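/- **Conventions.** Signature $(-,+,+,+)$. Let $(\mathcal M,g)$ be a smooth 4-dimensional Lorentzian manifold, with $R^{\kappa}{}_{\lambda\mu\nu}=\partial_\mu\Gamma^\kappa_{\nu\lambda}-\partial_\nu\Gamma^\kappa_{\mu\lambda}+\Gamma^\kappa_{\mu\sigma}\Gamma^\sigma_{\nu\lambda}-\Gamma^\kappa_{\nu\sigma}\Gamma^\sigma_{\mu\lambda}$, Weyl tensor $C_{\mu\nu\lambda\rho}$ and $Z_{\mu\nu\lambda\rho}=\Box C_{\mu\nu\lambda\rho}=g^{\sigma\tau}\nabla_\sigma\nabla_\tau C_{\mu\nu\lambda\rho}$. For a timelike unit vector $n$ ($n_\mu n^\mu=-1$) put $h_{\mu\nu}=g_{\mu\nu}+n_\mu n_\nu$, and for a rank-four tensor $T$ let $T^*_{\mu\nu\lambda\rho}=\tfrac12T_{\mu\nu\tau\sigma}\epsilon^{\tau\sigma}{}_{\lambda\rho}$, where $\epsilon$ is the volume form of either orientation. The $n$-electric and $n$-magnetic parts of $C$ are $$E_{\tau\sigma}=C_{\mu\nu\lambda\rho}h^\mu{}_\tau n^\nu h^\lambda{}_\sigma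 n^\rho,\qquad B_{\tau\sigma}=C^*_{\mu\nu\lambda\rho}h^\mu{}_\tau n^\nu h^\lambda{}_\sigma n^\rho,$$ and those of $Z$, defined in the same way, are $D_{\tau\sigma}$ and $H_{\tau\sigma}$. Given a 3-manifold $\mathcal S$ and symmetric tensors $h_{ij},K_{ij}$ on it, $(\mathcal S,h_{ij},K_{ij})$ is a slice of $(\mathcal M,g)$ if there is a smooth embedding $\phi:\mathcal S\to\mathcal M$ with smooth timelike unit normal $n$ such that $h_{ij}=(\phi^*g)_{ij}$ and $K_{ij}=\frac12(\phi^*\mathcal L_nh)_{ij}$; then $E_{ij},B_{ij},D_{ij},H_{ij}$ denote the pull-backs by $\phi$ of $E,B,D,H$. **Proposition.** (1) If $(\mathcal M,g)$ is vacuum ($R_{\mu\nu}=0$), then for every timelike unit vector $n$ $$D_{\mu\nu}=6\Big(E_{\mu\sigma}E^\sigma{}_\nu-\tfrac13h_{\mu\nu}E^{\sigma\tau}E_{\sigma\tau}\Big)-6\Big(B_{\mu\sigma}B^\sigma{}_\nu-\tfrac13h_{\mu\nu}B^{\sigma\tau}B_{\sigma\tau}\Big),$$ $$H_{\mu\nu}=12\Big(E^\sigma{}_{(\mu}B_{\nu)\sigma}-\tfrac13h_{\mu\nu}E_{\sigma\tau}B^{\sigma\tau}\Big),$$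 and the same formulas hold on every slice, with $h_{ij},E_{ij},B_{ij},D_{ij},H_{ij}$ in place of $h_{\mu\nu},E_{\mu\nu},B_{\mu\nu},D_{\mu\nu},H_{\mu\nu}$ and indices raised with the inverse of $h_{ij}$. (2) Let $(\mathcal S,h_{ij},K_{ij})$ be a slice of the Schwarzschild–Kruskal spacetime of mass $m>0$, that is, of $\{(T,X,\omega)\in\mathbb R\times\mathbb R\times S^2: T^2-X^2<1\}$ with the metric $\frac{32m^3}{r}e^{-r/2m}(-dT^2+dX^2)+r^2d\Omega^2$, where the standard Schwarzschild radial coordinate $r>0$ is given by $(1-\frac r{2m})e^{r/2m}=T^2-X^2$. Then $D_{ij}$ and $H_{ij}$ are the quadratic expressions of (1) in $E_{ij}$ and $B_{ij}$, and $$D_{ij}=\alpha E_{ij},\qquad H_{ij}=\alpha B_{ij},\qquad \alpha=-\frac{6m}{r^3}.$$ -/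

import Mathlib

open scoped Manifold ContDiff

noncomputable section

namespace GR

/-! ### Tensor calculus in a coordinate patch of `ℝ⁴`

Signature `(-,+,+,+)`. A covariant tensor field of rank `k` is given by its components
`T x α`, `α : Fin k → Fin 4`. -/

/-- Coordinate space `ℝⁿ`. -/
abbrev Eu (n : ℕ) := EuclideanSpace ℝ (Fin n)

/-- Coordinate basis vector. -/
abbrev ev {n : ℕ} (i : Fin n) : Eu n := EuclideanSpace.single i (1 : ℝ)

/-- Partial derivative `∂_μ f`. -/
def pd (μ : Fin 4) (f : Eu 4 → ℝ) (x : Eu 4) : ℝ := fderiv ℝ f x (ev μ)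

/-- Christoffel symbols `Γ^l_{μν}`. -/
def christoffel (G : Eu 4 → Matrix (Fin 4) (Fin 4) ℝ) (l μ ν : Fin 4) (x : Eu 4) : ℝ :=
  (1 / 2) * ∑ κ, (G x)⁻¹ l κ *
    (pd μ (fun y => G y κ ν) x + pd ν (fun y => G y κ μ) x - pd κ (fun y => G y μ ν) x)

/-- `R^κ_{lμν} = ∂_μ Γ^κ_{νl} - ∂_ν Γ^κ_{μl} + Γ^κ_{μσ} Γ^σ_{νl} - Γ^κ_{νσ} Γ^σ_{μl}`. -/
def riemannUp (G : Eu 4 → Matrix (Fin 4) (Fin 4) ℝ) (κ l μ ν : Fin 4) (x : Eu 4) : ℝ :=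
  pd μ (christoffel G κ ν l) x - pd ν (christoffel G κ μ l) x
    + ∑ σ, (christoffel G κ μ σ x * christoffel G σ ν l x
      - christoffel G κ ν σ x * christoffel G σ μ l x)

/-- `R_{κlμν}`. -/
def riemann (G : Eu 4 → Matrix (Fin 4) (Fin 4) ℝ) (κ l μ ν : Fin 4) (x : Eu 4) : ℝ :=
  ∑ σ, G x κ σ * riemannUp G σ l μ ν x

/-- `R_{lν} = R^κ_{lκν}`. -/
def ricci (G : Eu 4 → Matrix (Fin 4) (Fin 4) ℝ) (l ν : Fin 4) (x : Eu 4) : ℝ :=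
  ∑ κ, riemannUp G κ l κ ν x

/-- The Ricci scalar. -/
def scalarCurv (G : Eu 4 → Matrix (Fin 4) (Fin 4) ℝ) (x : Eu 4) : ℝ :=
  ∑ l, ∑ ν, (G x)⁻¹ l ν * ricci G l ν x

/-- The Weyl tensor `C_{κlμν}` (dimension four). -/
def weyl (G : Eu 4 → Matrix (Fin 4) (Fin 4) ℝ) (x : Eu 4) (α : Fin 4 → Fin 4) : ℝ :=
  riemann G (α 0) (α 1) (α 2) (α 3) x
    - (1 / 2) * (G x (α 0) (α 2) * ricci G (α 1) (α 3) x - G x (α 0) (α 3) * ricci G (α 1) (α 2) x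
      - G x (α 1) (α 2) * ricci G (α 0) (α 3) x + G x (α 1) (α 3) * ricci G (α 0) (α 2) x)
    + (scalarCurv G x / 6)
      * (G x (α 0) (α 2) * G x (α 1) (α 3) - G x (α 0) (α 3) * G x (α 1) (α 2))

/-- The covariant derivative; the new (differentiation) index is the first one:
`(∇T)(x)(σ, α) = ∂_σ T_α - ∑ᵢ Γ^τ_{σ αᵢ} T_{α with αᵢ replaced by τ}`. -/
def covDeriv (G : Eu 4 → Matrix (Fin 4) (Fin 4) ℝ) {k : ℕ}
    (T : Eu 4 → (Fin k → Fin 4) → ℝ) (x : Eu 4) (β : Fin (k + 1) → Fin 4) : ℝ :=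
  pd (β 0) (fun y => T y (Fin.tail β)) x
    - ∑ i : Fin k, ∑ τ : Fin 4,
        christoffel G τ (β 0) (Fin.tail β i) x * T x (Function.update (Fin.tail β) i τ)

/-- The d'Alembertian `g^{στ} ∇_σ ∇_τ T`. -/
def dAlembertian (G : Eu 4 → Matrix (Fin 4) (Fin 4) ℝ) {k : ℕ}
    (T : Eu 4 → (Fin k → Fin 4) → ℝ) (x : Eu 4) (α : Fin k → Fin 4) : ℝ :=
  ∑ σ, ∑ τ, (G x)⁻¹ σ τ *
    covDeriv G (covDeriv G T) x (Fin.cons σ (Fin.cons τ α : Fin (k + 1) → Fin 4))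

/-! ### Electric and magnetic parts at a point

`g` is the matrix of metric components at the point, `n` a timelike unit vector, `T` the components
of a tensor of rank four. -/

/-- `n_μ = g_{μκ} n^κ`. -/
def lower (g : Matrix (Fin 4) (Fin 4) ℝ) (n : Eu 4) (μ : Fin 4) : ℝ := ∑ κ, g μ κ * n κ

/-- The projector `h^μ_ν = δ^μ_ν + n^μ n_ν`. -/
def proj (g : Matrix (Fin 4) (Fin 4) ℝ) (n : Eu 4) (μ ν : Fin 4) : ℝ :=
  (if μ = ν then 1 else 0) + n μ * lower g n ν

/-- `h_{μν} = g_{μν} + n_μ n_ν`. -/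
def spatialMetric (g : Matrix (Fin 4) (Fin 4) ℝ) (n : Eu 4) : Matrix (Fin 4) (Fin 4) ℝ :=
  Matrix.of fun μ ν => g μ ν + lower g n μ * lower g n ν

/-- The volume form `ε_{α₀α₁α₂α₃}`; the sign `o` is the orientation. The determinant is the
totally antisymmetric symbol with value `1` at `(0,1,2,3)`. -/
def volForm (g : Matrix (Fin 4) (Fin 4) ℝ) (o : ℤˣ) (α : Fin 4 → Fin 4) : ℝ :=
  ((o : ℤ) : ℝ) * Real.sqrt |g.det|
    * (Matrix.of fun i j : Fin 4 => if α i = j then (1 : ℝ) else 0).det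

/-- The dual `T*_{μνlρ} = ½ T_{μνab} ε^{ab}_{lρ}`. -/
def dual (g : Matrix (Fin 4) (Fin 4) ℝ) (o : ℤˣ) (T : (Fin 4 → Fin 4) → ℝ)
    (α : Fin 4 → Fin 4) : ℝ :=
  (1 / 2) * ∑ a, ∑ b, ∑ c, ∑ d,
    T ![α 0, α 1, a, b] * (g⁻¹ a c * g⁻¹ b d * volForm g o ![c, d, α 2, α 3])

/-- The `n`-electric part `T_{μνlρ} h^μ_τ n^ν h^l_σ n^ρ`. -/
def electric (g : Matrix (Fin 4) (Fin 4) ℝ) (n : Eu 4) (T : (Fin 4 → Fin 4) → ℝ) :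
    Matrix (Fin 4) (Fin 4) ℝ :=
  Matrix.of fun τ σ => ∑ μ, ∑ ν, ∑ l, ∑ ρ,
    T ![μ, ν, l, ρ] * proj g n μ τ * n ν * proj g n l σ * n ρ

/-- The `n`-magnetic part `T*_{μνlρ} h^μ_τ n^ν h^l_σ n^ρ`. -/
def magnetic (g : Matrix (Fin 4) (Fin 4) ℝ) (o : ℤˣ) (n : Eu 4) (T : (Fin 4 → Fin 4) → ℝ) :
    Matrix (Fin 4) (Fin 4) ℝ :=
  electric g n (dual g o T)

/-! ### The quadratic expressions; `q` is the inverse metric used to raise indices -/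

/-- `X_{στ} Y^{στ}`. -/
def contract {ι : Type} [Fintype ι] (q X Y : Matrix ι ι ℝ) : ℝ :=
  ∑ σ, ∑ τ, ∑ κ, ∑ l, X σ τ * (q σ κ * q τ l * Y κ l)

/-- `6 (E_{μσ} E^σ_ν - ⅓ h_{μν} E^{στ} E_{στ}) - 6 (B_{μσ} B^σ_ν - ⅓ h_{μν} B^{στ} B_{στ})`. -/
def quadElectric {ι : Type} [Fintype ι] (q h E B : Matrix ι ι ℝ) : Matrix ι ι ℝ :=
  (6 : ℝ) • (E * q * E - ((1 / 3) * contract q E E) • h)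
    - (6 : ℝ) • (B * q * B - ((1 / 3) * contract q B B) • h)

/-- `12 (E^σ_{(μ} B_{ν)σ} - ⅓ h_{μν} E_{στ} B^{στ})`. -/
def quadMagnetic {ι : Type} [Fintype ι] (q h E B : Matrix ι ι ℝ) : Matrix ι ι ℝ :=
  (12 : ℝ) • ((1 / 2 : ℝ) • (B * q * E + (B * q * E).transpose)
    - ((1 / 3) * contract q E B) • h)

/-! ### Spacetimes -/

section Manifold

variable {M : Type*} [TopologicalSpace M] [ChartedSpace (Eu 4) M]

/-- A field of bilinear forms on the tangent spaces. -/
abbrev BilinField (n : ℕ) (M : Type*) [TopologicalSpace M] [ChartedSpace (Eu n) M] :=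
  ∀ p : M, TangentSpace (𝓡 n) p →L[ℝ] TangentSpace (𝓡 n) p →L[ℝ] ℝ

/-- Smooth Lorentzian metrics of signature `(-,+,+,+)`. -/
structure IsLorentzMetric [IsManifold (𝓡 4) ∞ M] (g : BilinField 4 M) : Prop where
  smooth : ContMDiff (𝓡 4) ((𝓡 4).prod 𝓘(ℝ, Eu 4 →L[ℝ] Eu 4 →L[ℝ] ℝ)) ∞
    (fun p => Bundle.TotalSpace.mk' (Eu 4 →L[ℝ] Eu 4 →L[ℝ] ℝ)
      (E := fun p : M => TangentSpace (𝓡 4) p →L[ℝ] TangentSpace (𝓡 4) p →L[ℝ] ℝ) p (g p))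
  symm : ∀ p v w, g p v w = g p w v
  signature : ∀ p, ∃ t, g p t t < 0 ∧ ∀ v, g p t v = 0 → v ≠ 0 → 0 < g p v v

/-- The components of the metric in the chart around `p`, as functions of the coordinates. -/
def chartMetric (g : BilinField 4 M) (p : M) (y : Eu 4) : Matrix (Fin 4) (Fin 4) ℝ :=
  Matrix.of fun μ ν =>
    g ((extChartAt (𝓡 4) p).symm y)
      (mfderiv (𝓡 4) (𝓡 4) (extChartAt (𝓡 4) p).symm y (ev μ))
      (mfderiv (𝓡 4) (𝓡 4) (extChartAt (𝓡 4) p).symm y (ev ν))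

/-- The vacuum equations: the Ricci tensor vanishes, in the charts of the manifold. -/
def IsVacuum (g : BilinField 4 M) : Prop :=
  ∀ p : M, ∀ y ∈ (extChartAt (𝓡 4) p).target, ∀ μ ν, ricci (chartMetric g p) μ ν y = 0

/-- The components of the metric at `p`. The tangent space at `p` is `ℝ⁴` by means of the
coordinate basis of the chart around `p`; all components at `p` refer to it. -/
def metricAt (g : BilinField 4 M) (p : M) : Matrix (Fin 4) (Fin 4) ℝ :=
  Matrix.of fun μ ν => g p (ev μ : Eu 4) (ev ν : Eu 4)

/-- The Weyl tensor at `p`. -/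
def weylAt (g : BilinField 4 M) (p : M) : (Fin 4 → Fin 4) → ℝ :=
  weyl (chartMetric g p) (extChartAt (𝓡 4) p p)

/-- `Z = □C` at `p`. -/
def boxWeylAt (g : BilinField 4 M) (p : M) : (Fin 4 → Fin 4) → ℝ :=
  dAlembertian (chartMetric g p) (weyl (chartMetric g p)) (extChartAt (𝓡 4) p p)

/-- `E_{μν}` at `p`, for the unit vector `n`. -/
def tensorE (g : BilinField 4 M) (p : M) (n : TangentSpace (𝓡 4) p) : Matrix (Fin 4) (Fin 4) ℝ :=
  electric (metricAt g p) n (weylAt g p)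

/-- `B_{μν}` at `p`, for the unit vector `n` and the orientation `o` of the tangent space. -/
def tensorB (g : BilinField 4 M) (o : M → ℤˣ) (p : M) (n : TangentSpace (𝓡 4) p) :
    Matrix (Fin 4) (Fin 4) ℝ :=
  magnetic (metricAt g p) (o p) n (weylAt g p)

/-- `D_{μν}` at `p`: the electric part of `Z`. -/
def tensorD (g : BilinField 4 M) (p : M) (n : TangentSpace (𝓡 4) p) : Matrix (Fin 4) (Fin 4) ℝ :=
  electric (metricAt g p) n (boxWeylAt g p)

/-- `H_{μν}` at `p`: the magnetic part of `Z`. -/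
def tensorH (g : BilinField 4 M) (o : M → ℤˣ) (p : M) (n : TangentSpace (𝓡 4) p) :
    Matrix (Fin 4) (Fin 4) ℝ :=
  magnetic (metricAt g p) (o p) n (boxWeylAt g p)

/-! ### Slices -/

variable {S : Type*} [TopologicalSpace S] [ChartedSpace (Eu 3) S]

/-- The Jacobian `∂_i φ^μ` at `s`. -/
def jacobian (φ : S → M) (s : S) : Matrix (Fin 4) (Fin 3) ℝ :=
  Matrix.of fun μ i => (show Eu 4 from mfderiv (𝓡 3) (𝓡 4) φ s (ev i : Eu 3)) μ

/-- Pull-back `(φ^* X)_{ij} = X_{μν} ∂_i φ^μ ∂_j φ^ν` at `s`. -/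
def pull (φ : S → M) (s : S) (X : Matrix (Fin 4) (Fin 4) ℝ) : Matrix (Fin 3) (Fin 3) ℝ :=
  (jacobian φ s).transpose * X * jacobian φ s

/-- The covariant derivative `∇_u n` of a vector field `n` along `φ`, with components
`u(n^l) + Γ^l_{μν} (dφ u)^μ n^ν` in the chart around `φ s`. -/
def covAlong (g : BilinField 4 M) (φ : S → M) (n : ∀ s, TangentSpace (𝓡 4) (φ s)) (s : S)
    (u : TangentSpace (𝓡 3) s) : TangentSpace (𝓡 4) (φ s) :=
  let e := extChartAt (𝓡 4) (φ s)
  let dn : Eu 4 := mfderiv (𝓡 3) (𝓡 4)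
    (fun s' => (show Eu 4 from mfderiv (𝓡 4) (𝓡 4) e (φ s') (n s'))) s u
  let du : Eu 4 := mfderiv (𝓡 3) (𝓡 4) φ s u
  let ns : Eu 4 := n s
  (WithLp.toLp 2 (fun l => dn l + ∑ μ, ∑ ν,
    christoffel (chartMetric g (φ s)) l μ ν (e (φ s)) * du μ * ns ν) : Eu 4)

/-- `(S, h, K)` is the initial data set induced on `S` by the embedding `φ` into `(M, g)`, with
timelike unit normal `n`: `h = φ^* g`, and `K(u, v) = g(∇_u n, dφ v)`, which is
`½ φ^*(L_n h)`. -/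
structure IsSlice [IsManifold (𝓡 4) ∞ M] (g : BilinField 4 M) (φ : S → M) (n : ∀ s, TangentSpace (𝓡 4) (φ s))
    (h K : BilinField 3 S) : Prop where
  embedding : Manifold.IsSmoothEmbedding (𝓡 3) (𝓡 4) ∞ φ
  normal_smooth : ContMDiff (𝓡 3) (𝓡 4).tangent ∞
    (fun s => (⟨φ s, n s⟩ : TangentBundle (𝓡 4) M))
  normal_unit : ∀ s, g (φ s) (n s) (n s) = -1
  normal_orthogonal : ∀ s u, g (φ s) (n s) (mfderiv (𝓡 3) (𝓡 4) φ s u) = 0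
  first : ∀ s u v,
    h s u v = g (φ s) (mfderiv (𝓡 3) (𝓡 4) φ s u) (mfderiv (𝓡 3) (𝓡 4) φ s v)
  second : ∀ s u v, K s u v = g (φ s) (covAlong g φ n s u) (mfderiv (𝓡 3) (𝓡 4) φ s v)

/-- The components `h_{ij}` at `s`. -/
def dataMetric (h : BilinField 3 S) (s : S) : Matrix (Fin 3) (Fin 3) ℝ :=
  Matrix.of fun i j => h s (ev i : Eu 3) (ev j : Eu 3)

/-- `E_{ij} = (φ^* E)_{ij}`. -/
def sliceE (g : BilinField 4 M) (φ : S → M) (n : ∀ s, TangentSpace (𝓡 4) (φ s)) (s : S) :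
    Matrix (Fin 3) (Fin 3) ℝ :=
  pull φ s (tensorE g (φ s) (n s))

/-- `B_{ij} = (φ^* B)_{ij}`. -/
def sliceB (g : BilinField 4 M) (o : M → ℤˣ) (φ : S → M) (n : ∀ s, TangentSpace (𝓡 4) (φ s))
    (s : S) : Matrix (Fin 3) (Fin 3) ℝ :=
  pull φ s (tensorB g o (φ s) (n s))

/-- `D_{ij} = (φ^* D)_{ij}`. -/
def sliceD (g : BilinField 4 M) (φ : S → M) (n : ∀ s, TangentSpace (𝓡 4) (φ s)) (s : S) :
    Matrix (Fin 3) (Fin 3) ℝ :=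
  pull φ s (tensorD g (φ s) (n s))

/-- `H_{ij} = (φ^* H)_{ij}`. -/
def sliceH (g : BilinField 4 M) (o : M → ℤˣ) (φ : S → M) (n : ∀ s, TangentSpace (𝓡 4) (φ s))
    (s : S) : Matrix (Fin 3) (Fin 3) ℝ :=
  pull φ s (tensorH g o (φ s) (n s))

end Manifold

/-! ### The Schwarzschild--Kruskal spacetime

The Kruskal manifold is the set of `(T, X, ω) ∈ ℝ × ℝ × S²` with `T² - X² < 1`, with the metric
`(32 m³ / r) e^{-r/2m} (-dT² + dX²) + r² dΩ²`, where `(1 - r/2m) e^{r/2m} = T² - X²`.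
It is realised here as an open subset of `ℝ⁴ ∋ (T, y)`, `y ∈ ℝ³ ∖ {0}`, by means of the
diffeomorphism `(X, ω) ↦ y = e^X ω` of `ℝ × S²` onto `ℝ³ ∖ {0}`. -/

/-- `|y|²` for the point `(T, y)`. -/
def normSq (p : Eu 4) : ℝ := ∑ i : Fin 3, p i.succ ^ 2

/-- The Kruskal coordinate `X = log |y|`. -/
def kX (p : Eu 4) : ℝ := Real.log (Real.sqrt (normSq p))

/-- The Kruskal manifold. -/
def kruskalRegion : TopologicalSpace.Opens (Eu 4) where
  carrier := {p | normSq p ≠ 0 ∧ p 0 ^ 2 - kX p ^ 2 < 1}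
  is_open' := by
    have hc : Continuous normSq := by unfold normSq; fun_prop
    have h1 : IsOpen {p | normSq p ≠ 0} := isOpen_ne_fun hc continuous_const
    have h2 : ContinuousOn (fun p : Eu 4 => p 0 ^ 2 - kX p ^ 2) {p | normSq p ≠ 0} := by
      have h3 : ContinuousOn kX {p | normSq p ≠ 0} := by
        refine ContinuousOn.log (Real.continuous_sqrt.comp hc).continuousOn fun p hp => ?_
        have : 0 ≤ normSq p := Finset.sum_nonneg fun i _ => sq_nonneg _
        exact (Real.sqrt_pos.2 (lt_of_le_of_ne this (Ne.symm hp))).ne'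
      have h4 : Continuous (fun p : Eu 4 => p 0 ^ 2) := by fun_prop
      exact h4.continuousOn.sub (h3.pow 2)
    exact h2.isOpen_inter_preimage h1 isOpen_Iio

/-- `x = r / 2m` is determined by `(1 - x) e^x = T² - X²` and `x > 0`. -/
theorem existsUnique_radius {s : ℝ} (hs : s < 1) :
    ∃! x : ℝ, 0 < x ∧ (1 - x) * Real.exp x = s := by
  have hd : ∀ x : ℝ, HasDerivAt (fun x : ℝ => (1 - x) * Real.exp x) (-x * Real.exp x) x := by
    intro x
    have h := ((hasDerivAt_id' x).const_sub 1).fun_mul (Real.hasDerivAt_exp x)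
    exact h.congr_deriv (by ring)
  have hanti : StrictAntiOn (fun x : ℝ => (1 - x) * Real.exp x) (Set.Ici 0) := by
    refine strictAntiOn_of_deriv_neg (convex_Ici 0) (by fun_prop) fun x hx => ?_
    rw [interior_Ici] at hx
    rw [(hd x).deriv]
    have := mul_pos (Set.mem_Ioi.1 hx) (Real.exp_pos x)
    linarith
  have hex : ∃ x ∈ Set.Icc (0 : ℝ) (2 + |s|), (1 - x) * Real.exp x = s := by
    refine intermediate_value_Icc' (by positivity)
      (f := fun x : ℝ => (1 - x) * Real.exp x) (by fun_prop) ⟨?_, by simpa using hs.le⟩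
    have h1 := Real.one_le_exp (show (0 : ℝ) ≤ 2 + |s| by positivity)
    have h2 := neg_abs_le s
    have h3 := abs_nonneg s
    nlinarith
  obtain ⟨x, hx, hxs⟩ := hex
  have hx0 : x ≠ 0 := by
    rintro rfl
    simp at hxs
    linarith
  refine ⟨x, ⟨lt_of_le_of_ne hx.1 hx0.symm, hxs⟩, fun y hy => ?_⟩
  exact hanti.injOn (Set.mem_Ici.2 hy.1.le) (Set.mem_Ici.2 hx.1) (hy.2.trans hxs.symm)

open Classical in
/-- The standard Schwarzschild radial coordinate `r > 0` on the Kruskal manifold, given by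
`(1 - r/2m) e^{r/2m} = T² - X²`. -/
def radius (m : ℝ) (p : Eu 4) : ℝ :=
  if hp : p 0 ^ 2 - kX p ^ 2 < 1 then 2 * m * (existsUnique_radius hp).choose else 0

/-- The covector `dx^i` on `ℝ⁴`. -/
abbrev dx (i : Fin 4) : Eu 4 →L[ℝ] ℝ := EuclideanSpace.proj i

/-- The covector `dX = |y|⁻² ∑ yᵢ dyᵢ` at `p`. -/
def dX (p : Eu 4) : Eu 4 →L[ℝ] ℝ := (normSq p)⁻¹ • ∑ i : Fin 3, p i.succ • dx i.succ

/-- Tensor product of covectors. -/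
def tens (a b : Eu 4 →L[ℝ] ℝ) : Eu 4 →L[ℝ] Eu 4 →L[ℝ] ℝ := a.smulRight b

/-- The round metric `dΩ² = |d(y/|y|)|² = |y|⁻² |dy|² - dX²` at `p`. -/
def dOmega (p : Eu 4) : Eu 4 →L[ℝ] Eu 4 →L[ℝ] ℝ :=
  (normSq p)⁻¹ • (∑ i : Fin 3, tens (dx i.succ) (dx i.succ)) - tens (dX p) (dX p)

/-- The form `(32 m³ / r) e^{-r/2m} (-dT² + dX²) + r² dΩ²` at `p`. -/
def kruskalForm (m : ℝ) (p : Eu 4) : Eu 4 →L[ℝ] Eu 4 →L[ℝ] ℝ :=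
  (32 * m ^ 3 / radius m p * Real.exp (-(radius m p) / (2 * m))) •
      (-tens (dx 0) (dx 0) + tens (dX p) (dX p))
    + (radius m p ^ 2) • dOmega p

/-- The Kruskal metric. -/
def kruskalMetric (m : ℝ) : BilinField 4 kruskalRegion := fun p => kruskalForm m p

end GR

end

/-! In vacuum the Weyl tensor is the full curvature tensor, and it satisfies a wave equation with
quadratic source. The second Bianchi identity turns g^{ef}∇_e∇_f R_{abcd} into g^{ef}∇_e∇_c R_{abfd}
minus the same expression with c and d exchanged. Commuting the two derivatives produces the
derivative of a divergence, which vanishes because the Ricci tensor does, plus terms quadratic in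
the curvature. The result is `MetricOn.box_weyl`: □C equals the algebraic expression `boxQuad` in C.

What remains of part (1) is pointwise algebra. In an orthonormal frame with first leg n, a tensor
with the Weyl symmetries has ten free components, five electric and five magnetic, and the electric
and magnetic parts of `boxQuad` are quadratic polynomials in them (`IsWeylFrame.quad`). Such a frame
exists for every timelike unit vector (`IsLorentzMatrix.exists_frame`), and the formulas pass
between bases by congruence. For a slice with Jacobian J, the matrix J h⁻¹ Jᵀ equals g⁻¹ + n⊗n
(`IsLorentzMatrix.restrict_inv`). Since E and B annihilate n, this may replace g⁻¹ in every
contraction, so the formulas pull back.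

For Kruskal, the connection and curvature are found explicitly in terms of the forms dT, dX, dΩ².
The curvature formula is a polynomial identity modulo x · x⁻¹ = 1 and e^{-x}(T² - X²) = 1 - x, where
x = r/2m (`curvature_kΓ`). The metric is therefore vacuum. In a frame adapted to ∂_T, ∂_X and the
spheres, the curvature is m/r³ times a fixed integer tensor, on which the quadratic source acts as
multiplication by -6 (`frameCurvQuad_eq`). Hence □C = -(6m/r³) C as an equation between full
tensors, so the proportionality descends to every normal n and every slice by linearity. -/

noncomputable section

namespace GR

section

/-! ### Partial derivatives of smooth functions on an open set -/

section pd

variable {U : Set (Eu 4)} {f f' : Eu 4 → ℝ} {x : Eu 4}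

theorem differentiableAt_of_smoothOn (hU : IsOpen U) (hf : ContDiffOn ℝ ∞ f U) (hx : x ∈ U) :
    DifferentiableAt ℝ f x :=
  (hf.differentiableOn (by simp)).differentiableAt (hU.mem_nhds hx)

theorem pd_congr (hU : IsOpen U) (h : ∀ y ∈ U, f y = f' y) (hx : x ∈ U) (μ : Fin 4) :
    pd μ f x = pd μ f' x := by
  unfold pd
  rw [Filter.EventuallyEq.fderiv_eq (Filter.eventually_of_mem (hU.mem_nhds hx) h)]

theorem smoothOn_pd (hU : IsOpen U) (hf : ContDiffOn ℝ ∞ f U) (μ : Fin 4) :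
    ContDiffOn ℝ ∞ (pd μ f) U :=
  (hf.fderiv_of_isOpen hU (m := ∞) (by simp)).clm_apply contDiffOn_const

theorem pd_const (c : ℝ) (μ : Fin 4) : pd μ (fun _ => c) x = 0 := by simp [pd]

theorem pd_add (hf : DifferentiableAt ℝ f x) (hf' : DifferentiableAt ℝ f' x) (μ : Fin 4) :
    pd μ (fun y => f y + f' y) x = pd μ f x + pd μ f' x := by
  simp [pd, fderiv_fun_add hf hf']

theorem pd_sub (hf : DifferentiableAt ℝ f x) (hf' : DifferentiableAt ℝ f' x) (μ : Fin 4) :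
    pd μ (fun y => f y - f' y) x = pd μ f x - pd μ f' x := by
  simp [pd, fderiv_fun_sub hf hf']

theorem pd_mul (hf : DifferentiableAt ℝ f x) (hf' : DifferentiableAt ℝ f' x) (μ : Fin 4) :
    pd μ (fun y => f y * f' y) x = pd μ f x * f' x + f x * pd μ f' x := by
  simp [pd, fderiv_fun_mul hf hf']; ring

theorem pd_const_mul (hf : DifferentiableAt ℝ f x) (c : ℝ) (μ : Fin 4) :
    pd μ (fun y => c * f y) x = c * pd μ f x := by
  simp [pd, fderiv_const_mul hf]

theorem pd_sum {ι : Type*} (s : Finset ι) {F : ι → Eu 4 → ℝ}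
    (hF : ∀ i ∈ s, DifferentiableAt ℝ (F i) x) (μ : Fin 4) :
    pd μ (fun y => ∑ i ∈ s, F i y) x = ∑ i ∈ s, pd μ (F i) x := by
  simp [pd, fderiv_fun_sum hF]

theorem pd_comm (hU : IsOpen U) (hf : ContDiffOn ℝ ∞ f U) (hx : x ∈ U) (μ ν : Fin 4) :
    pd μ (pd ν f) x = pd ν (pd μ f) x := by
  have hfx : ContDiffAt ℝ ∞ f x := hf.contDiffAt (hU.mem_nhds hx)
  have hd : DifferentiableAt ℝ (fderiv ℝ f) x :=
    ((hfx.fderiv_right (m := 1) (WithTop.coe_le_coe.2 le_top)).differentiableAt (by simp))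
  have key : ∀ a b : Fin 4, pd a (pd b f) x = fderiv ℝ (fderiv ℝ f) x (ev a) (ev b) := by
    intro a b
    unfold pd
    rw [fderiv_clm_apply hd (differentiableAt_const _)]
    simp
  rw [key, key]
  exact (hfx.isSymmSndFDerivAt
    (by simpa using WithTop.coe_le_coe.2 (le_top : (2 : ℕ∞) ≤ ⊤))).eq _ _

end pd

/-! ### Metrics in a coordinate patch -/

/-- `G` is a smooth field of nondegenerate symmetric matrices on the open set `U`. -/
structure MetricOn (G : Eu 4 → Matrix (Fin 4) (Fin 4) ℝ) (U : Set (Eu 4)) : Prop where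
  isOpen : IsOpen U
  smooth : ∀ μ ν, ContDiffOn ℝ ∞ (fun y => G y μ ν) U
  symm : ∀ x ∈ U, ∀ μ ν, G x μ ν = G x ν μ
  det_ne : ∀ x ∈ U, (G x).det ≠ 0

namespace MetricOn

variable {G : Eu 4 → Matrix (Fin 4) (Fin 4) ℝ} {U : Set (Eu 4)} {x : Eu 4}

theorem diffAt (hG : MetricOn G U) {f : Eu 4 → ℝ} (hf : ContDiffOn ℝ ∞ f U) (hx : x ∈ U) :
    DifferentiableAt ℝ f x := differentiableAt_of_smoothOn hG.isOpen hf hx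

theorem smooth_det {F : Eu 4 → Matrix (Fin 4) (Fin 4) ℝ}
    (hF : ∀ μ ν, ContDiffOn ℝ ∞ (fun y => F y μ ν) U) :
    ContDiffOn ℝ ∞ (fun y => (F y).det) U := by
  simp only [Matrix.det_apply']
  exact ContDiffOn.sum fun σ _ => contDiffOn_const.mul (contDiffOn_prod fun i _ => hF _ _)

theorem smooth_inv (hG : MetricOn G U) (μ ν : Fin 4) :
    ContDiffOn ℝ ∞ (fun y => (G y)⁻¹ μ ν) U := by
  -- Cramer's rule exhibits the entries of the inverse as quotients of polynomials in the entries of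
  -- `G`.
  have h : ∀ y, (G y)⁻¹ μ ν = ((G y).det)⁻¹ * ((G y).updateRow ν (Pi.single μ 1)).det := by
    intro y
    rw [Matrix.inv_def, Matrix.smul_apply, Matrix.adjugate_apply, Ring.inverse_eq_inv', smul_eq_mul]
  simp only [h]
  refine ((smooth_det hG.smooth).inv hG.det_ne).mul (smooth_det fun a b => ?_)
  by_cases hab : a = ν
  · subst hab; simp only [Matrix.updateRow_self]; exact contDiffOn_const
  · simp only [Matrix.updateRow_ne hab]; exact hG.smooth a b

theorem transpose_eq (hG : MetricOn G U) (hx : x ∈ U) : (G x).transpose = G x := by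
  ext i j; exact hG.symm x hx j i

theorem inv_symm (hG : MetricOn G U) (hx : x ∈ U) (μ ν : Fin 4) :
    (G x)⁻¹ μ ν = (G x)⁻¹ ν μ := by
  conv_lhs => rw [← hG.transpose_eq hx, ← Matrix.transpose_nonsing_inv]
  rfl

theorem sum_mul_inv (hG : MetricOn G U) (hx : x ∈ U) (μ ν : Fin 4) :
    ∑ κ, G x μ κ * (G x)⁻¹ κ ν = if μ = ν then 1 else 0 := by
  rw [← Matrix.mul_apply, Matrix.mul_nonsing_inv _ (isUnit_iff_ne_zero.2 (hG.det_ne x hx)),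
    Matrix.one_apply]

theorem sum_inv_mul (hG : MetricOn G U) (hx : x ∈ U) (μ ν : Fin 4) :
    ∑ κ, (G x)⁻¹ μ κ * G x κ ν = if μ = ν then 1 else 0 := by
  rw [← Matrix.mul_apply, Matrix.nonsing_inv_mul _ (isUnit_iff_ne_zero.2 (hG.det_ne x hx)),
    Matrix.one_apply]

theorem sum_lower_raise (hG : MetricOn G U) (hx : x ∈ U) (v : Fin 4 → ℝ) (μ : Fin 4) :
    ∑ κ, G x μ κ * ∑ ν, (G x)⁻¹ κ ν * v ν = v μ := by
  simp_rw [Finset.mul_sum, ← mul_assoc]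
  rw [Finset.sum_comm]
  simp_rw [← Finset.sum_mul, hG.sum_mul_inv hx]
  simp

theorem sum_raise_lower (hG : MetricOn G U) (hx : x ∈ U) (v : Fin 4 → ℝ) (μ : Fin 4) :
    ∑ κ, (G x)⁻¹ μ κ * ∑ ν, G x κ ν * v ν = v μ := by
  simp_rw [Finset.mul_sum, ← mul_assoc]
  rw [Finset.sum_comm]
  simp_rw [← Finset.sum_mul, hG.sum_inv_mul hx]
  simp

theorem smooth_christoffel (hG : MetricOn G U) (l μ ν : Fin 4) :
    ContDiffOn ℝ ∞ (christoffel G l μ ν) U := by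
  unfold christoffel
  refine contDiffOn_const.mul (ContDiffOn.sum fun κ _ => (hG.smooth_inv l κ).mul ?_)
  exact ((smoothOn_pd hG.isOpen (hG.smooth _ _) _).add
    (smoothOn_pd hG.isOpen (hG.smooth _ _) _)).sub (smoothOn_pd hG.isOpen (hG.smooth _ _) _)

theorem smooth_riemannUp (hG : MetricOn G U) (κ l μ ν : Fin 4) :
    ContDiffOn ℝ ∞ (riemannUp G κ l μ ν) U := by
  unfold riemannUp
  refine ((smoothOn_pd hG.isOpen (hG.smooth_christoffel _ _ _) _).sub
    (smoothOn_pd hG.isOpen (hG.smooth_christoffel _ _ _) _)).add (ContDiffOn.sum fun σ _ => ?_)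
  exact ((hG.smooth_christoffel _ _ _).mul (hG.smooth_christoffel _ _ _)).sub
    ((hG.smooth_christoffel _ _ _).mul (hG.smooth_christoffel _ _ _))

theorem smooth_riemann (hG : MetricOn G U) (κ l μ ν : Fin 4) :
    ContDiffOn ℝ ∞ (riemann G κ l μ ν) U := by
  unfold riemann
  exact ContDiffOn.sum fun σ _ => (hG.smooth _ _).mul (hG.smooth_riemannUp _ _ _ _)

theorem christoffel_symm (hG : MetricOn G U) (hx : x ∈ U) (l μ ν : Fin 4) :
    christoffel G l μ ν x = christoffel G l ν μ x := by
  unfold christoffel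
  congr 1
  refine Finset.sum_congr rfl fun κ _ => ?_
  rw [pd_congr hG.isOpen (fun y hy => hG.symm y hy μ ν) hx κ]
  ring

/-- The Christoffel symbols with lowered first index. -/
theorem lower_christoffel (hG : MetricOn G U) (hx : x ∈ U) (κ μ ν : Fin 4) :
    ∑ l, G x κ l * christoffel G l μ ν x = (1 / 2) *
      (pd μ (fun y => G y κ ν) x + pd ν (fun y => G y κ μ) x - pd κ (fun y => G y μ ν) x) := by
  unfold christoffel
  simp_rw [mul_left_comm (G x κ _) (1 / 2 : ℝ)]
  rw [← Finset.mul_sum, hG.sum_lower_raise hx]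

/-- The metric is parallel. -/
theorem pd_metric (hG : MetricOn G U) (hx : x ∈ U) (σ μ ν : Fin 4) :
    pd σ (fun y => G y μ ν) x =
      ∑ l, G x μ l * christoffel G l σ ν x + ∑ l, G x ν l * christoffel G l σ μ x := by
  rw [hG.lower_christoffel hx, hG.lower_christoffel hx,
    pd_congr hG.isOpen (fun y hy => hG.symm y hy ν μ) hx σ,
    pd_congr hG.isOpen (fun y hy => hG.symm y hy σ μ) hx ν,
    pd_congr hG.isOpen (fun y hy => hG.symm y hy σ ν) hx μ]
  ring

/-- The inverse metric is parallel. -/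
theorem pd_inv (hG : MetricOn G U) (hx : x ∈ U) (σ μ ν : Fin 4) :
    pd σ (fun y => (G y)⁻¹ μ ν) x =
      -∑ l, christoffel G μ σ l x * (G x)⁻¹ l ν - ∑ l, christoffel G ν σ l x * (G x)⁻¹ μ l := by
  set Γ : Matrix (Fin 4) (Fin 4) ℝ := Matrix.of fun a b => christoffel G a σ b x with hΓ
  set D : Matrix (Fin 4) (Fin 4) ℝ := Matrix.of fun a b => pd σ (fun y => (G y)⁻¹ a b) x with hD
  set D' : Matrix (Fin 4) (Fin 4) ℝ := Matrix.of fun a b => pd σ (fun y => G y a b) x with hD'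
  have hdet := isUnit_iff_ne_zero.2 (hG.det_ne x hx)
  have hD'Γ : D' = G x * Γ + (G x * Γ).transpose := by
    ext a b
    simp only [hD', hΓ, Matrix.add_apply, Matrix.mul_apply, Matrix.transpose_apply, Matrix.of_apply]
    exact hG.pd_metric hx σ a b
  -- This is the derivative of G⁻¹ G = 1. It is solved for `D` below, with `D'` expressed through
  -- the connection by `hD'Γ`.
  have hprod : D * G x + (G x)⁻¹ * D' = 0 := by
    ext a b
    have h1 : pd σ (fun y => ∑ κ, (G y)⁻¹ a κ * G y κ b) x = 0 := by
      rw [pd_congr hG.isOpen (fun y hy => hG.sum_inv_mul hy a b) hx, pd_const]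
    rw [pd_sum _ fun κ _ => ((hG.diffAt (hG.smooth_inv a κ) hx).fun_mul
      (hG.diffAt (hG.smooth κ b) hx))] at h1
    rw [Matrix.zero_apply, ← h1]
    simp only [Matrix.add_apply, Matrix.mul_apply, hD, hD', Matrix.of_apply,
      ← Finset.sum_add_distrib]
    exact Finset.sum_congr rfl fun κ _ =>
      (pd_mul (hG.diffAt (hG.smooth_inv a κ) hx) (hG.diffAt (hG.smooth κ b) hx) σ).symm
  have hfin : D = -(Γ * (G x)⁻¹) - (Γ * (G x)⁻¹).transpose := by
    have h2 : D * G x * (G x)⁻¹ + (G x)⁻¹ * D' * (G x)⁻¹ = 0 := by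
      rw [← add_mul, hprod, zero_mul]
    rw [Matrix.mul_nonsing_inv_cancel_right _ _ hdet, hD'Γ, Matrix.transpose_mul,
      hG.transpose_eq hx, mul_add, add_mul, Matrix.nonsing_inv_mul_cancel_left _ _ hdet,
      ← Matrix.mul_assoc, Matrix.mul_nonsing_inv_cancel_right _ _ hdet] at h2
    rw [Matrix.transpose_mul, Matrix.transpose_nonsing_inv, hG.transpose_eq hx]
    rw [eq_sub_of_add_eq (a := D) h2]
    abel
  have := congrFun (congrFun hfin μ) ν
  simp only [hD, hΓ, Matrix.sub_apply, Matrix.neg_apply, Matrix.transpose_apply, Matrix.mul_apply,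
    Matrix.of_apply] at this
  rw [this]
  congr 1
  exact Finset.sum_congr rfl fun l _ => by rw [hG.inv_symm hx]

end MetricOn

end

section

/-! ### The covariant derivative -/

section covDeriv

variable {G : Eu 4 → Matrix (Fin 4) (Fin 4) ℝ} {U : Set (Eu 4)} {x : Eu 4} {k : ℕ}
  {T T' : Eu 4 → (Fin k → Fin 4) → ℝ}

theorem covDeriv_cons (a : Fin 4) (α : Fin k → Fin 4) :
    covDeriv G T x (Fin.cons a α : Fin (k + 1) → Fin 4) = pd a (fun y => T y α) x
      - ∑ i, ∑ τ, christoffel G τ a (α i) x * T x (Function.update α i τ) := by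
  simp [covDeriv]

theorem covDeriv_congr (hU : IsOpen U) (h : ∀ y ∈ U, ∀ α, T y α = T' y α) (hx : x ∈ U)
    (β : Fin (k + 1) → Fin 4) : covDeriv G T x β = covDeriv G T' x β := by
  unfold covDeriv
  rw [pd_congr hU (fun y hy => h y hy _) hx]
  simp_rw [h x hx]

theorem MetricOn.smooth_covDeriv (hG : MetricOn G U) (hT : ∀ α, ContDiffOn ℝ ∞ (fun y => T y α) U)
    (β : Fin (k + 1) → Fin 4) : ContDiffOn ℝ ∞ (fun y => covDeriv G T y β) U := by
  unfold covDeriv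
  exact (smoothOn_pd hG.isOpen (hT _) _).sub (ContDiffOn.sum fun i _ => ContDiffOn.sum fun τ _ =>
    (hG.smooth_christoffel _ _ _).mul (hT _))

/-- The first derivative has rank `k + 1`, with the differentiation index `b` in slot 0. Splitting
off that slot isolates Γ^τ_{ab} ∇_τ T, which is symmetric in `a`, `b` for a torsion-free connection
and so drops out of the commutator. -/
theorem covDeriv_covDeriv_cons (a b : Fin 4) (α : Fin k → Fin 4) :
    covDeriv G (covDeriv G T) x (Fin.cons a (Fin.cons b α : Fin (k + 1) → Fin 4)) =
      pd a (fun y => covDeriv G T y (Fin.cons b α : Fin (k + 1) → Fin 4)) x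
      - ∑ τ, christoffel G τ a b x * covDeriv G T x (Fin.cons τ α : Fin (k + 1) → Fin 4)
      - ∑ i, ∑ τ, christoffel G τ a (α i) x *
          covDeriv G T x (Fin.cons b (Function.update α i τ) : Fin (k + 1) → Fin 4) := by
  rw [covDeriv_cons, Fin.sum_univ_succ, ← sub_sub]
  simp [Fin.update_cons_zero, Fin.cons_update]

/-- The double action of the connection on the indices, antisymmetrised. -/
theorem connection_commutator (A B : Fin 4 → Fin 4 → ℝ) (F : (Fin k → Fin 4) → ℝ)
    (α : Fin k → Fin 4) :
    ∑ i, ∑ τ, A τ (α i) * ∑ j, ∑ σ, B σ (Function.update α i τ j) *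
        F (Function.update (Function.update α i τ) j σ)
      - ∑ i, ∑ τ, B τ (α i) * ∑ j, ∑ σ, A σ (Function.update α i τ j) *
        F (Function.update (Function.update α i τ) j σ)
      = ∑ i, ∑ τ, (∑ σ, (A σ (α i) * B τ σ - B σ (α i) * A τ σ)) * F (Function.update α i τ) := by
  set S : (Fin 4 → Fin 4 → ℝ) → (Fin 4 → Fin 4 → ℝ) → Fin k → Fin k → ℝ := fun A B i j =>
    ∑ τ, ∑ σ, A τ (α i) * (B σ (Function.update α i τ j) *
      F (Function.update (Function.update α i τ) j σ)) with hS
  have h1 : ∀ A B : Fin 4 → Fin 4 → ℝ, ∑ i, ∑ τ, A τ (α i) * ∑ j, ∑ σ,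
      B σ (Function.update α i τ j) * F (Function.update (Function.update α i τ) j σ)
      = ∑ i, ∑ j, S A B i j := by
    intro A B
    refine Finset.sum_congr rfl fun i _ => ?_
    simp only [hS]
    rw [Finset.sum_comm]
    refine Finset.sum_congr rfl fun τ _ => ?_
    simp_rw [Finset.mul_sum]
  -- In different slots the two actions commute, so these terms cancel in the antisymmetrised sum.
  have h2 : ∀ i j, i ≠ j → S A B i j = S B A j i := by
    intro i j hij
    simp only [hS]
    rw [Finset.sum_comm]
    refine Finset.sum_congr rfl fun τ _ => Finset.sum_congr rfl fun σ _ => ?_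
    rw [Function.update_of_ne hij.symm, Function.update_of_ne hij, Function.update_comm hij]
    ring
  -- Acting twice in one slot composes the two matrices; only here does a commutator survive.
  have h3 : ∀ i, S A B i i - S B A i i =
      ∑ τ, (∑ σ, (A σ (α i) * B τ σ - B σ (α i) * A τ σ)) * F (Function.update α i τ) := by
    intro i
    simp only [hS, Function.update_self, Function.update_idem]
    rw [Finset.sum_comm, Finset.sum_comm (f := fun τ σ => B τ (α i) * _), ← Finset.sum_sub_distrib]
    refine Finset.sum_congr rfl fun τ _ => ?_
    rw [Finset.sum_mul, ← Finset.sum_sub_distrib]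
    refine Finset.sum_congr rfl fun σ _ => ?_
    ring
  rw [h1, h1, Finset.sum_comm (f := fun i j => S B A i j), ← Finset.sum_sub_distrib]
  refine Finset.sum_congr rfl fun i _ => ?_
  rw [← Finset.sum_sub_distrib, ← h3 i]
  refine Finset.sum_eq_single i (fun j _ hj => ?_) (by simp)
  rw [h2 i j hj.symm, sub_self]

/-- The Ricci identity. -/
theorem MetricOn.ricci_identity (hG : MetricOn G U)
    (hT : ∀ α, ContDiffOn ℝ ∞ (fun y => T y α) U) (hx : x ∈ U) (a b : Fin 4) (α : Fin k → Fin 4) :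
    covDeriv G (covDeriv G T) x (Fin.cons a (Fin.cons b α : Fin (k + 1) → Fin 4))
      - covDeriv G (covDeriv G T) x (Fin.cons b (Fin.cons a α : Fin (k + 1) → Fin 4))
      = -∑ i, ∑ τ, riemannUp G τ (α i) a b x * T x (Function.update α i τ) := by
  have hΓ : ∀ l μ ν, DifferentiableAt ℝ (christoffel G l μ ν) x :=
    fun l μ ν => hG.diffAt (hG.smooth_christoffel l μ ν) hx
  have hTd : ∀ α, DifferentiableAt ℝ (fun y => T y α) x := fun α => hG.diffAt (hT α) hx
  have hpd : ∀ a b : Fin 4, pd a (fun y => covDeriv G T y (Fin.cons b α : Fin (k + 1) → Fin 4)) x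
      = pd a (pd b (fun y => T y α)) x
        - ∑ i, ∑ τ, (pd a (christoffel G τ b (α i)) x * T x (Function.update α i τ)
          + christoffel G τ b (α i) x * pd a (fun y => T y (Function.update α i τ)) x) := by
    intro a b
    simp_rw [covDeriv_cons]
    have hm : ∀ (i : Fin k) (τ : Fin 4), DifferentiableAt ℝ
        (fun y => christoffel G τ b (α i) y * T y (Function.update α i τ)) x :=
      fun i τ => (hΓ _ _ _).fun_mul (hTd _)
    rw [pd_sub (hG.diffAt (smoothOn_pd hG.isOpen (hT α) b) hx)
      (DifferentiableAt.fun_sum fun i _ => DifferentiableAt.fun_sum fun τ _ => hm i τ),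
      pd_sum _ fun i _ => DifferentiableAt.fun_sum fun τ _ => hm i τ]
    congr 1
    refine Finset.sum_congr rfl fun i _ => ?_
    rw [pd_sum _ fun τ _ => hm i τ]
    exact Finset.sum_congr rfl fun τ _ => pd_mul (hΓ _ _ _) (hTd _) a
  have hcomm := connection_commutator (fun l ν => christoffel G l a ν x)
    (fun l ν => christoffel G l b ν x) (T x) α
  have hR : ∑ i, ∑ τ, riemannUp G τ (α i) a b x * T x (Function.update α i τ)
      = ∑ i, ∑ τ, (pd a (christoffel G τ b (α i)) x * T x (Function.update α i τ))
        - ∑ i, ∑ τ, (pd b (christoffel G τ a (α i)) x * T x (Function.update α i τ))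
        - ∑ i, ∑ τ, (∑ σ, (christoffel G σ a (α i) x * christoffel G τ b σ x
          - christoffel G σ b (α i) x * christoffel G τ a σ x)) * T x (Function.update α i τ) := by
    simp only [← Finset.sum_sub_distrib]
    refine Finset.sum_congr rfl fun i _ => Finset.sum_congr rfl fun τ _ => ?_
    have : ∑ σ, (christoffel G τ a σ x * christoffel G σ b (α i) x
        - christoffel G τ b σ x * christoffel G σ a (α i) x) =
        -∑ σ, (christoffel G σ a (α i) x * christoffel G τ b σ x
          - christoffel G σ b (α i) x * christoffel G τ a σ x) := by
      rw [← Finset.sum_neg_distrib]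
      exact Finset.sum_congr rfl fun σ _ => by ring
    rw [riemannUp, this]
    ring
  -- The second partials of T agree, the Γ^τ_{ab} terms agree, and the mixed terms Γ ∂T are
  -- symmetric under the exchange of `a` and `b`. What is left is ∂Γ from `hR` and the commutator
  -- from `hcomm`.
  rw [covDeriv_covDeriv_cons, covDeriv_covDeriv_cons, hpd, hpd, pd_comm hG.isOpen (hT α) hx b a]
  simp_rw [hG.christoffel_symm hx _ b a, covDeriv_cons]
  simp only [mul_sub, Finset.sum_sub_distrib, Finset.sum_add_distrib] at hcomm hR ⊢
  rw [hR]
  linarith [hcomm]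

/-- Linear relations between index permutations of a tensor field pass to its covariant
derivative. -/
theorem MetricOn.covDeriv_relation (hG : MetricOn G U)
    (hT : ∀ α, ContDiffOn ℝ ∞ (fun y => T y α) U) {n : ℕ} (c : Fin n → ℝ)
    (π : Fin n → Equiv.Perm (Fin k)) (h : ∀ y ∈ U, ∀ α, ∑ s, c s * T y (α ∘ π s) = 0)
    (hx : x ∈ U) (e : Fin 4) (α : Fin k → Fin 4) :
    ∑ s, c s * covDeriv G T x (Fin.cons e (α ∘ π s) : Fin (k + 1) → Fin 4) = 0 := by
  simp_rw [covDeriv_cons, mul_sub]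
  rw [Finset.sum_sub_distrib]
  have h1 : ∑ s, c s * pd e (fun y => T y (α ∘ π s)) x = 0 := by
    have h2 := pd_congr hG.isOpen (fun y hy => h y hy α) hx e
    rw [pd_const, pd_sum _ fun s _ => (hG.diffAt (hT _) hx).const_mul _] at h2
    rw [← h2]
    exact Finset.sum_congr rfl fun s _ => (pd_const_mul (hG.diffAt (hT _) hx) _ _).symm
  -- Slot i of `α ∘ π s` is slot `π s i` of `α`. Reindexing the sum over slots makes the update
  -- independent of `s`, so the assumed relation applies to each updated multi-index.
  have h3 : ∀ s, ∑ i, ∑ τ, christoffel G τ e ((α ∘ π s) i) x *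
      T x (Function.update (α ∘ π s) i τ)
      = ∑ i, ∑ τ, christoffel G τ e (α i) x * T x (Function.update α i τ ∘ π s) := by
    intro s
    rw [← Equiv.sum_comp (π s)
      (fun i => ∑ τ, christoffel G τ e (α i) x * T x (Function.update α i τ ∘ π s))]
    refine Finset.sum_congr rfl fun i _ => Finset.sum_congr rfl fun τ _ => ?_
    rw [Function.update_comp_equiv]
    simp
  rw [h1, zero_sub, neg_eq_zero]
  simp_rw [h3, Finset.mul_sum]
  rw [Finset.sum_comm]
  refine Finset.sum_eq_zero fun i _ => ?_
  rw [Finset.sum_comm]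
  refine Finset.sum_eq_zero fun τ _ => ?_
  simp_rw [mul_left_comm (c _)]
  rw [← Finset.mul_sum, h x hx, mul_zero]

/-- The vanishing of a trace passes to the covariant derivative. -/
theorem MetricOn.covDeriv_trace (hG : MetricOn G U)
    (hT : ∀ α, ContDiffOn ℝ ∞ (fun y => T y α) U) {i j : Fin k} (hij : i ≠ j)
    (h : ∀ y ∈ U, ∀ α, ∑ e, ∑ f, (G y)⁻¹ e f *
      T y (Function.update (Function.update α i e) j f) = 0)
    (hx : x ∈ U) (c : Fin 4) (α : Fin k → Fin 4) :
    ∑ e, ∑ f, (G x)⁻¹ e f * covDeriv G T x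
      (Fin.cons c (Function.update (Function.update α i e) j f) : Fin (k + 1) → Fin 4) = 0 := by
  set t : Fin 4 → Fin 4 → Fin k → Fin 4 := fun e f => Function.update (Function.update α i e) j f
    with ht
  -- The total derivative of the vanishing trace is zero, so the derivative of T is traded for the
  -- derivative of the inverse metric, that is, for connection terms.
  have hpd : ∑ e, ∑ f, (G x)⁻¹ e f * pd c (fun y => T y (t e f)) x
      = ∑ e, ∑ f, (∑ l, christoffel G e c l x * (G x)⁻¹ l f
        + ∑ l, christoffel G f c l x * (G x)⁻¹ e l) * T x (t e f) := by
    have hd : ∀ e f, DifferentiableAt ℝ (fun y => (G y)⁻¹ e f * T y (t e f)) x := fun e f =>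
      (hG.diffAt (hG.smooth_inv e f) hx).fun_mul (hG.diffAt (hT _) hx)
    have h2 := pd_congr hG.isOpen (fun y hy => h y hy α) hx c
    rw [pd_const, pd_sum _ fun e _ => DifferentiableAt.fun_sum fun f _ => hd e f] at h2
    rw [← sub_eq_zero, ← h2, ← Finset.sum_sub_distrib]
    refine Finset.sum_congr rfl fun e _ => ?_
    rw [pd_sum _ fun f _ => hd e f, ← Finset.sum_sub_distrib]
    refine Finset.sum_congr rfl fun f _ => ?_
    rw [pd_mul (hG.diffAt (hG.smooth_inv e f) hx) (hG.diffAt (hT _) hx), hG.pd_inv hx]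
    ring
  set B : Fin k → ℝ := fun l => ∑ e, ∑ f, (G x)⁻¹ e f *
    ∑ τ, christoffel G τ c (t e f l) x * T x (Function.update (t e f) l τ) with hB
  -- The connection acting in an uncontracted slot leaves a trace of T at another multi-index, which
  -- vanishes by hypothesis.
  have hB0 : ∀ l, l ≠ i → l ≠ j → B l = 0 := by
    intro l hli hlj
    have : ∀ e f τ, Function.update (t e f) l τ
        = Function.update (Function.update (Function.update α l τ) i e) j f := by
      intro e f τ
      rw [ht]
      simp only
      rw [Function.update_comm hlj.symm, Function.update_comm hli.symm]
    have h' : B l = ∑ τ, christoffel G τ c (α l) x * ∑ e, ∑ f, (G x)⁻¹ e f *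
        T x (Function.update (Function.update (Function.update α l τ) i e) j f) := by
      simp only [hB, this]
      simp_rw [Finset.mul_sum]
      symm
      rw [Finset.sum_comm]
      refine Finset.sum_congr rfl fun e _ => ?_
      rw [Finset.sum_comm]
      refine Finset.sum_congr rfl fun f _ => Finset.sum_congr rfl fun τ _ => ?_
      simp only [ht, Function.update_of_ne hlj, Function.update_of_ne hli]
      ring
    rw [h']
    refine Finset.sum_eq_zero fun τ _ => ?_
    rw [h x hx, mul_zero]
  -- In the contracted slots `i` and `j`, renaming the summation indices moves the connection from T
  -- to the inverse metric. These two terms cancel against `hpd`.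
  have hBi : B i = ∑ e, ∑ f, (∑ l, christoffel G e c l x * (G x)⁻¹ l f) * T x (t e f) := by
    have : ∀ e f τ, Function.update (t e f) i τ = t τ f := by
      intro e f τ
      simp only [ht]
      rw [Function.update_comm hij.symm, Function.update_idem]
    simp only [hB, this, Finset.mul_sum, Finset.sum_mul]
    rw [Finset.sum_comm, Finset.sum_comm (f := fun e f => ∑ l, _ * _ * T x (t e f))]
    refine Finset.sum_congr rfl fun f _ => ?_
    rw [Finset.sum_comm]
    refine Finset.sum_congr rfl fun e _ => Finset.sum_congr rfl fun τ _ => ?_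
    simp only [ht, Function.update_of_ne hij, Function.update_self]
    ring
  have hBj : B j = ∑ e, ∑ f, (∑ l, christoffel G f c l x * (G x)⁻¹ e l) * T x (t e f) := by
    have : ∀ e f τ, Function.update (t e f) j τ = t e τ := by
      intro e f τ
      simp only [ht, Function.update_idem]
    simp only [hB, this, Finset.mul_sum, Finset.sum_mul]
    refine Finset.sum_congr rfl fun e _ => ?_
    rw [Finset.sum_comm]
    refine Finset.sum_congr rfl fun f _ => Finset.sum_congr rfl fun τ _ => ?_
    simp only [ht, Function.update_self]
    ring
  have hsum : ∑ e, ∑ f, (G x)⁻¹ e f * ∑ l, ∑ τ, christoffel G τ c (t e f l) x *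
      T x (Function.update (t e f) l τ) = B i + B j := by
    rw [← Finset.sum_pair hij, Finset.sum_subset (Finset.subset_univ {i, j})
      (fun l _ hl => hB0 l (by simp at hl; tauto) (by simp at hl; tauto))]
    simp only [hB]
    symm
    rw [Finset.sum_comm]
    refine Finset.sum_congr rfl fun e _ => ?_
    rw [Finset.sum_comm]
    refine Finset.sum_congr rfl fun f _ => ?_
    rw [Finset.mul_sum]
  simp_rw [covDeriv_cons, mul_sub, Finset.sum_sub_distrib]
  rw [hpd, hsum, hBi, hBj]
  simp only [add_mul, Finset.sum_add_distrib]
  ring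

end covDeriv

end

section

/-! ### Symmetries of the curvature tensor -/

/-- The curvature tensor as a tensor field of rank four. -/
def riemannT (G : Eu 4 → Matrix (Fin 4) (Fin 4) ℝ) (x : Eu 4) (α : Fin 4 → Fin 4) : ℝ :=
  riemann G (α 0) (α 1) (α 2) (α 3) x

namespace MetricOn

variable {G : Eu 4 → Matrix (Fin 4) (Fin 4) ℝ} {U : Set (Eu 4)} {x : Eu 4}

theorem smooth_riemannT (hG : MetricOn G U) (α : Fin 4 → Fin 4) :
    ContDiffOn ℝ ∞ (fun y => riemannT G y α) U := hG.smooth_riemann _ _ _ _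

theorem _root_.GR.riemannUp_antisymm (κ l μ ν : Fin 4) :
    riemannUp G κ l μ ν x = -riemannUp G κ l ν μ x := by
  have : ∑ σ, (christoffel G κ μ σ x * christoffel G σ ν l x
      - christoffel G κ ν σ x * christoffel G σ μ l x) =
      -∑ σ, (christoffel G κ ν σ x * christoffel G σ μ l x
      - christoffel G κ μ σ x * christoffel G σ ν l x) := by
    rw [← Finset.sum_neg_distrib]
    exact Finset.sum_congr rfl fun σ _ => by ring
  rw [riemannUp, riemannUp, this]
  ring

theorem _root_.GR.riemann_antisymm_right (κ l μ ν : Fin 4) :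
    riemann G κ l μ ν x = -riemann G κ l ν μ x := by
  unfold riemann
  rw [← Finset.sum_neg_distrib]
  exact Finset.sum_congr rfl fun σ _ => by rw [riemannUp_antisymm]; ring

/-- First Bianchi identity: the symmetry of Γ in its lower indices pairs off the six derivative
terms and the six products of the cyclic sum. -/
theorem riemannUp_cyclic (hG : MetricOn G U) (hx : x ∈ U) (κ l μ ν : Fin 4) :
    riemannUp G κ l μ ν x + riemannUp G κ μ ν l x + riemannUp G κ ν l μ x = 0 := by
  have hp : ∀ a b c d : Fin 4, pd a (christoffel G b c d) x = pd a (christoffel G b d c) x :=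
    fun a b c d => pd_congr hG.isOpen (fun y hy => hG.christoffel_symm hy b c d) hx a
  simp only [riemannUp]
  rw [hp μ κ l ν, hp ν κ μ l, hp l κ ν μ]
  have : ∑ σ, (christoffel G κ μ σ x * christoffel G σ ν l x
      - christoffel G κ ν σ x * christoffel G σ μ l x)
    + ∑ σ, (christoffel G κ ν σ x * christoffel G σ l μ x
      - christoffel G κ l σ x * christoffel G σ ν μ x)
    + ∑ σ, (christoffel G κ l σ x * christoffel G σ μ ν x
      - christoffel G κ μ σ x * christoffel G σ l ν x) = 0 := by
    rw [← Finset.sum_add_distrib, ← Finset.sum_add_distrib]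
    refine Finset.sum_eq_zero fun σ _ => ?_
    rw [hG.christoffel_symm hx σ l μ, hG.christoffel_symm hx σ ν μ, hG.christoffel_symm hx σ l ν]
    ring
  linarith

theorem riemann_cyclic (hG : MetricOn G U) (hx : x ∈ U) (κ l μ ν : Fin 4) :
    riemann G κ l μ ν x + riemann G κ μ ν l x + riemann G κ ν l μ x = 0 := by
  unfold riemann
  rw [← Finset.sum_add_distrib, ← Finset.sum_add_distrib]
  refine Finset.sum_eq_zero fun σ _ => ?_
  rw [← mul_add, ← mul_add, hG.riemannUp_cyclic hx, mul_zero]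

theorem covDeriv_metric (hG : MetricOn G U) (hx : x ∈ U) (β : Fin 3 → Fin 4) :
    covDeriv G (fun y (α : Fin 2 → Fin 4) => G y (α 0) (α 1)) x β = 0 := by
  have h1 : covDeriv G (fun y (α : Fin 2 → Fin 4) => G y (α 0) (α 1)) x β
      = pd (β 0) (fun y => G y (β 1) (β 2)) x
        - (∑ τ, christoffel G τ (β 0) (β 1) x * G x τ (β 2)
          + ∑ τ, christoffel G τ (β 0) (β 2) x * G x (β 1) τ) := by
    rw [covDeriv, Fin.sum_univ_two]
    rfl
  rw [h1, hG.pd_metric hx]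
  simp_rw [hG.symm x hx _ (β 2), mul_comm (christoffel G _ _ _ _)]
  ring

/-- The Ricci identity is applied to the metric itself. Its left side vanishes because the metric is
parallel, and its right side is the sum of the two curvature components. -/
theorem riemann_antisymm_left (hG : MetricOn G U) (hx : x ∈ U) (κ l μ ν : Fin 4) :
    riemann G κ l μ ν x = -riemann G l κ μ ν x := by
  have h := hG.ricci_identity (T := fun y (α : Fin 2 → Fin 4) => G y (α 0) (α 1))
    (fun α => hG.smooth _ _) hx μ ν ![κ, l]
  have h0 : ∀ β : Fin 4 → Fin 4, covDeriv G (covDeriv G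
      (fun y (α : Fin 2 → Fin 4) => G y (α 0) (α 1))) x β = 0 := by
    intro β
    rw [covDeriv_congr (T' := fun _ _ => 0) hG.isOpen (fun y hy α => hG.covDeriv_metric hy α) hx]
    simp [covDeriv, pd_const]
  rw [h0, h0, Fin.sum_univ_two] at h
  simp [Function.update] at h
  unfold riemann
  simp_rw [mul_comm (riemannUp G _ _ _ _ _), hG.symm x hx _ l] at h
  linarith

/-- The classical argument: the four cyclic identities, one starting from each of the four indices,
combine so that the two antisymmetries cancel all but the two terms sought. -/
theorem riemann_pair_symm (hG : MetricOn G U) (hx : x ∈ U) (a b c d : Fin 4) :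
    riemann G a b c d x = riemann G c d a b x := by
  have A := @riemann_antisymm_right G x
  have B := hG.riemann_antisymm_left hx
  have C := hG.riemann_cyclic hx
  linarith [C a b c d, C b c d a, C c d a b, C d a b c, A a b c d, B a b c d, A a c d b, B a c d b,
    A a d b c, B a d b c, A b c d a, B b c d a, A b d a c, B b d a c, A c d a b, B c d a b,
    A d b c a, B d b c a, A c a b d, B c a b d, A b a c d, B b a c d, A c b d a, A d a b c,
    B d a b c, A d c a b, A c a b d, B a c b d, A b d c a, A a d c b, A d c b a, A c b a d]

theorem riemannUp_eq_raise (hG : MetricOn G U) (hx : x ∈ U) (κ l μ ν : Fin 4) :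
    riemannUp G κ l μ ν x = ∑ s, (G x)⁻¹ κ s * riemann G s l μ ν x := by
  unfold riemann
  rw [hG.sum_raise_lower hx (fun σ => riemannUp G σ l μ ν x)]

/-- The trace of the curvature tensor is the Ricci tensor. -/
theorem trace_riemann (hG : MetricOn G U) (hx : x ∈ U) (l ν : Fin 4) :
    ∑ e, ∑ f, (G x)⁻¹ e f * riemann G f l e ν x = ricci G l ν x := by
  unfold ricci
  exact Finset.sum_congr rfl fun e _ => (hG.riemannUp_eq_raise hx _ _ _ _).symm

/-! ### The second Bianchi identity -/

/-- For fixed differentiation and form indices, Γ and the curvature are matrices, with F_{μν} = ∂_μ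
C_ν - ∂_ν C_μ + [C_μ, C_ν] and D_e F_{μν} = ∂_e F_{μν} + [C_e, F_{μν}]. The cyclic sum then vanishes
as an identity in noncommuting variables, given that second partial derivatives commute. Corrections
on the form indices are left out of `D` and are treated in `bianchi`. -/
theorem bianchiUp (hG : MetricOn G U) (hx : x ∈ U) (κ l : Fin 4) (e μ ν : Fin 4) :
    let D := fun e μ ν : Fin 4 => pd e (riemannUp G κ l μ ν) x
      + ∑ σ, christoffel G κ e σ x * riemannUp G σ l μ ν x
      - ∑ σ, riemannUp G κ σ μ ν x * christoffel G σ e l x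
    D e μ ν + D μ ν e + D ν e μ = 0 := by
  intro D
  set C : Fin 4 → Matrix (Fin 4) (Fin 4) ℝ := fun μ => Matrix.of fun a b => christoffel G a μ b x
    with hC
  set P : Fin 4 → Fin 4 → Matrix (Fin 4) (Fin 4) ℝ := fun e μ =>
    Matrix.of fun a b => pd e (christoffel G a μ b) x with hP
  set Q : Fin 4 → Fin 4 → Fin 4 → Matrix (Fin 4) (Fin 4) ℝ := fun f e μ =>
    Matrix.of fun a b => pd f (pd e (christoffel G a μ b)) x with hQ
  have hΓ : ∀ l μ ν, DifferentiableAt ℝ (christoffel G l μ ν) x :=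
    fun l μ ν => hG.diffAt (hG.smooth_christoffel l μ ν) hx
  have hΓ' : ∀ e l μ ν, DifferentiableAt ℝ (pd e (christoffel G l μ ν)) x :=
    fun e l μ ν => hG.diffAt (smoothOn_pd hG.isOpen (hG.smooth_christoffel l μ ν) e) hx
  have hQs : ∀ f e μ, Q f e μ = Q e f μ := by
    intro f e μ
    ext a b
    exact pd_comm hG.isOpen (hG.smooth_christoffel a μ b) hx f e
  have hF : ∀ a b μ ν, riemannUp G a b μ ν x = (P μ ν - P ν μ + C μ * C ν - C ν * C μ) a b := by
    intro a b μ ν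
    simp only [riemannUp, hP, hC, Matrix.sub_apply, Matrix.add_apply, Matrix.mul_apply,
      Matrix.of_apply, Finset.sum_sub_distrib]
    ring
  have hdF : ∀ e μ ν, pd e (riemannUp G κ l μ ν) x = (Q e μ ν - Q e ν μ + P e μ * C ν + C μ * P e ν
      - P e ν * C μ - C ν * P e μ) κ l := by
    intro e μ ν
    have hd : ∀ σ, DifferentiableAt ℝ (fun y => christoffel G κ μ σ y * christoffel G σ ν l y
        - christoffel G κ ν σ y * christoffel G σ μ l y) x := fun σ =>
      ((hΓ _ _ _).fun_mul (hΓ _ _ _)).fun_sub ((hΓ _ _ _).fun_mul (hΓ _ _ _))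
    have : riemannUp G κ l μ ν = fun y => (pd μ (christoffel G κ ν l) y - pd ν (christoffel G κ μ l) y)
        + ∑ σ, (christoffel G κ μ σ y * christoffel G σ ν l y
          - christoffel G κ ν σ y * christoffel G σ μ l y) := rfl
    rw [this, pd_add ((hΓ' _ _ _ _).fun_sub (hΓ' _ _ _ _)) (DifferentiableAt.fun_sum fun σ _ => hd σ),
      pd_sub (hΓ' _ _ _ _) (hΓ' _ _ _ _), pd_sum _ fun σ _ => hd σ]
    have : ∀ σ, pd e (fun y => christoffel G κ μ σ y * christoffel G σ ν l y
        - christoffel G κ ν σ y * christoffel G σ μ l y) x =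
        pd e (christoffel G κ μ σ) x * christoffel G σ ν l x
        + christoffel G κ μ σ x * pd e (christoffel G σ ν l) x
        - pd e (christoffel G κ ν σ) x * christoffel G σ μ l x
        - christoffel G κ ν σ x * pd e (christoffel G σ μ l) x := by
      intro σ
      rw [pd_sub ((hΓ _ _ _).fun_mul (hΓ _ _ _)) ((hΓ _ _ _).fun_mul (hΓ _ _ _)),
        pd_mul (hΓ _ _ _) (hΓ _ _ _), pd_mul (hΓ _ _ _) (hΓ _ _ _)]
      ring
    simp only [this, hQ, hP, hC, Matrix.sub_apply, Matrix.add_apply, Matrix.mul_apply,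
      Matrix.of_apply, Finset.sum_sub_distrib, Finset.sum_add_distrib]
    ring
  have hD : ∀ e μ ν, D e μ ν = (Q e μ ν - Q e ν μ + P e μ * C ν + C μ * P e ν
      - P e ν * C μ - C ν * P e μ + C e * (P μ ν - P ν μ + C μ * C ν - C ν * C μ)
      - (P μ ν - P ν μ + C μ * C ν - C ν * C μ) * C e) κ l := by
    intro e μ ν
    simp only [D, hdF, hF]
    rw [Matrix.sub_apply (_ + _), Matrix.add_apply _ (C e * _), Matrix.mul_apply (M := C e),
      Matrix.mul_apply (N := C e)]
    rfl
  rw [hD, hD, hD, ← Matrix.add_apply, ← Matrix.add_apply, hQs μ e ν, hQs ν e μ, hQs ν μ e]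
  have : ∀ M : Matrix (Fin 4) (Fin 4) ℝ, M = 0 → M κ l = 0 := by rintro M rfl; rfl
  apply this
  noncomm_ring

/-- Since the metric is parallel, lowering the first index commutes with the derivative. The bracket
is the expression of `bianchiUp`, and the last two sums are the corrections on the form indices. -/
theorem covDeriv_riemannT (hG : MetricOn G U) (hx : x ∈ U) (e a b c d : Fin 4) :
    covDeriv G (riemannT G) x ![e, a, b, c, d] =
      ∑ s, G x a s * (pd e (riemannUp G s b c d) x
        + ∑ σ, christoffel G s e σ x * riemannUp G σ b c d x
        - ∑ σ, riemannUp G s σ c d x * christoffel G σ e b x)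
      - ∑ τ, christoffel G τ e c x * riemann G a b τ d x
      - ∑ τ, christoffel G τ e d x * riemann G a b c τ x := by
  have h1 : covDeriv G (riemannT G) x ![e, a, b, c, d] = pd e (riemann G a b c d) x
      - (∑ τ, christoffel G τ e a x * riemann G τ b c d x
        + ∑ τ, christoffel G τ e b x * riemann G a τ c d x
        + ∑ τ, christoffel G τ e c x * riemann G a b τ d x
        + ∑ τ, christoffel G τ e d x * riemann G a b c τ x) := by
    have := covDeriv_cons (G := G) (T := riemannT G) (x := x) e ![a, b, c, d]
    rw [Fin.sum_univ_four] at this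
    exact this
  have h2 : pd e (riemann G a b c d) x = ∑ s, (pd e (fun y => G y a s) x * riemannUp G s b c d x
      + G x a s * pd e (riemannUp G s b c d) x) := by
    have hR : ∀ s, DifferentiableAt ℝ (riemannUp G s b c d) x :=
      fun s => hG.diffAt (hG.smooth_riemannUp _ _ _ _) hx
    have hg : ∀ s, DifferentiableAt ℝ (fun y => G y a s) x := fun s => hG.diffAt (hG.smooth _ _) hx
    have : riemann G a b c d = fun y => ∑ s, G y a s * riemannUp G s b c d y := rfl
    rw [this, pd_sum _ fun s _ => (hg s).fun_mul (hR s)]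
    exact Finset.sum_congr rfl fun s _ => pd_mul (hg s) (hR s) e
  have h3 : ∑ s, pd e (fun y => G y a s) x * riemannUp G s b c d x
      = ∑ s, G x a s * ∑ σ, christoffel G s e σ x * riemannUp G σ b c d x
        + ∑ τ, christoffel G τ e a x * riemann G τ b c d x := by
    simp_rw [hG.pd_metric hx, add_mul, Finset.sum_add_distrib, riemann, Finset.mul_sum,
      Finset.sum_mul]
    congr 1
    · rw [Finset.sum_comm]
      exact Finset.sum_congr rfl fun s _ => Finset.sum_congr rfl fun l _ => by ring
    · rw [Finset.sum_comm]
      refine Finset.sum_congr rfl fun s _ => Finset.sum_congr rfl fun l _ => ?_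
      rw [hG.symm x hx]
      ring
  have h4 : ∑ τ, christoffel G τ e b x * riemann G a τ c d x =
      ∑ s, G x a s * ∑ σ, riemannUp G s σ c d x * christoffel G σ e b x := by
    simp_rw [riemann, Finset.mul_sum]
    rw [Finset.sum_comm]
    exact Finset.sum_congr rfl fun s _ => Finset.sum_congr rfl fun l _ => by ring
  rw [h1, h2, Finset.sum_add_distrib, h3, h4]
  simp_rw [mul_sub, mul_add, Finset.sum_sub_distrib, Finset.sum_add_distrib]
  ring

theorem bianchi (hG : MetricOn G U) (hx : x ∈ U) (e a b c d : Fin 4) :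
    covDeriv G (riemannT G) x ![e, a, b, c, d] + covDeriv G (riemannT G) x ![c, a, b, d, e]
      + covDeriv G (riemannT G) x ![d, a, b, e, c] = 0 := by
  simp only [hG.covDeriv_riemannT hx]
  -- The corrections on the form indices cancel in pairs over the cyclic sum, by symmetry of Γ and
  -- antisymmetry of the curvature.
  have h1 : ∀ p q r : Fin 4, ∑ τ, christoffel G τ p q x * riemann G a b τ r x
      = -∑ τ, christoffel G τ q p x * riemann G a b r τ x := by
    intro p q r
    rw [← Finset.sum_neg_distrib]
    refine Finset.sum_congr rfl fun τ _ => ?_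
    rw [hG.christoffel_symm hx, riemann_antisymm_right]
    ring
  rw [h1 e c d, h1 c d e, h1 d e c]
  have h2 := Finset.sum_congr (s₁ := Finset.univ) rfl fun s _ =>
    congrArg (G x a s * ·) (hG.bianchiUp hx s b e c d)
  simp only [mul_zero, Finset.sum_const_zero] at h2
  simp only [mul_add, Finset.sum_add_distrib] at h2 ⊢
  linarith

end MetricOn

end

section

/-! ### The wave equation of the curvature tensor in vacuum -/

/-- `-g^{ef} g^{ts} (R_{saec} R_{tbfd} + R_{sbec} R_{atfd} + R_{sdec} R_{abft})`. -/
def curvQuad (g : Matrix (Fin 4) (Fin 4) ℝ) (R : (Fin 4 → Fin 4) → ℝ) (a b c d : Fin 4) : ℝ :=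
  -∑ e, ∑ f, ∑ t, ∑ s, g⁻¹ e f * g⁻¹ t s * (R ![s, a, e, c] * R ![t, b, f, d]
    + R ![s, b, e, c] * R ![a, t, f, d] + R ![s, d, e, c] * R ![a, b, f, t])

/-- The quadratic expression which equals the d'Alembertian of the curvature in vacuum. -/
def boxQuad (g : Matrix (Fin 4) (Fin 4) ℝ) (R : (Fin 4 → Fin 4) → ℝ) (α : Fin 4 → Fin 4) : ℝ :=
  curvQuad g R (α 0) (α 1) (α 2) (α 3) - curvQuad g R (α 0) (α 1) (α 3) (α 2)

theorem vec4_eta {X : Type*} (α : Fin 4 → X) : ![α 0, α 1, α 2, α 3] = α := by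
  ext i; fin_cases i <;> rfl

namespace MetricOn

variable {G : Eu 4 → Matrix (Fin 4) (Fin 4) ℝ} {U : Set (Eu 4)} {x : Eu 4}

theorem weyl_eq_riemannT (hv : ∀ y ∈ U, ∀ μ ν, ricci G μ ν y = 0)
    (hx : x ∈ U) (α : Fin 4 → Fin 4) : weyl G x α = riemannT G x α := by
  simp [weyl, riemannT, scalarCurv, hv x hx]

theorem covDeriv_riemannT_pair (hG : MetricOn G U) (hx : x ∈ U) (e a b c d : Fin 4) :
    covDeriv G (riemannT G) x ![e, a, b, c, d] = covDeriv G (riemannT G) x ![e, c, d, a, b] := by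
  let π : Equiv.Perm (Fin 4) := ⟨![2, 3, 0, 1], ![2, 3, 0, 1], by decide, by decide⟩
  have h := hG.covDeriv_relation hG.smooth_riemannT (![1, -1]) (![1, π]) (fun y hy α => by
    have := hG.riemann_pair_symm hy (α 0) (α 1) (α 2) (α 3)
    simp [Fin.sum_univ_two, riemannT, π]
    linarith) hx e ![a, b, c, d]
  rw [Fin.sum_univ_two] at h
  have e1 : (![a, b, c, d] ∘ (![1, π] 0 : Equiv.Perm (Fin 4)) : Fin 4 → Fin 4) = ![a, b, c, d] := by
    ext i; fin_cases i <;> rfl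
  have e2 : (![a, b, c, d] ∘ (![1, π] 1 : Equiv.Perm (Fin 4)) : Fin 4 → Fin 4) = ![c, d, a, b] := by
    ext i; fin_cases i <;> rfl
  rw [e1, e2] at h
  change 1 * covDeriv G (riemannT G) x ![e, a, b, c, d]
    + -1 * covDeriv G (riemannT G) x ![e, c, d, a, b] = 0 at h
  linarith

theorem covDeriv_riemannT_antisymm (hG : MetricOn G U) (hx : x ∈ U) (e a b c d : Fin 4) :
    covDeriv G (riemannT G) x ![e, a, b, c, d] = -covDeriv G (riemannT G) x ![e, a, b, d, c] := by
  have h := hG.covDeriv_relation hG.smooth_riemannT (![1, 1])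
    (![1, Equiv.swap 2 3]) (fun y hy α => by
      have := riemann_antisymm_right (G := G) (x := y) (α 0) (α 1) (α 2) (α 3)
      simp [Fin.sum_univ_two, riemannT, Equiv.swap_apply_of_ne_of_ne]
      linarith) hx e ![a, b, c, d]
  rw [Fin.sum_univ_two] at h
  have e1 : (![a, b, c, d] ∘ (![1, Equiv.swap 2 3] 0 : Equiv.Perm (Fin 4)) : Fin 4 → Fin 4)
      = ![a, b, c, d] := by
    ext i; fin_cases i <;> rfl
  have e2 : (![a, b, c, d] ∘ (![1, Equiv.swap 2 3] 1 : Equiv.Perm (Fin 4)) : Fin 4 → Fin 4)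
      = ![a, b, d, c] := by
    ext i; fin_cases i <;> rfl
  rw [e1, e2] at h
  change 1 * covDeriv G (riemannT G) x ![e, a, b, c, d]
    + 1 * covDeriv G (riemannT G) x ![e, a, b, d, c] = 0 at h
  linarith

/-- The Bianchi identity solved so that `f` moves from the derivative into a curvature slot.
Contracting `f` with a further derivative index will then lead to a divergence. -/
theorem bianchi' (hG : MetricOn G U) (hx : x ∈ U) (f a b c d : Fin 4) :
    covDeriv G (riemannT G) x ![f, a, b, c, d] = covDeriv G (riemannT G) x ![c, a, b, f, d]
      - covDeriv G (riemannT G) x ![d, a, b, f, c] := by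
  have h1 := hG.bianchi hx f a b c d
  have h2 := hG.covDeriv_riemannT_antisymm hx c a b d f
  linarith

theorem bianchi_covDeriv (hG : MetricOn G U) (hx : x ∈ U) (e f a b c d : Fin 4) :
    covDeriv G (covDeriv G (riemannT G)) x ![e, f, a, b, c, d]
      = covDeriv G (covDeriv G (riemannT G)) x ![e, c, a, b, f, d]
      - covDeriv G (covDeriv G (riemannT G)) x ![e, d, a, b, f, c] := by
  -- `bianchi'` is a linear relation between slot permutations of ∇R, so it may be differentiated
  -- slotwise. This permutation sends (f, a, b, c, d) to (d, a, b, f, c), the swap of 0 and 3 to (c,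
  -- a, b, f, d).
  let π : Equiv.Perm (Fin 5) := ⟨![4, 1, 2, 0, 3], ![3, 1, 2, 4, 0], by decide, by decide⟩
  have c1 : ∀ β : Fin 5 → Fin 4, β ∘ (1 : Equiv.Perm (Fin 5)) = ![β 0, β 1, β 2, β 3, β 4] := by
    intro β; ext i; fin_cases i <;> rfl
  have c2 : ∀ β : Fin 5 → Fin 4, β ∘ (Equiv.swap 0 3 : Equiv.Perm (Fin 5))
      = ![β 3, β 1, β 2, β 0, β 4] := by
    intro β; ext i; fin_cases i <;> rfl
  have c3 : ∀ β : Fin 5 → Fin 4, β ∘ π = ![β 4, β 1, β 2, β 0, β 3] := by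
    intro β; ext i; fin_cases i <;> rfl
  have h := hG.covDeriv_relation (hG.smooth_covDeriv hG.smooth_riemannT) (![1, -1, 1])
    (![1, Equiv.swap 0 3, π]) (fun y hy β => by
      have := hG.bianchi' hy (β 0) (β 1) (β 2) (β 3) (β 4)
      rw [Fin.sum_univ_three]
      change 1 * covDeriv G (riemannT G) y (β ∘ (1 : Equiv.Perm (Fin 5)))
        + -1 * covDeriv G (riemannT G) y (β ∘ (Equiv.swap 0 3 : Equiv.Perm (Fin 5)))
        + 1 * covDeriv G (riemannT G) y (β ∘ π) = 0
      rw [c1, c2, c3]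
      linarith) hx e ![f, a, b, c, d]
  rw [Fin.sum_univ_three] at h
  change 1 * covDeriv G (covDeriv G (riemannT G)) x
      (Fin.cons e (![f, a, b, c, d] ∘ (1 : Equiv.Perm (Fin 5))))
    + -1 * covDeriv G (covDeriv G (riemannT G)) x
      (Fin.cons e (![f, a, b, c, d] ∘ (Equiv.swap 0 3 : Equiv.Perm (Fin 5))))
    + 1 * covDeriv G (covDeriv G (riemannT G)) x (Fin.cons e (![f, a, b, c, d] ∘ π)) = 0 at h
  rw [c1, c2, c3] at h
  change 1 * covDeriv G (covDeriv G (riemannT G)) x ![e, f, a, b, c, d]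
    + -1 * covDeriv G (covDeriv G (riemannT G)) x ![e, c, a, b, f, d]
    + 1 * covDeriv G (covDeriv G (riemannT G)) x ![e, d, a, b, f, c] = 0 at h
  linarith

/-- In vacuum the curvature tensor is divergence free. -/
theorem div_riemannT (hG : MetricOn G U) (hv : ∀ y ∈ U, ∀ μ ν, ricci G μ ν y = 0) (hx : x ∈ U)
    (a b d : Fin 4) :
    ∑ e, ∑ f, (G x)⁻¹ e f * covDeriv G (riemannT G) x ![e, a, b, f, d] = 0 := by
  have u : ∀ (α : Fin 4 → Fin 4) e f, Function.update (Function.update α 2 e) 0 f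
      = ![f, α 1, e, α 3] := by
    intro α e f; ext i; fin_cases i <;> rfl
  have ht : ∀ p q r : Fin 4, ∑ e, ∑ f, (G x)⁻¹ e f *
      covDeriv G (riemannT G) x ![p, f, q, e, r] = 0 := by
    intro p q r
    have := hG.covDeriv_trace hG.smooth_riemannT (i := 2) (j := 0) (by decide) (fun y hy α => by
      simp_rw [u]
      exact (hG.trace_riemann hy (α 1) (α 3)).trans (hv y hy _ _)) hx p ![0, q, 0, r]
    simp_rw [u] at this
    exact this
  -- Pair symmetry followed by Bianchi writes the divergence as a difference of derivatives of Ricci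
  -- traces, both zero by `ht`.
  have : ∀ e f, covDeriv G (riemannT G) x ![e, a, b, f, d] =
      covDeriv G (riemannT G) x ![a, f, d, e, b] - covDeriv G (riemannT G) x ![b, f, d, e, a] := by
    intro e f
    rw [hG.covDeriv_riemannT_pair hx, hG.bianchi' hx]
  simp_rw [this, mul_sub, Finset.sum_sub_distrib, ht]
  simp

/-- The vanishing divergence is the trace of ∇R over slots 0 and 3, and a vanishing trace may be
differentiated. -/
theorem trace_covDeriv_covDeriv_riemannT (hG : MetricOn G U)
    (hv : ∀ y ∈ U, ∀ μ ν, ricci G μ ν y = 0) (hx : x ∈ U) (c a b d : Fin 4) :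
    ∑ e, ∑ f, (G x)⁻¹ e f *
      covDeriv G (covDeriv G (riemannT G)) x ![c, e, a, b, f, d] = 0 := by
  have u : ∀ (β : Fin 5 → Fin 4) e f, Function.update (Function.update β 0 e) 3 f
      = ![e, β 1, β 2, f, β 4] := by
    intro β e f; ext i; fin_cases i <;> rfl
  have := hG.covDeriv_trace (hG.smooth_covDeriv hG.smooth_riemannT) (i := 0) (j := 3)
    (by decide) (fun y hy β => by
      simp_rw [u]
      exact hG.div_riemannT hv hy (β 1) (β 2) (β 4)) hx c ![0, a, b, 0, d]
  simp_rw [u] at this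
  exact this

theorem ricci_riemannT (hG : MetricOn G U) (hx : x ∈ U) (e c a b f d : Fin 4) :
    covDeriv G (covDeriv G (riemannT G)) x ![e, c, a, b, f, d]
      = covDeriv G (covDeriv G (riemannT G)) x ![c, e, a, b, f, d]
      - (∑ t, riemannUp G t a e c x * riemannT G x ![t, b, f, d]
        + ∑ t, riemannUp G t b e c x * riemannT G x ![a, t, f, d]
        + ∑ t, riemannUp G t f e c x * riemannT G x ![a, b, t, d]
        + ∑ t, riemannUp G t d e c x * riemannT G x ![a, b, f, t]) := by
  have h := hG.ricci_identity hG.smooth_riemannT hx e c ![a, b, f, d]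
  rw [Fin.sum_univ_four] at h
  have h' : covDeriv G (covDeriv G (riemannT G)) x ![e, c, a, b, f, d]
      - covDeriv G (covDeriv G (riemannT G)) x ![c, e, a, b, f, d]
      = - (∑ t, riemannUp G t a e c x * riemannT G x ![t, b, f, d]
        + ∑ t, riemannUp G t b e c x * riemannT G x ![a, t, f, d]
        + ∑ t, riemannUp G t f e c x * riemannT G x ![a, b, t, d]
        + ∑ t, riemannUp G t d e c x * riemannT G x ![a, b, f, t]) := by
    have u0 : ∀ t, Function.update ![a, b, f, d] 0 t = ![t, b, f, d] := by
      intro t; ext i; fin_cases i <;> rfl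
    have u1 : ∀ t, Function.update ![a, b, f, d] 1 t = ![a, t, f, d] := by
      intro t; ext i; fin_cases i <;> rfl
    have u2 : ∀ t, Function.update ![a, b, f, d] 2 t = ![a, b, t, d] := by
      intro t; ext i; fin_cases i <;> rfl
    have u3 : ∀ t, Function.update ![a, b, f, d] 3 t = ![a, b, f, t] := by
      intro t; ext i; fin_cases i <;> rfl
    simp_rw [u0, u1, u2, u3] at h
    exact h
  linarith

/-- Exchanging the derivatives `e` and `c` leaves the derivative of the divergence, which is zero,
and the four curvature terms of the Ricci identity. The term acting on the contracted slot `f` is a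
Ricci trace, so only the three terms of `curvQuad` survive. -/
theorem trace_commutator (hG : MetricOn G U) (hv : ∀ y ∈ U, ∀ μ ν, ricci G μ ν y = 0)
    (hx : x ∈ U) (a b c d : Fin 4) :
    ∑ e, ∑ f, (G x)⁻¹ e f * covDeriv G (covDeriv G (riemannT G)) x ![e, c, a, b, f, d]
      = curvQuad (G x) (riemannT G x) a b c d := by
  -- After lowering `t` and using antisymmetry in the first pair, this trace is minus the Ricci
  -- tensor.
  have h0 : ∀ t, ∑ e, ∑ f, (G x)⁻¹ e f * riemannUp G t f e c x = 0 := by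
    intro t
    have : ∀ s, ∑ e, ∑ f, (G x)⁻¹ e f * riemann G s f e c x = 0 := by
      intro s
      rw [← neg_eq_zero, ← hv x hx s c, ← hG.trace_riemann hx, ← Finset.sum_neg_distrib]
      refine Finset.sum_congr rfl fun e _ => ?_
      rw [← Finset.sum_neg_distrib]
      refine Finset.sum_congr rfl fun f _ => ?_
      rw [hG.riemann_antisymm_left hx]
      ring
    simp_rw [hG.riemannUp_eq_raise hx, Finset.mul_sum]
    calc _ = ∑ s, (G x)⁻¹ t s * ∑ e, ∑ f, (G x)⁻¹ e f * riemann G s f e c x := by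
          simp_rw [Finset.mul_sum]
          symm
          rw [Finset.sum_comm]
          refine Finset.sum_congr rfl fun e _ => ?_
          rw [Finset.sum_comm]
          refine Finset.sum_congr rfl fun f _ => Finset.sum_congr rfl fun s _ => ?_
          ring
      _ = 0 := by simp [this]
  have h1 : ∑ e, ∑ f, (G x)⁻¹ e f * ∑ t, riemannUp G t f e c x * riemannT G x ![a, b, t, d]
      = 0 := by
    calc _ = ∑ t, (∑ e, ∑ f, (G x)⁻¹ e f * riemannUp G t f e c x) * riemannT G x ![a, b, t, d] := by
          simp_rw [Finset.mul_sum, Finset.sum_mul]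
          symm
          rw [Finset.sum_comm]
          refine Finset.sum_congr rfl fun e _ => ?_
          rw [Finset.sum_comm]
          refine Finset.sum_congr rfl fun f _ => Finset.sum_congr rfl fun t _ => ?_
          ring
      _ = 0 := by simp [h0]
  rw [Finset.sum_congr rfl fun e _ => Finset.sum_congr rfl fun f _ =>
    congrArg ((G x)⁻¹ e f * ·) (hG.ricci_riemannT hx e c a b f d)]
  simp_rw [mul_sub, mul_add, Finset.sum_sub_distrib, Finset.sum_add_distrib]
  rw [hG.trace_covDeriv_covDeriv_riemannT hv hx, h1, zero_sub, add_zero, curvQuad]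
  rw [← Finset.sum_add_distrib, ← Finset.sum_add_distrib, neg_inj]
  refine Finset.sum_congr rfl fun e _ => ?_
  rw [← Finset.sum_add_distrib, ← Finset.sum_add_distrib]
  refine Finset.sum_congr rfl fun f _ => ?_
  rw [← mul_add, ← mul_add, ← Finset.sum_add_distrib, ← Finset.sum_add_distrib, Finset.mul_sum]
  refine Finset.sum_congr rfl fun t _ => ?_
  simp_rw [hG.riemannUp_eq_raise hx, Finset.sum_mul]
  rw [← Finset.sum_add_distrib, ← Finset.sum_add_distrib, Finset.mul_sum]
  refine Finset.sum_congr rfl fun s _ => ?_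
  simp only [riemannT]
  change _ = (G x)⁻¹ e f * (G x)⁻¹ t s *
    (riemann G s a e c x * riemann G t b f d x + riemann G s b e c x * riemann G a t f d x
      + riemann G s d e c x * riemann G a b f t x)
  change (G x)⁻¹ e f * ((G x)⁻¹ t s * riemann G s a e c x * riemann G t b f d x
    + (G x)⁻¹ t s * riemann G s b e c x * riemann G a t f d x
    + (G x)⁻¹ t s * riemann G s d e c x * riemann G a b f t x) = _
  ring

/-- The wave equation of the Weyl tensor in vacuum. -/
theorem box_weyl (hG : MetricOn G U) (hv : ∀ y ∈ U, ∀ μ ν, ricci G μ ν y = 0) (hx : x ∈ U)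
    (α : Fin 4 → Fin 4) : dAlembertian G (weyl G) x α = boxQuad (G x) (weyl G x) α := by
  -- The Weyl and curvature tensors agree on the whole open set `U`, hence so do their derivatives
  -- at `x`.
  have h1 : ∀ β, covDeriv G (covDeriv G (weyl G)) x β
      = covDeriv G (covDeriv G (riemannT G)) x β := fun β =>
    covDeriv_congr hG.isOpen (fun y hy α => covDeriv_congr hG.isOpen
      (fun z hz α => weyl_eq_riemannT hv hz α) hy α) hx β
  have h2 : weyl G x = riemannT G x := funext fun α => weyl_eq_riemannT hv hx α
  -- Bianchi under the outer derivative splits the d'Alembertian into two traces of the kind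
  -- computed by `trace_commutator`.
  have h3 : ∀ σ τ, covDeriv G (covDeriv G (riemannT G)) x
      (Fin.cons σ (Fin.cons τ α : Fin 5 → Fin 4)) =
      covDeriv G (covDeriv G (riemannT G)) x ![σ, α 2, α 0, α 1, τ, α 3]
      - covDeriv G (covDeriv G (riemannT G)) x ![σ, α 3, α 0, α 1, τ, α 2] := by
    intro σ τ
    rw [← hG.bianchi_covDeriv hx, ← vec4_eta α]
    rfl
  unfold dAlembertian boxQuad
  simp_rw [h1, h2, h3, mul_sub, Finset.sum_sub_distrib, hG.trace_commutator hv hx]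

end MetricOn

end

section

/-! ### Components with respect to a frame -/

section sums

theorem sum_comm_four {P : Type*} [Fintype P] (f : Fin 4 → Fin 4 → Fin 4 → Fin 4 → P → ℝ) :
    ∑ a, ∑ b, ∑ c, ∑ d, ∑ p, f a b c d p = ∑ p, ∑ a, ∑ b, ∑ c, ∑ d, f a b c d p := by
  have h : ∀ f : Fin 4 → P → ℝ, ∑ d, ∑ p, f d p = ∑ p, ∑ d, f d p := fun f => Finset.sum_comm
  simp_rw [h]

theorem sum_kernel_mul {P : Type*} [Fintype P] (K : P → ℝ) (F H : P → Fin 4 → Fin 4 → ℝ)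
    (x y z w : Fin 4 → ℝ) :
    ∑ a, ∑ b, ∑ c, ∑ d, (∑ p, K p * (F p a b * H p c d)) * (x a * y b * z c * w d)
      = ∑ p, K p * ((∑ a, ∑ b, F p a b * x a * y b) * ∑ c, ∑ d, H p c d * z c * w d) := by
  simp_rw [Finset.sum_mul]
  rw [sum_comm_four]
  refine Finset.sum_congr rfl fun p _ => ?_
  simp_rw [Finset.mul_sum]
  refine Finset.sum_congr rfl fun a _ => Finset.sum_congr rfl fun b _ =>
    Finset.sum_congr rfl fun c _ => Finset.sum_congr rfl fun d _ => ?_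
  ring

theorem sum4_congr {f h : Fin 4 → Fin 4 → Fin 4 → Fin 4 → ℝ} (H : ∀ a b c d, f a b c d = h a b c d) :
    ∑ a, ∑ b, ∑ c, ∑ d, f a b c d = ∑ a, ∑ b, ∑ c, ∑ d, h a b c d := by
  simp_rw [H]

theorem sum4_swap12 (f : Fin 4 → Fin 4 → Fin 4 → Fin 4 → ℝ) :
    ∑ a, ∑ b, ∑ c, ∑ d, f a b c d = ∑ a, ∑ b, ∑ c, ∑ d, f b a c d := Finset.sum_comm

theorem sum4_swap23 (f : Fin 4 → Fin 4 → Fin 4 → Fin 4 → ℝ) :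
    ∑ a, ∑ b, ∑ c, ∑ d, f a b c d = ∑ a, ∑ b, ∑ c, ∑ d, f a c b d :=
  Finset.sum_congr rfl fun _ _ => Finset.sum_comm

theorem sum4_swap34 (f : Fin 4 → Fin 4 → Fin 4 → Fin 4 → ℝ) :
    ∑ a, ∑ b, ∑ c, ∑ d, f a b c d = ∑ a, ∑ b, ∑ c, ∑ d, f a b d c :=
  Finset.sum_congr rfl fun _ _ => Finset.sum_congr rfl fun _ _ => Finset.sum_comm

/-- With q = A diag(s) Aᵀ, contraction with q becomes a signed sum over the columns of A. This is
how every index contraction below is moved to a frame. -/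
theorem contract_frame {q A : Matrix (Fin 4) (Fin 4) ℝ} {s : Fin 4 → ℝ}
    (hq : q = A * Matrix.diagonal s * A.transpose) (M : Fin 4 → Fin 4 → ℝ) :
    ∑ e, ∑ f, q e f * M e f = ∑ i, s i * ∑ e, ∑ f, M e f * A e i * A f i := by
  have : ∀ e f, q e f = ∑ i, s i * (A e i * A f i) := by
    intro e f
    rw [hq, Matrix.mul_apply]
    refine Finset.sum_congr rfl fun i _ => ?_
    rw [Matrix.mul_diagonal, Matrix.transpose_apply]; ring
  simp_rw [this, Finset.sum_mul, Finset.mul_sum]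
  symm
  rw [Finset.sum_comm]
  refine Finset.sum_congr rfl fun e _ => ?_
  rw [Finset.sum_comm]
  refine Finset.sum_congr rfl fun f _ => Finset.sum_congr rfl fun i _ => ?_
  ring

theorem contract_frame_mul {q A : Matrix (Fin 4) (Fin 4) ℝ} {s : Fin 4 → ℝ}
    (hq : q = A * Matrix.diagonal s * A.transpose) (X Y : Fin 4 → ℝ) :
    ∑ e, ∑ f, q e f * (X e * Y f) = ∑ i, s i * ((∑ e, X e * A e i) * ∑ f, Y f * A f i) := by
  rw [contract_frame hq]
  refine Finset.sum_congr rfl fun i _ => ?_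
  rw [Finset.sum_mul_sum]
  congr 1
  exact Finset.sum_congr rfl fun _ _ => Finset.sum_congr rfl fun _ _ => by ring

theorem contract_frame_two {q A : Matrix (Fin 4) (Fin 4) ℝ} {s : Fin 4 → ℝ}
    (hq : q = A * Matrix.diagonal s * A.transpose) (F H : Fin 4 → Fin 4 → ℝ) :
    ∑ e, ∑ f, ∑ t, ∑ u, q e f * q t u * (F u e * H t f) = ∑ i, ∑ j, s i * s j *
      ((∑ u, ∑ e, F u e * A u j * A e i) * ∑ t, ∑ f, H t f * A t j * A f i) := by
  have h1 : ∀ e f, ∑ t, ∑ u, q e f * q t u * (F u e * H t f) =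
      q e f * ∑ j, s j * ((∑ u, F u e * A u j) * ∑ t, H t f * A t j) := by
    intro e f
    simp_rw [mul_comm (∑ u, F u e * A u _)]
    rw [← contract_frame_mul hq, Finset.mul_sum]
    refine Finset.sum_congr rfl fun t _ => ?_
    rw [Finset.mul_sum]
    exact Finset.sum_congr rfl fun u _ => by ring
  simp_rw [h1]
  rw [contract_frame hq]
  refine Finset.sum_congr rfl fun i _ => ?_
  simp_rw [mul_assoc (s i), ← Finset.mul_sum]
  congr 1
  have h2 : ∀ F : Fin 4 → Fin 4 → ℝ, ∀ j, ∑ u, ∑ e, F u e * A u j * A e i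
      = ∑ e, (∑ u, F u e * A u j) * A e i := by
    intro F j
    rw [Finset.sum_comm]
    simp_rw [Finset.sum_mul]
  have h3 : ∀ (X Y : Fin 4 → Fin 4 → ℝ), ∑ e, ∑ f, (∑ j, s j * (X j e * Y j f)) * A e i * A f i
      = ∑ j, s j * ((∑ e, X j e * A e i) * ∑ f, Y j f * A f i) := by
    intro X Y
    simp_rw [Finset.sum_mul_sum, Finset.mul_sum, Finset.sum_mul]
    symm
    rw [Finset.sum_comm]
    refine Finset.sum_congr rfl fun e _ => ?_
    rw [Finset.sum_comm]
    exact Finset.sum_congr rfl fun f _ => Finset.sum_congr rfl fun j _ => by ring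
  refine (h3 (fun j e => ∑ u, F u e * A u j) (fun j f => ∑ t, H t f * A t j)).trans ?_
  simp_rw [h2]

/-- Evaluation of a doubly contracted product of two tensors of rank four. -/
theorem contract_frame_tensor {q A : Matrix (Fin 4) (Fin 4) ℝ} {s : Fin 4 → ℝ}
    (hq : q = A * Matrix.diagonal s * A.transpose) (X Y : Fin 4 → Fin 4 → Fin 4 → Fin 4 → ℝ)
    (x y z w : Fin 4 → ℝ) :
    ∑ a, ∑ b, ∑ c, ∑ d, (∑ e, ∑ f, ∑ t, ∑ u, q e f * q t u * (X u e a b * Y t f c d)) *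
      (x a * y b * z c * w d) = ∑ i, ∑ j, s i * s j *
      ((∑ u, ∑ e, ∑ a, ∑ b, X u e a b * A u j * A e i * x a * y b) *
        ∑ t, ∑ f, ∑ c, ∑ d, Y t f c d * A t j * A f i * z c * w d) := by
  have h := sum_kernel_mul (P := Fin 4 × Fin 4 × Fin 4 × Fin 4)
    (fun p => q p.1 p.2.1 * q p.2.2.1 p.2.2.2) (fun p a b => X p.2.2.2 p.1 a b)
    (fun p c d => Y p.2.2.1 p.2.1 c d) x y z w
  simp only [Fintype.sum_prod_type] at h
  rw [h, contract_frame_two hq (fun u e => ∑ a, ∑ b, X u e a b * x a * y b)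
    (fun t f => ∑ c, ∑ d, Y t f c d * z c * w d)]
  have h2 : ∀ (X : Fin 4 → Fin 4 → Fin 4 → Fin 4 → ℝ) (x y : Fin 4 → ℝ) (i j : Fin 4),
      ∑ u, ∑ e, (∑ a, ∑ b, X u e a b * x a * y b) * A u j * A e i
      = ∑ u, ∑ e, ∑ a, ∑ b, X u e a b * A u j * A e i * x a * y b := by
    intro X x y i j
    simp_rw [Finset.sum_mul]
    exact sum4_congr fun _ _ _ _ => by ring
  simp_rw [h2]

end sums

/-- The value of a tensor of rank four on four vectors. -/
def ev4 (T : (Fin 4 → Fin 4) → ℝ) (x y z w : Fin 4 → ℝ) : ℝ :=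
  ∑ i, ∑ j, ∑ k, ∑ l, T ![i, j, k, l] * x i * y j * z k * w l

section ev4

variable {T T' : (Fin 4 → Fin 4) → ℝ}

theorem ev4_antisymm_left (h : ∀ a b c d, T ![a, b, c, d] = -T ![b, a, c, d])
    (x y z w : Fin 4 → ℝ) : ev4 T x y z w = -ev4 T y x z w := by
  unfold ev4
  rw [sum4_swap12]
  simp_rw [← Finset.sum_neg_distrib]
  exact sum4_congr fun a b c d => by rw [h]; ring

theorem ev4_antisymm_right (h : ∀ a b c d, T ![a, b, c, d] = -T ![a, b, d, c])
    (x y z w : Fin 4 → ℝ) : ev4 T x y z w = -ev4 T x y w z := by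
  unfold ev4
  rw [sum4_swap34]
  simp_rw [← Finset.sum_neg_distrib]
  exact sum4_congr fun a b c d => by rw [h]; ring

theorem ev4_pair_symm (h : ∀ a b c d, T ![a, b, c, d] = T ![c, d, a, b])
    (x y z w : Fin 4 → ℝ) : ev4 T x y z w = ev4 T z w x y := by
  unfold ev4
  rw [sum4_swap23, sum4_swap12, sum4_swap34, sum4_swap23]
  exact sum4_congr fun a b c d => by rw [h]; ring

theorem ev4_cyclic (h : ∀ a b c d, T ![a, b, c, d] + T ![a, c, d, b] + T ![a, d, b, c] = 0)
    (x y z w : Fin 4 → ℝ) : ev4 T x y z w + ev4 T x z w y + ev4 T x w y z = 0 := by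
  unfold ev4
  have h1 : ∑ i, ∑ j, ∑ k, ∑ l, T ![i, j, k, l] * x i * z j * w k * y l
      = ∑ i, ∑ j, ∑ k, ∑ l, T ![i, k, l, j] * x i * y j * z k * w l := by
    rw [sum4_swap34, sum4_swap23]
    exact sum4_congr fun a b c d => by ring
  have h2 : ∑ i, ∑ j, ∑ k, ∑ l, T ![i, j, k, l] * x i * w j * y k * z l
      = ∑ i, ∑ j, ∑ k, ∑ l, T ![i, l, j, k] * x i * y j * z k * w l := by
    rw [sum4_swap23, sum4_swap34]
    exact sum4_congr fun a b c d => by ring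
  rw [h1, h2]
  simp_rw [← Finset.sum_add_distrib]
  refine Finset.sum_eq_zero fun a _ => Finset.sum_eq_zero fun b _ => Finset.sum_eq_zero fun c _ =>
    Finset.sum_eq_zero fun d _ => ?_
  linear_combination (x a * y b * z c * w d) * h a b c d

theorem ev4_sub (x y z w : Fin 4 → ℝ) :
    ev4 (fun α => T α - T' α) x y z w = ev4 T x y z w - ev4 T' x y z w := by
  unfold ev4
  simp_rw [sub_mul, Finset.sum_sub_distrib]

theorem ev4_trace {q A : Matrix (Fin 4) (Fin 4) ℝ} {s : Fin 4 → ℝ}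
    (hq : q = A * Matrix.diagonal s * A.transpose)
    (h : ∀ l ν, ∑ e, ∑ f, q e f * T ![f, l, e, ν] = 0) (x y : Fin 4 → ℝ) :
    ∑ i, s i * ev4 T (fun k => A k i) x (fun k => A k i) y = 0 := by
  have h1 : ∀ i, ev4 T (fun k => A k i) x (fun k => A k i) y
      = ∑ l, ∑ ν, (∑ e, ∑ f, T ![f, l, e, ν] * A e i * A f i) * (x l * y ν) := by
    intro i
    unfold ev4
    rw [sum4_swap12]
    refine Finset.sum_congr rfl fun l _ => ?_
    rw [Finset.sum_congr rfl fun f _ => Finset.sum_comm, Finset.sum_comm]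
    refine Finset.sum_congr rfl fun ν _ => ?_
    rw [Finset.sum_comm, Finset.sum_mul]
    refine Finset.sum_congr rfl fun e _ => ?_
    rw [Finset.sum_mul]
    exact Finset.sum_congr rfl fun f _ => by ring
  simp_rw [h1, Finset.mul_sum]
  rw [Finset.sum_comm]
  refine Finset.sum_eq_zero fun l _ => ?_
  rw [Finset.sum_comm]
  refine Finset.sum_eq_zero fun ν _ => ?_
  simp_rw [← mul_assoc]
  simp_rw [← Finset.sum_mul]
  rw [← contract_frame hq (fun e f => T ![f, l, e, ν]), h, zero_mul, zero_mul]

/-- Each of the three products is a double contraction of two tensors, evaluated by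
`contract_frame_tensor`. The summation swaps only align the order of the free slots. -/
theorem ev4_curvQuad {g A : Matrix (Fin 4) (Fin 4) ℝ} {s : Fin 4 → ℝ}
    (hq : g⁻¹ = A * Matrix.diagonal s * A.transpose) (x y z w : Fin 4 → ℝ) :
    ev4 (fun α => curvQuad g T (α 0) (α 1) (α 2) (α 3)) x y z w =
      -∑ i, ∑ j, s i * s j * (
        ev4 T (fun k => A k j) x (fun k => A k i) z * ev4 T (fun k => A k j) y (fun k => A k i) w
        + ev4 T (fun k => A k j) y (fun k => A k i) z * ev4 T x (fun k => A k j) (fun k => A k i) w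
        + ev4 T (fun k => A k j) w (fun k => A k i) z
          * ev4 T x y (fun k => A k i) (fun k => A k j)) := by
  have e1 := contract_frame_tensor hq (fun u e a c => T ![u, a, e, c])
    (fun t f b d => T ![t, b, f, d]) x z y w
  have e2 := contract_frame_tensor hq (fun u e b c => T ![u, b, e, c])
    (fun t f a d => T ![a, t, f, d]) y z x w
  have e3 := contract_frame_tensor hq (fun u e d c => T ![u, d, e, c])
    (fun t f a b => T ![a, b, f, t]) w z x y
  rw [sum4_swap23] at e1
  rw [sum4_swap23, sum4_swap12] at e2
  rw [sum4_swap23, sum4_swap12, sum4_swap34, sum4_swap23, sum4_swap34] at e3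
  have r1 : ∀ x y z w : Fin 4 → ℝ, ∑ u, ∑ e, ∑ a, ∑ c, T ![u, a, e, c] * x u * y e * z a * w c
      = ev4 T x z y w := by
    intro x y z w
    rw [sum4_swap23]
    exact sum4_congr fun _ _ _ _ => by ring
  have r2 : ∀ x y z w : Fin 4 → ℝ, ∑ u, ∑ e, ∑ a, ∑ c, T ![a, u, e, c] * x u * y e * z a * w c
      = ev4 T z x y w := by
    intro x y z w
    rw [sum4_swap23, sum4_swap12]
    exact sum4_congr fun _ _ _ _ => by ring
  have r3 : ∀ x y z w : Fin 4 → ℝ, ∑ u, ∑ e, ∑ a, ∑ c, T ![a, c, e, u] * x u * y e * z a * w c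
      = ev4 T z w y x := by
    intro x y z w
    rw [sum4_swap23, sum4_swap12, sum4_swap34, sum4_swap23, sum4_swap34]
    exact sum4_congr fun _ _ _ _ => by ring
  simp_rw [r1] at e1
  simp_rw [r1, r2] at e2
  simp_rw [r1, r3] at e3
  simp_rw [mul_add, Finset.sum_add_distrib]
  rw [← e1, ← e2, ← e3]
  simp_rw [← Finset.sum_add_distrib, ← Finset.sum_neg_distrib]
  unfold ev4 curvQuad
  refine sum4_congr fun a b c d => ?_
  simp_rw [mul_add, Finset.sum_add_distrib]
  simp
  ring

end ev4

end

/-! ### Orthonormal frames, the volume form and congruence of the quadratic expressions. -/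

section

/-- The signs of the Minkowski metric. -/
def sgn : Fin 4 → ℝ := ![-1, 1, 1, 1]

/-- The columns of `A` are an orthonormal frame for `g`. -/
def IsFrame (g A : Matrix (Fin 4) (Fin 4) ℝ) : Prop :=
  A.transpose * g * A = Matrix.diagonal sgn

/-- The components in the frame `A`. -/
def frameComp (A : Matrix (Fin 4) (Fin 4) ℝ) (T : (Fin 4 → Fin 4) → ℝ) (a b c d : Fin 4) : ℝ :=
  ev4 T (fun k => A k a) (fun k => A k b) (fun k => A k c) (fun k => A k d)

section frame

variable {g A : Matrix (Fin 4) (Fin 4) ℝ} {T : (Fin 4 → Fin 4) → ℝ}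

theorem sgn_mul_sgn : Matrix.diagonal sgn * Matrix.diagonal sgn = 1 := by
  rw [Matrix.diagonal_mul_diagonal, ← Matrix.diagonal_one]
  congr 1
  ext i; fin_cases i <;> simp [sgn]

theorem IsFrame.det (h : IsFrame g A) : A.det * g.det * A.det = -1 := by
  have := congrArg Matrix.det h
  rw [Matrix.det_mul, Matrix.det_mul, Matrix.det_transpose, Matrix.det_diagonal] at this
  rw [this, Fin.prod_univ_four]
  simp [sgn]

theorem IsFrame.isUnit_det (h : IsFrame g A) : IsUnit A.det := by
  rw [isUnit_iff_ne_zero]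
  intro h0
  have := h.det
  rw [h0] at this
  norm_num at this

theorem IsFrame.inv_eq (h : IsFrame g A) : g⁻¹ = A * Matrix.diagonal sgn * A.transpose := by
  refine Matrix.inv_eq_right_inv ?_
  have hT : IsUnit A.transpose.det := by rw [Matrix.det_transpose]; exact h.isUnit_det
  have h1 : A.transpose * (g * (A * Matrix.diagonal sgn * A.transpose)) = A.transpose := by
    calc _ = (A.transpose * g * A) * Matrix.diagonal sgn * A.transpose := by
          simp only [Matrix.mul_assoc]
      _ = A.transpose := by rw [h, sgn_mul_sgn, Matrix.one_mul]
  have h2 := congrArg (A.transpose⁻¹ * ·) h1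
  simpa only [Matrix.nonsing_inv_mul_cancel_left _ _ hT, Matrix.nonsing_inv_mul _ hT] using h2

theorem IsFrame.cancel (h : IsFrame g A) {X Y : Matrix (Fin 4) (Fin 4) ℝ}
    (hXY : A.transpose * X * A = A.transpose * Y * A) : X = Y := by
  have hT : IsUnit A.transpose.det := by rw [Matrix.det_transpose]; exact h.isUnit_det
  have := congrArg (fun M => A.transpose⁻¹ * (M * A⁻¹)) hXY
  simpa only [Matrix.mul_nonsing_inv_cancel_right _ _ h.isUnit_det,
    Matrix.nonsing_inv_mul_cancel_left _ _ hT] using this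

/-! ### The volume form in a frame -/

/-- The antisymmetric symbol. -/
def levi (a b c d : Fin 4) : ℝ :=
  (Matrix.of fun i j : Fin 4 => if ![a, b, c, d] i = j then (1 : ℝ) else 0).det

theorem levi_eq (a b c d : Fin 4) : levi a b c d = ∑ σ : Equiv.Perm (Fin 4),
    ((Equiv.Perm.sign σ : ℤ) : ℝ) * ((if a = σ 0 then 1 else 0) * (if b = σ 1 then 1 else 0)
      * (if c = σ 2 then 1 else 0) * (if d = σ 3 then 1 else 0)) := by
  rw [levi, ← Matrix.det_transpose, Matrix.det_apply']
  refine Finset.sum_congr rfl fun σ _ => ?_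
  rw [Fin.prod_univ_four]
  rfl

theorem sum_levi (v : Fin 4 → Fin 4 → ℝ) :
    ∑ a, ∑ b, ∑ c, ∑ d, levi a b c d * v 0 a * v 1 b * v 2 c * v 3 d = (Matrix.of v).det := by
  rw [← Matrix.det_transpose, Matrix.det_apply']
  simp_rw [levi_eq, Finset.sum_mul]
  rw [sum_comm_four]
  refine Finset.sum_congr rfl fun σ _ => ?_
  rw [Fin.prod_univ_four]
  simp [mul_assoc, ite_mul, mul_ite]

/-- The sign of the orientation in a frame. -/
def frameSign (g A : Matrix (Fin 4) (Fin 4) ℝ) (o : ℤˣ) : ℝ :=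
  ((o : ℤ) : ℝ) * Real.sqrt |g.det| * A.det

/-- From det g · (det A)² = -1 it follows that |det g| (det A)² = 1, and the orientation sign
squares to one. -/
theorem IsFrame.frameSign_sq (h : IsFrame g A) (o : ℤˣ) : frameSign g A o ^ 2 = 1 := by
  have h1 : (((o : ℤ) : ℝ)) ^ 2 = 1 := by
    rcases Int.units_eq_one_or o with rfl | rfl <;> simp
  have h2 : Real.sqrt |g.det| ^ 2 = |g.det| := Real.sq_sqrt (abs_nonneg _)
  have h3 : |g.det| = - g.det := by
    rw [abs_of_neg]
    have := h.det
    by_contra hneg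
    push Not at hneg
    nlinarith [mul_nonneg hneg (sq_nonneg A.det)]
  rw [frameSign, mul_pow, mul_pow, h1, h2, h3]
  linarith [h.det]

theorem volForm_eq (o : ℤˣ) (a b c d : Fin 4) :
    volForm g o ![a, b, c, d] = ((o : ℤ) : ℝ) * Real.sqrt |g.det| * levi a b c d := rfl

/-- The matrix formed from the columns a, b, c, d of A is the selection matrix defining `levi` times
Aᵀ, so multiplicativity of the determinant gives the two factors. -/
theorem frameComp_volForm (o : ℤˣ) (a b c d : Fin 4) :
    frameComp A (volForm g o) a b c d = frameSign g A o * levi a b c d := by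
  have h : ∑ i, ∑ j, ∑ k, ∑ l, levi i j k l * A i a * A j b * A k c * A l d
      = (Matrix.of fun i j => A j (![a, b, c, d] i)).det :=
    sum_levi (fun i j => A j (![a, b, c, d] i))
  have h2 : (Matrix.of fun i j => A j (![a, b, c, d] i)) =
      (Matrix.of fun i j : Fin 4 => if ![a, b, c, d] i = j then (1 : ℝ) else 0) * A.transpose := by
    ext i j
    simp [Matrix.mul_apply]
  rw [h2, Matrix.det_mul, Matrix.det_transpose, ← levi] at h
  rw [frameSign, mul_assoc, mul_comm A.det, ← h]
  simp_rw [Finset.mul_sum, frameComp, ev4, volForm_eq]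
  exact sum4_congr fun i j k l => by ring

theorem IsFrame.frameComp_dual (h : IsFrame g A) (o : ℤˣ) (a b c d : Fin 4) :
    frameComp A (dual g o T) a b c d = (1 / 2) * ∑ i, ∑ j, sgn i * sgn j *
      (frameComp A T a b j i * (frameSign g A o * levi j i c d)) := by
  have hs : ∀ t u, g⁻¹ t u = g⁻¹ u t := by
    intro t u
    have : (g⁻¹).transpose = g⁻¹ := by
      rw [h.inv_eq]
      simp [Matrix.transpose_mul, Matrix.mul_assoc]
    exact congrFun (congrFun this u) t
  have e1 := contract_frame_tensor h.inv_eq (fun u e a b => T ![a, b, u, e])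
    (fun t f c d => volForm g o ![t, f, c, d]) (fun k => A k a) (fun k => A k b) (fun k => A k c)
    (fun k => A k d)
  have r3 : ∀ x y z w : Fin 4 → ℝ, ∑ u, ∑ e, ∑ a, ∑ c, T ![a, c, u, e] * x u * y e * z a * w c
      = ev4 T z w x y := by
    intro x y z w
    rw [sum4_swap23, sum4_swap12, sum4_swap34, sum4_swap23]
    exact sum4_congr fun _ _ _ _ => by ring
  simp_rw [r3] at e1
  simp_rw [← frameComp_volForm]
  refine Eq.trans ?_ (congrArg (1 / 2 * ·) e1)
  rw [Finset.mul_sum]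
  simp_rw [Finset.mul_sum (a := (1 / 2 : ℝ)), frameComp, ev4]
  refine sum4_congr fun i j k l => ?_
  have e2 : dual g o T ![i, j, k, l] = 1 / 2 * ∑ e, ∑ f, ∑ t, ∑ u, g⁻¹ e f * g⁻¹ t u *
      (T ![i, j, u, e] * volForm g o ![t, f, k, l]) := by
    unfold dual
    congr 1
    rw [sum4_swap12, sum4_swap34, sum4_swap23, sum4_swap34]
    refine sum4_congr fun e f t u => ?_
    rw [hs t u]
    change T ![i, j, u, e] * (g⁻¹ u t * g⁻¹ e f * volForm g o ![t, f, k, l]) = _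
    ring
  rw [e2]
  ring

/-! ### Electric part and quadratic expressions in a frame -/

theorem ev4_sum_first {ι : Type*} [Fintype ι] (a : ι → ℝ) (P : ι → Fin 4 → ℝ)
    (y z w : Fin 4 → ℝ) :
    ev4 T (fun μ => ∑ τ, a τ * P τ μ) y z w = ∑ τ, a τ * ev4 T (P τ) y z w := by
  unfold ev4
  simp_rw [Finset.mul_sum, Finset.sum_mul]
  rw [sum_comm_four]
  refine Finset.sum_congr rfl fun τ _ => sum4_congr fun _ _ _ _ => by ring

theorem ev4_sum_third {ι : Type*} [Fintype ι] (a : ι → ℝ) (P : ι → Fin 4 → ℝ)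
    (x y w : Fin 4 → ℝ) :
    ev4 T x y (fun μ => ∑ τ, a τ * P τ μ) w = ∑ τ, a τ * ev4 T x y (P τ) w := by
  unfold ev4
  simp_rw [Finset.mul_sum, Finset.sum_mul]
  rw [sum_comm_four]
  refine Finset.sum_congr rfl fun τ _ => sum4_congr fun _ _ _ _ => by ring

theorem ev4_zero_first (y z w : Fin 4 → ℝ) : ev4 T (fun _ => 0) y z w = 0 := by
  simp [ev4]

theorem ev4_zero_third (x y w : Fin 4 → ℝ) : ev4 T x y (fun _ => 0) w = 0 := by
  simp [ev4]

variable {n : Eu 4}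

theorem IsFrame.sum_lower (h : IsFrame g A) (hn : ∀ i, n i = A i 0) (a : Fin 4) :
    ∑ τ, lower g n τ * A τ a = if a = 0 then -1 else 0 := by
  have h1 := congrFun (congrFun h a) 0
  have h2 : (A.transpose * g * A) a 0 = ∑ τ, lower g n τ * A τ a := by
    rw [Matrix.mul_assoc, Matrix.mul_apply]
    refine Finset.sum_congr rfl fun τ _ => ?_
    rw [Matrix.mul_apply, Matrix.transpose_apply, lower, mul_comm]
    simp_rw [hn]
  rw [← h2, h1, Matrix.diagonal_apply]
  split_ifs with h0
  · rw [h0]; simp [sgn]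
  · rfl

theorem IsFrame.sum_proj (h : IsFrame g A) (hn : ∀ i, n i = A i 0) (a μ : Fin 4) :
    ∑ τ, A τ a * proj g n μ τ = if a = 0 then 0 else A μ a := by
  have h1 := h.sum_lower hn a
  have h2 : ∑ τ, A τ a * proj g n μ τ = A μ a + n μ * ∑ τ, lower g n τ * A τ a := by
    simp_rw [proj, mul_add, Finset.sum_add_distrib, Finset.mul_sum]
    congr 1
    · simp
    · exact Finset.sum_congr rfl fun τ _ => by ring
  rw [h2, h1]
  split_ifs with h0
  · rw [h0, hn]; ring
  · ring

theorem IsFrame.electric_apply (h : IsFrame g A) (hn : ∀ i, n i = A i 0) (a b : Fin 4) :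
    (A.transpose * electric g n T * A) a b
      = if a = 0 ∨ b = 0 then 0 else frameComp A T a 0 b 0 := by
  have h1 : (A.transpose * electric g n T * A) a b = ev4 T (fun μ => ∑ τ, A τ a * proj g n μ τ)
      (fun i => n i) (fun μ => ∑ σ, A σ b * proj g n μ σ) (fun i => n i) := by
    rw [ev4_sum_third, Matrix.mul_apply]
    refine Finset.sum_congr rfl fun σ _ => ?_
    rw [ev4_sum_first, Matrix.mul_apply, mul_comm]
    rfl
  rw [h1]
  simp_rw [h.sum_proj hn, hn]
  by_cases ha : a = 0
  · simp [ha, ev4_zero_first]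
  by_cases hb : b = 0
  · simp [hb, ev4_zero_third]
  · simp [ha, hb, frameComp]

theorem IsFrame.spatialMetric_apply (h : IsFrame g A) (hn : ∀ i, n i = A i 0) :
    A.transpose * spatialMetric g n * A = Matrix.diagonal ![0, 1, 1, 1] := by
  have h1 : spatialMetric g n = g + Matrix.vecMulVec (lower g n) (lower g n) := by
    ext i j; rfl
  have h2 : A.transpose * Matrix.vecMulVec (lower g n) (lower g n) * A
      = Matrix.diagonal ![1, 0, 0, 0] := by
    rw [Matrix.mul_vecMulVec, Matrix.vecMulVec_mul]
    have h3 : ∀ a, Matrix.mulVec A.transpose (lower g n) a = if a = 0 then -1 else 0 := by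
      intro a
      rw [← h.sum_lower hn a]
      simp only [Matrix.mulVec, dotProduct, Matrix.transpose_apply]
      exact Finset.sum_congr rfl fun τ _ => mul_comm (A τ a) (lower g n τ)
    have h4 : ∀ a, Matrix.vecMul (lower g n) A a = if a = 0 then -1 else 0 := by
      intro a
      rw [← h.sum_lower hn a]
      rfl
    ext a b
    rw [Matrix.vecMulVec_apply, h3, h4]
    fin_cases a <;> fin_cases b <;> simp
  rw [h1, Matrix.mul_add, Matrix.add_mul, h2]
  change A.transpose * g * A = _ at h
  rw [h, Matrix.diagonal_add]
  congr 1
  ext i; fin_cases i <;> simp [sgn]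

/-- As a trace, the contraction transforms under congruence by cyclicity alone. -/
theorem contract_eq_trace {ι : Type} [Fintype ι] (q X Y : Matrix ι ι ℝ) :
    contract q X Y = (X.transpose * q * Y * q.transpose).trace := by
  unfold contract Matrix.trace
  rw [Finset.sum_comm]
  refine Finset.sum_congr rfl fun τ _ => ?_
  simp only [Matrix.diag_apply, Matrix.mul_apply, Matrix.transpose_apply, Finset.sum_mul]
  rw [Finset.sum_comm]
  rw [Finset.sum_congr rfl fun κ _ => Finset.sum_comm]
  rw [Finset.sum_comm]
  refine Finset.sum_congr rfl fun l _ => Finset.sum_congr rfl fun κ _ =>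
    Finset.sum_congr rfl fun σ _ => ?_
  ring

theorem contract_congr {ι κ : Type} [Fintype ι] [Fintype κ] (A : Matrix ι κ ℝ) (p : Matrix κ κ ℝ)
    (X Y : Matrix ι ι ℝ) :
    contract p (A.transpose * X * A) (A.transpose * Y * A)
      = contract (A * p * A.transpose) X Y := by
  rw [contract_eq_trace, contract_eq_trace]
  simp only [Matrix.transpose_mul, Matrix.transpose_transpose]
  rw [show A.transpose * (X.transpose * A) * p * (A.transpose * Y * A) * p.transpose
      = A.transpose * (X.transpose * A * p * A.transpose * Y * A * p.transpose) by
    simp only [Matrix.mul_assoc], Matrix.trace_mul_comm]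
  simp only [Matrix.mul_assoc]

/-- The matrix `A` may be rectangular: the same identity changes to an orthonormal frame and pulls
back to a slice by its 4 × 3 Jacobian. This also holds for `quadMagnetic_congr`. -/
theorem quadElectric_congr {ι κ : Type} [Fintype ι] [Fintype κ] (A : Matrix ι κ ℝ)
    (p : Matrix κ κ ℝ) (h E B : Matrix ι ι ℝ) :
    A.transpose * quadElectric (A * p * A.transpose) h E B * A
      = quadElectric p (A.transpose * h * A) (A.transpose * E * A) (A.transpose * B * A) := by
  unfold quadElectric
  rw [contract_congr, contract_congr]
  simp only [Matrix.mul_sub, Matrix.sub_mul, Matrix.mul_smul, Matrix.smul_mul, Matrix.mul_assoc]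

theorem quadMagnetic_congr {ι κ : Type} [Fintype ι] [Fintype κ] (A : Matrix ι κ ℝ)
    (p : Matrix κ κ ℝ) (h E B : Matrix ι ι ℝ) :
    A.transpose * quadMagnetic (A * p * A.transpose) h E B * A
      = quadMagnetic p (A.transpose * h * A) (A.transpose * E * A) (A.transpose * B * A) := by
  have e : ∀ M : Matrix ι ι ℝ, (A.transpose * M * A).transpose = A.transpose * M.transpose * A := by
    intro M; simp [Matrix.transpose_mul, Matrix.mul_assoc]
  have e1 : A.transpose * B * A * p * (A.transpose * E * A)
      = A.transpose * (B * (A * p * A.transpose) * E) * A := by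
    simp only [Matrix.mul_assoc]
  unfold quadMagnetic
  rw [contract_congr, e1, e, Matrix.mul_smul, Matrix.smul_mul, Matrix.mul_sub, Matrix.sub_mul,
    Matrix.mul_smul, Matrix.smul_mul, Matrix.mul_smul, Matrix.smul_mul, Matrix.mul_add,
    Matrix.add_mul]

end frame

end

section

/-! ### The algebra of Weyl tensors -/

/-- The algebraic symmetries of the Weyl tensor, in terms of components. -/
structure IsWeylTensor (g : Matrix (Fin 4) (Fin 4) ℝ) (T : (Fin 4 → Fin 4) → ℝ) : Prop where
  antisymm_left : ∀ a b c d, T ![a, b, c, d] = -T ![b, a, c, d]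
  antisymm_right : ∀ a b c d, T ![a, b, c, d] = -T ![a, b, d, c]
  pair_symm : ∀ a b c d, T ![a, b, c, d] = T ![c, d, a, b]
  cyclic : ∀ a b c d, T ![a, b, c, d] + T ![a, c, d, b] + T ![a, d, b, c] = 0
  trace : ∀ l ν, ∑ e, ∑ f, g⁻¹ e f * T ![f, l, e, ν] = 0

/-- The symmetries of the Weyl tensor in an orthonormal frame. -/
structure IsWeylFrame (R : Fin 4 → Fin 4 → Fin 4 → Fin 4 → ℝ) : Prop where
  antisymm_left : ∀ a b c d, R a b c d = -R b a c d
  antisymm_right : ∀ a b c d, R a b c d = -R a b d c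
  pair_symm : ∀ a b c d, R a b c d = R c d a b
  cyclic : ∀ a b c d, R a b c d + R a c d b + R a d b c = 0
  trace : ∀ b d, ∑ i, sgn i * R i b i d = 0

theorem IsWeylTensor.frame {g A : Matrix (Fin 4) (Fin 4) ℝ} {T : (Fin 4 → Fin 4) → ℝ}
    (hT : IsWeylTensor g T) (h : IsFrame g A) : IsWeylFrame (frameComp A T) where
  antisymm_left _ _ _ _ := ev4_antisymm_left hT.antisymm_left _ _ _ _
  antisymm_right _ _ _ _ := ev4_antisymm_right hT.antisymm_right _ _ _ _
  pair_symm _ _ _ _ := ev4_pair_symm hT.pair_symm _ _ _ _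
  cyclic _ _ _ _ := ev4_cyclic hT.cyclic _ _ _ _
  trace _ _ := ev4_trace h.inv_eq hT.trace _ _

/-- `curvQuad` in an orthonormal frame. -/
def frameQuad (R : Fin 4 → Fin 4 → Fin 4 → Fin 4 → ℝ) (a b c d : Fin 4) : ℝ :=
  -∑ i, ∑ j, sgn i * sgn j * (R j a i c * R j b i d + R j b i c * R a j i d + R j d i c * R a b i j)

theorem IsFrame.frameComp_boxQuad {g A : Matrix (Fin 4) (Fin 4) ℝ} {T : (Fin 4 → Fin 4) → ℝ}
    (h : IsFrame g A) (a b c d : Fin 4) :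
    frameComp A (boxQuad g T) a b c d
      = frameQuad (frameComp A T) a b c d - frameQuad (frameComp A T) a b d c := by
  have e1 := fun a b c d => ev4_curvQuad (T := T) h.inv_eq (fun k => A k a) (fun k => A k b)
    (fun k => A k c) (fun k => A k d)
  have e2 : ∀ x y z w, ev4 (fun α => curvQuad g T (α 0) (α 1) (α 3) (α 2)) x y z w
      = ev4 (fun α => curvQuad g T (α 0) (α 1) (α 2) (α 3)) x y w z := by
    intro x y z w
    unfold ev4
    rw [sum4_swap34]
    refine sum4_congr fun i j k l => ?_
    change curvQuad g T i j k l * _ * _ * _ * _ = curvQuad g T i j k l * _ * _ * _ * _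
    ring
  have e3 : frameComp A (boxQuad g T) a b c d = ev4 (fun α => curvQuad g T (α 0) (α 1) (α 2) (α 3)
      - curvQuad g T (α 0) (α 1) (α 3) (α 2)) (fun k => A k a) (fun k => A k b)
        (fun k => A k c) (fun k => A k d) := rfl
  rw [e3, ev4_sub, e2, e1, e1]
  rfl

/-- Over the integers the determinants can be evaluated by `decide`. -/
theorem levi_eq_intCast (a b c d : Fin 4) : levi a b c d =
    (((Matrix.of fun i j : Fin 4 => if ![a, b, c, d] i = j then (1 : ℤ) else 0).det : ℤ) : ℝ) := by
  rw [levi, Int.cast_det]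
  congr 1
  ext i j
  simp [Matrix.map_apply]

theorem levi_one (i j : Fin 4) : levi i j 1 0
    = (if i = 2 ∧ j = 3 then -1 else if i = 3 ∧ j = 2 then 1 else 0 : ℤ) := by
  rw [levi_eq_intCast]
  congr 1
  revert i j
  decide

theorem levi_two (i j : Fin 4) : levi i j 2 0
    = (if i = 3 ∧ j = 1 then -1 else if i = 1 ∧ j = 3 then 1 else 0 : ℤ) := by
  rw [levi_eq_intCast]
  congr 1
  revert i j
  decide

theorem levi_three (i j : Fin 4) : levi i j 3 0
    = (if i = 1 ∧ j = 2 then -1 else if i = 2 ∧ j = 1 then 1 else 0 : ℤ) := by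
  rw [levi_eq_intCast]
  congr 1
  revert i j
  decide

/-- The electric part in a frame whose first vector is the normal. -/
def frameElectric (R : Fin 4 → Fin 4 → Fin 4 → Fin 4 → ℝ) : Matrix (Fin 4) (Fin 4) ℝ :=
  !![0, 0, 0, 0;
    0, R 1 0 1 0, R 1 0 2 0, R 1 0 3 0;
    0, R 2 0 1 0, R 2 0 2 0, R 2 0 3 0;
    0, R 3 0 1 0, R 3 0 2 0, R 3 0 3 0]

/-- The magnetic part in a frame whose first vector is the normal, up to orientation. -/
def frameMagnetic (R : Fin 4 → Fin 4 → Fin 4 → Fin 4 → ℝ) : Matrix (Fin 4) (Fin 4) ℝ :=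
  !![0, 0, 0, 0;
    0, R 1 0 2 3, R 1 0 3 1, R 1 0 1 2;
    0, R 2 0 2 3, R 2 0 3 1, R 2 0 1 2;
    0, R 3 0 2 3, R 3 0 3 1, R 3 0 1 2]

section

variable {g A : Matrix (Fin 4) (Fin 4) ℝ} {T : (Fin 4 → Fin 4) → ℝ} {n : Eu 4}

theorem IsFrame.electric_eq (h : IsFrame g A) (hn : ∀ i, n i = A i 0) :
    A.transpose * electric g n T * A = frameElectric (frameComp A T) := by
  ext a b
  rw [h.electric_apply hn]
  fin_cases a <;> fin_cases b <;> simp [frameElectric]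

/-- For each spatial leg, only one complementary pair of spatial legs contributes to the dual. It is
counted twice by antisymmetry in the last pair, which cancels the factor ½. The minus sign comes
from values such as `levi 2 3 1 0` = -1. -/
theorem IsFrame.magnetic_eq (h : IsFrame g A) (hn : ∀ i, n i = A i 0) (o : ℤˣ)
    (hT : ∀ a b c d, frameComp A T a b c d = -frameComp A T a b d c) :
    A.transpose * magnetic g o n T * A
      = (-frameSign g A o) • frameMagnetic (frameComp A T) := by
  have e1 : ∀ a, frameComp A (dual g o T) a 0 1 0 = -frameSign g A o * frameComp A T a 0 2 3 := by
    intro a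
    rw [h.frameComp_dual]
    simp [levi_one, Fin.sum_univ_four, sgn]
    rw [hT a 0 3 2]
    ring
  have e2 : ∀ a, frameComp A (dual g o T) a 0 2 0 = -frameSign g A o * frameComp A T a 0 3 1 := by
    intro a
    rw [h.frameComp_dual]
    simp [levi_two, Fin.sum_univ_four, sgn]
    rw [hT a 0 1 3]
    ring
  have e3 : ∀ a, frameComp A (dual g o T) a 0 3 0 = -frameSign g A o * frameComp A T a 0 1 2 := by
    intro a
    rw [h.frameComp_dual]
    simp [levi_three, Fin.sum_univ_four, sgn]
    rw [hT a 0 2 1]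
    ring
  rw [magnetic]
  ext a b
  rw [h.electric_apply hn]
  fin_cases a <;> fin_cases b <;> simp [frameMagnetic, e1, e2, e3]

end

end

/-! ### Symmetric trace-free spatial matrices and the quadratic identity for Weyl tensors. -/

section

theorem contract_diagonal (s : Fin 4 → ℝ) (X Y : Matrix (Fin 4) (Fin 4) ℝ) :
    contract (Matrix.diagonal s) X Y = ∑ i, ∑ j, s i * s j * (X i j * Y i j) := by
  unfold contract
  refine Finset.sum_congr rfl fun i _ => Finset.sum_congr rfl fun j _ => ?_
  rw [Finset.sum_eq_single i (by intro k _ hk; simp [Matrix.diagonal_apply_ne' _ hk]) (by simp),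
    Finset.sum_eq_single j (by intro k _ hk; simp [Matrix.diagonal_apply_ne' _ hk]) (by simp)]
  simp
  ring

theorem mul_diagonal_mul (s : Fin 4 → ℝ) (X Y : Matrix (Fin 4) (Fin 4) ℝ) (a b : Fin 4) :
    (X * Matrix.diagonal s * Y) a b = ∑ i, s i * (X a i * Y i b) := by
  rw [Matrix.mul_apply]
  exact Finset.sum_congr rfl fun i _ => by rw [Matrix.mul_diagonal]; ring

/-- A symmetric trace-free spatial matrix. -/
def stf (a b c d e : ℝ) : Matrix (Fin 4) (Fin 4) ℝ :=
  !![0, 0, 0, 0; 0, a, b, c; 0, b, d, e; 0, c, e, -a - d]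

theorem contract_stf (a b c d e a' b' c' d' e' : ℝ) :
    contract (Matrix.diagonal sgn) (stf a b c d e) (stf a' b' c' d' e')
      = a * a' + d * d' + (a + d) * (a' + d') + 2 * (b * b' + c * c' + e * e') := by
  rw [contract_diagonal]
  simp [Fin.sum_univ_four, stf, sgn]
  ring

theorem stf_mul_stf (a b c d e a' b' c' d' e' : ℝ) :
    stf a b c d e * Matrix.diagonal sgn * stf a' b' c' d' e' = !![0, 0, 0, 0;
      0, a * a' + b * b' + c * c', a * b' + b * d' + c * e', a * c' + b * e' - c * (a' + d');
      0, b * a' + d * b' + e * c', b * b' + d * d' + e * e', b * c' + d * e' - e * (a' + d');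
      0, c * a' + e * b' - (a + d) * c', c * b' + e * d' - (a + d) * e',
        c * c' + e * e' + (a + d) * (a' + d')] := by
  ext i j
  rw [mul_diagonal_mul]
  fin_cases i <;> fin_cases j <;> simp [Fin.sum_univ_four, stf, sgn] <;> ring

/-- Subtracting a third of the trace times the spatial metric leaves a symmetric trace-free matrix,
so the result is again described by five numbers. -/
theorem quadElectric_stf (a b c d e a' b' c' d' e' : ℝ) :
    quadElectric (Matrix.diagonal sgn) (Matrix.diagonal ![0, 1, 1, 1]) (stf a b c d e)
      (stf a' b' c' d' e') = stf
      (2 * (a * a + b * b + c * c - 2 * (d * d + a * d + e * e))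
        - 2 * (a' * a' + b' * b' + c' * c' - 2 * (d' * d' + a' * d' + e' * e')))
      (6 * (a * b + b * d + c * e) - 6 * (a' * b' + b' * d' + c' * e'))
      (6 * (b * e - c * d) - 6 * (b' * e' - c' * d'))
      (2 * (d * d + b * b + e * e - 2 * (a * a + a * d + c * c))
        - 2 * (d' * d' + b' * b' + e' * e' - 2 * (a' * a' + a' * d' + c' * c')))
      (6 * (b * c - a * e) - 6 * (b' * c' - a' * e')) := by
  rw [quadElectric, contract_stf, contract_stf, stf_mul_stf, stf_mul_stf]
  ext i j
  fin_cases i <;> fin_cases j <;> simp [stf] <;> ring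

theorem quadMagnetic_stf (a b c d e a' b' c' d' e' : ℝ) :
    quadMagnetic (Matrix.diagonal sgn) (Matrix.diagonal ![0, 1, 1, 1]) (stf a b c d e)
      (stf a' b' c' d' e') = stf
      (4 * (a * a' + b * b' + c * c' - 2 * d * d' - a * d' - d * a' - 2 * e * e'))
      (6 * (a * b' + b * d' + c * e' + a' * b + b' * d + c' * e))
      (6 * (b * e' - c * d' + b' * e - c' * d))
      (4 * (d * d' + b * b' + e * e' - 2 * a * a' - a * d' - d * a' - 2 * c * c'))
      (6 * (b * c' - a * e' + b' * c - a' * e)) := by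
  rw [quadMagnetic, contract_stf, stf_mul_stf]
  ext i j
  fin_cases i <;> fin_cases j <;> simp [stf] <;> ring

theorem frameElectric_eq_stf {R : Fin 4 → Fin 4 → Fin 4 → Fin 4 → ℝ} {a b c d e : ℝ}
    (h11 : R 1 0 1 0 = a) (h12 : R 1 0 2 0 = b) (h13 : R 1 0 3 0 = c) (h21 : R 2 0 1 0 = b)
    (h22 : R 2 0 2 0 = d) (h23 : R 2 0 3 0 = e) (h31 : R 3 0 1 0 = c) (h32 : R 3 0 2 0 = e)
    (h33 : R 3 0 3 0 = -a - d) : frameElectric R = stf a b c d e := by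
  rw [frameElectric, stf, h11, h12, h13, h21, h22, h23, h31, h32, h33]

theorem frameMagnetic_eq_stf {R : Fin 4 → Fin 4 → Fin 4 → Fin 4 → ℝ} {a b c d e : ℝ}
    (h11 : R 1 0 2 3 = a) (h12 : R 1 0 3 1 = b) (h13 : R 1 0 1 2 = c) (h21 : R 2 0 2 3 = b)
    (h22 : R 2 0 3 1 = d) (h23 : R 2 0 1 2 = e) (h31 : R 3 0 2 3 = c) (h32 : R 3 0 3 1 = e)
    (h33 : R 3 0 1 2 = -a - d) : frameMagnetic R = stf a b c d e := by
  rw [frameMagnetic, stf, h11, h12, h13, h21, h22, h23, h31, h32, h33]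

set_option linter.unusedSimpArgs false in
set_option maxHeartbeats 1000000 in
/-- The electric and magnetic parts of the quadratic expression, in a frame. -/
theorem IsWeylFrame.quad {R : Fin 4 → Fin 4 → Fin 4 → Fin 4 → ℝ} (hR : IsWeylFrame R) :
    frameElectric (fun a b c d => frameQuad R a b c d - frameQuad R a b d c)
      = quadElectric (Matrix.diagonal sgn) (Matrix.diagonal ![0, 1, 1, 1])
          (frameElectric R) (frameMagnetic R) ∧
    frameMagnetic (fun a b c d => frameQuad R a b c d - frameQuad R a b d c)
      = quadMagnetic (Matrix.diagonal sgn) (Matrix.diagonal ![0, 1, 1, 1])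
          (frameElectric R) (frameMagnetic R) := by
  have L := hR.antisymm_left
  have Rt := hR.antisymm_right
  have S := hR.pair_symm
  have z : ∀ a c d, R a a c d = 0 := fun a c d => by linarith [L a a c d]
  have z' : ∀ a b c, R a b c c = 0 := fun a b c => by linarith [Rt a b c c]
  -- Used as rewrite rules, these antisymmetries put both index pairs in increasing order; the pair
  -- symmetries below then fix the order of the two pairs.
  have l10 := L 1 0
  have l20 := L 2 0
  have l30 := L 3 0
  have l21 := L 2 1
  have l31 := L 3 1
  have l32 := L 3 2
  have r10 := fun a b => Rt a b 1 0
  have r20 := fun a b => Rt a b 2 0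
  have r30 := fun a b => Rt a b 3 0
  have r21 := fun a b => Rt a b 2 1
  have r31 := fun a b => Rt a b 3 1
  have r32 := fun a b => Rt a b 3 2
  have t00 := hR.trace 0 0
  have t01 := hR.trace 0 1
  have t02 := hR.trace 0 2
  have t03 := hR.trace 0 3
  have t11 := hR.trace 1 1
  have t12 := hR.trace 1 2
  have t13 := hR.trace 1 3
  have t22 := hR.trace 2 2
  have t23 := hR.trace 2 3
  have t33 := hR.trace 3 3
  have c := hR.cyclic 0 1 2 3
  simp only [Fin.sum_univ_four, sgn, Matrix.cons_val, z, z', l10, l20, l30, l21, l31, l32, r10,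
    r20, r30, r21, r31, r32] at t00 t01 t02 t03 t11 t12 t13 t22 t23 t33 c
  have p1 := S 0 2 0 1
  have p2 := S 0 3 0 1
  have p3 := S 0 3 0 2
  -- The trace and cyclic identities leave ten independent components: 0101, 0102, 0103, 0202, 0203
  -- of electric type and 0112, 0113, 0123, 0212, 0213 of magnetic type. The equations `q1` to `q11`
  -- express all the others through these.
  have q1 : R 0 3 0 3 = -R 0 1 0 1 - R 0 2 0 2 := by linarith
  have q2 : R 0 3 1 2 = R 0 2 1 3 - R 0 1 2 3 := by linarith
  have q3 : R 0 3 1 3 = -R 0 2 1 2 := by linarith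
  have q4 : R 0 3 2 3 = R 0 1 1 2 := by linarith
  have q5 : R 0 2 2 3 = -R 0 1 1 3 := by linarith
  have q6 : R 1 2 1 2 = R 0 1 0 1 + R 0 2 0 2 := by linarith
  have q7 : R 1 3 1 3 = -R 0 2 0 2 := by linarith
  have q8 : R 2 3 2 3 = -R 0 1 0 1 := by linarith
  have q9 : R 1 3 2 3 = R 0 1 0 2 := by linarith
  have q10 : R 1 2 2 3 = -R 0 1 0 3 := by linarith
  have q11 : R 1 2 1 3 = R 0 2 0 3 := by linarith
  have p4 := S 1 2 0 1
  have p5 := S 1 2 0 2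
  have p6 := (S 1 2 0 3).trans q2
  have p7 := S 1 3 0 1
  have p8 := S 1 3 0 2
  have p9 := (S 1 3 0 3).trans q3
  have p10 := (S 1 3 1 2).trans q11
  have p11 := S 2 3 0 1
  have p12 := (S 2 3 0 2).trans q5
  have p13 := (S 2 3 0 3).trans q4
  have p14 := (S 2 3 1 2).trans q10
  have p15 := (S 2 3 1 3).trans q9
  have hE : frameElectric R = stf (R 0 1 0 1) (R 0 1 0 2) (R 0 1 0 3) (R 0 2 0 2) (R 0 2 0 3) := by
    simp only [frameElectric, stf, l10, l20, l30, r10, r20, r30, p1, p2, p3, q1, neg_neg]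
  have hB : frameMagnetic R
      = stf (-R 0 1 2 3) (R 0 1 1 3) (-R 0 1 1 2) (R 0 2 1 3) (-R 0 2 1 2) := by
    simp only [frameMagnetic, stf, l10, l20, l30, r31, q2, q3, q4, q5, neg_neg, neg_sub]
  rw [hE, hB, quadElectric_stf, quadMagnetic_stf]
  constructor
  -- After the reduction each entry is a polynomial identity of degree two in the ten components.
  · apply frameElectric_eq_stf <;>
    · simp only [frameQuad, Fin.sum_univ_four, sgn, Matrix.cons_val, z, z', l10, l20, l30, l21, l31,
        l32, r10, r20, r30, r21, r31, r32, p1, p2, p3, p4, p5, p6, p7, p8, p9, p10, p11, p12, p13,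
        p14, p15, q1, q2, q3, q4, q5, q6, q7, q8, q9, q10, q11]
      ring
  · apply frameMagnetic_eq_stf <;>
    · simp only [frameQuad, Fin.sum_univ_four, sgn, Matrix.cons_val, z, z', l10, l20, l30, l21, l31,
        l32, r10, r20, r30, r21, r31, r32, p1, p2, p3, p4, p5, p6, p7, p8, p9, p10, p11, p12, p13,
        p14, p15, q1, q2, q3, q4, q5, q6, q7, q8, q9, q10, q11]
      ring

end

section

/-! ### Electric and magnetic parts of the quadratic expression -/

section

variable {ι : Type} [Fintype ι] (q h E B : Matrix ι ι ℝ) (c : ℝ)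

theorem contract_smul_right (X Y : Matrix ι ι ℝ) :
    contract q X (c • Y) = c * contract q X Y := by
  simp_rw [contract, Finset.mul_sum, Matrix.smul_apply, smul_eq_mul]
  refine Finset.sum_congr rfl fun _ _ => Finset.sum_congr rfl fun _ _ =>
    Finset.sum_congr rfl fun _ _ => Finset.sum_congr rfl fun _ _ => by ring

theorem contract_smul_left (X Y : Matrix ι ι ℝ) :
    contract q (c • X) Y = c * contract q X Y := by
  simp_rw [contract, Finset.mul_sum, Matrix.smul_apply, smul_eq_mul]
  refine Finset.sum_congr rfl fun _ _ => Finset.sum_congr rfl fun _ _ =>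
    Finset.sum_congr rfl fun _ _ => Finset.sum_congr rfl fun _ _ => by ring

/-- The magnetic part enters quadratically here, so the orientation sign of a frame drops out. In
`quadMagnetic` it enters linearly, and the sign factors out to match that of the left side. -/
theorem quadElectric_smul (hc : c ^ 2 = 1) : quadElectric q h E (c • B) = quadElectric q h E B := by
  unfold quadElectric
  rw [contract_smul_left, contract_smul_right]
  simp only [Matrix.smul_mul, Matrix.mul_smul, smul_smul]
  rw [← mul_assoc c c, show c * c = 1 by rw [← hc]; ring, one_smul, one_mul]

theorem quadMagnetic_smul : quadMagnetic q h E (c • B) = c • quadMagnetic q h E B := by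
  unfold quadMagnetic
  rw [contract_smul_right]
  ext i j
  simp only [Matrix.smul_mul, Matrix.transpose_smul, Matrix.smul_apply, Matrix.sub_apply,
    Matrix.add_apply, smul_eq_mul]
  ring

end

variable {g A : Matrix (Fin 4) (Fin 4) ℝ} {T : (Fin 4 → Fin 4) → ℝ} {n : Eu 4}

/-- Both sides are compared after congruence by a frame whose first leg is the normal, where the
claim becomes `IsWeylFrame.quad`. -/
theorem IsWeylTensor.electric_magnetic_boxQuad (hT : IsWeylTensor g T) (h : IsFrame g A)
    (hn : ∀ i, n i = A i 0) (o : ℤˣ) :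
    electric g n (boxQuad g T)
      = quadElectric g⁻¹ (spatialMetric g n) (electric g n T) (magnetic g o n T) ∧
    magnetic g o n (boxQuad g T)
      = quadMagnetic g⁻¹ (spatialMetric g n) (electric g n T) (magnetic g o n T) := by
  have hF := hT.frame h
  have hZ : frameComp A (boxQuad g T) = fun a b c d =>
      frameQuad (frameComp A T) a b c d - frameQuad (frameComp A T) a b d c := by
    ext a b c d
    exact h.frameComp_boxQuad a b c d
  have hc : (-frameSign g A o) ^ 2 = 1 := by rw [neg_sq, h.frameSign_sq]
  constructor
  · refine h.cancel ?_
    rw [h.electric_eq hn, h.inv_eq, quadElectric_congr, h.spatialMetric_apply hn, h.electric_eq hn,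
      h.magnetic_eq hn o hF.antisymm_right, quadElectric_smul _ _ _ _ _ hc, hZ, hF.quad.1]
  · refine h.cancel ?_
    rw [h.magnetic_eq hn o (by intro a b c d; rw [hZ]; ring), h.inv_eq, quadMagnetic_congr,
      h.spatialMetric_apply hn, h.electric_eq hn,
      h.magnetic_eq hn o hF.antisymm_right, quadMagnetic_smul, hZ, hF.quad.2]

/-! ### Existence of frames -/

/-- The bilinear form with matrix `g`. -/
def bil (g : Matrix (Fin 4) (Fin 4) ℝ) (x y : Fin 4 → ℝ) : ℝ := dotProduct x (g.mulVec y)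

/-- Symmetric matrices of signature `(-,+,+,+)`. -/
structure IsLorentzMatrix (g : Matrix (Fin 4) (Fin 4) ℝ) : Prop where
  symm : ∀ i j, g i j = g j i
  signature : ∃ t, bil g t t < 0 ∧ ∀ v, bil g t v = 0 → v ≠ 0 → 0 < bil g v v

theorem bil_add_right (x y z : Fin 4 → ℝ) : bil g x (y + z) = bil g x y + bil g x z := by
  simp [bil, Matrix.mulVec_add, dotProduct_add]

theorem bil_smul_right (c : ℝ) (x y : Fin 4 → ℝ) : bil g x (c • y) = c * bil g x y := by
  simp [bil, Matrix.mulVec_smul, dotProduct_smul]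

namespace IsLorentzMatrix

theorem bil_comm (hg : IsLorentzMatrix g) (x y : Fin 4 → ℝ) : bil g x y = bil g y x := by
  have : g.transpose = g := by ext i j; exact hg.symm j i
  unfold bil
  rw [Matrix.dotProduct_mulVec, ← Matrix.mulVec_transpose, this, dotProduct_comm]

theorem bil_add_left (hg : IsLorentzMatrix g) (x y z : Fin 4 → ℝ) :
    bil g (x + y) z = bil g x z + bil g y z := by
  rw [hg.bil_comm, bil_add_right, hg.bil_comm z, hg.bil_comm z]

theorem bil_smul_left (hg : IsLorentzMatrix g) (c : ℝ) (x y : Fin 4 → ℝ) :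
    bil g (c • x) y = c * bil g x y := by
  rw [hg.bil_comm, bil_smul_right, hg.bil_comm y]

/-- The signature condition supplies one timelike t with positive complement; this extends it to
every timelike unit n. The vector p = g(t,w) n - g(t,n) w is orthogonal to t, and g(p,p) = -g(t,w)²
+ g(t,n)² g(w,w). If g(w,w) ≤ 0 then p = 0, which forces w = 0 because g(t,n) ≠ 0. -/
theorem pos_of_orthogonal (hg : IsLorentzMatrix g) {n w : Fin 4 → ℝ} (hn : bil g n n = -1)
    (hnw : bil g n w = 0) (hw : w ≠ 0) : 0 < bil g w w := by
  obtain ⟨t, -, ht⟩ := hg.signature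
  have hα : bil g t n ≠ 0 := by
    intro h0
    have hn0 : n ≠ 0 := by
      rintro rfl
      simp [bil] at hn
    have := ht n h0 hn0
    linarith
  by_contra hneg
  push Not at hneg
  set p : Fin 4 → ℝ := bil g t w • n + (-bil g t n) • w with hp
  have htp : bil g t p = 0 := by
    rw [hp, bil_add_right, bil_smul_right, bil_smul_right]; ring
  have hpp : bil g p p = -(bil g t w) ^ 2 + bil g t n ^ 2 * bil g w w := by
    rw [hp, bil_add_right, hg.bil_add_left, hg.bil_add_left]
    simp only [bil_smul_right, hg.bil_smul_left, hg.bil_comm w n, hnw, hn]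
    ring
  have hle : bil g p p ≤ 0 := by
    rw [hpp]
    nlinarith [sq_nonneg (bil g t w), mul_nonneg (sq_nonneg (bil g t n)) (neg_nonneg.2 hneg)]
  have hp0 : p = 0 := by
    by_contra h
    exact absurd (ht p htp h) (not_lt.2 hle)
  have hβ : bil g t w = 0 := by
    have : bil g p p = 0 := by rw [hp0]; simp [bil]
    rw [hpp] at this
    have h2 := mul_nonneg (sq_nonneg (bil g t n)) (neg_nonneg.2 hneg)
    have : bil g t w ^ 2 = 0 := le_antisymm (by nlinarith) (sq_nonneg _)
    exact pow_eq_zero_iff (two_ne_zero) |>.1 this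
  rw [hp, hβ, zero_smul, zero_add] at hp0
  exact hw ((smul_eq_zero.1 hp0).resolve_left (neg_ne_zero.2 hα))

/-- The inner product is passed as data, so the norm it induces stays inside the proof and does not
compete with the standard norm on the space of coordinates. -/
theorem _root_.GR.exists_orthonormal_extension {V : Type*} [AddCommGroup V] [Module ℝ V]
    (core : InnerProductSpace.Core ℝ V) (hV : Module.finrank ℝ V = 4) (v : Fin 4 → V)
    (s : Set (Fin 4)) (hv : ∀ i ∈ s, ∀ j ∈ s, core.inner (v i) (v j) = if i = j then 1 else 0) :
    ∃ b : Fin 4 → V, (∀ i j, core.inner (b i) (b j) = if i = j then 1 else 0) ∧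
      ∀ i ∈ s, b i = v i := by
  let : NormedAddCommGroup V := core.toNormedAddCommGroup
  let : InnerProductSpace ℝ V := InnerProductSpace.ofCore core.toCore
  have : FiniteDimensional ℝ V := Module.finite_of_finrank_pos (by rw [hV]; norm_num)
  have hon : Orthonormal ℝ (s.domRestrict v) := by
    rw [orthonormal_iff_ite]
    rintro ⟨i, hi⟩ ⟨j, hj⟩
    simp only [Subtype.mk.injEq]
    exact hv i hi j hj
  obtain ⟨b, hb⟩ := hon.exists_orthonormalBasis_extension_of_card_eq (by simp [hV])
  exact ⟨b, fun i j => orthonormal_iff_ite.1 b.orthonormal i j, hb⟩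

/-- Orthonormal vectors, the first of which is timelike, are part of an orthonormal frame. -/
theorem exists_frame (hg : IsLorentzMatrix g) (v : Fin 4 → Fin 4 → ℝ) (s : Set (Fin 4))
    (h0 : 0 ∈ s) (hv : ∀ i ∈ s, ∀ j ∈ s, bil g (v i) (v j) = Matrix.diagonal sgn i j) :
    ∃ A, IsFrame g A ∧ ∀ i ∈ s, ∀ k, A k i = v i k := by
  set n := v 0 with hn
  have hnn : bil g n n = -1 := by rw [hn, hv 0 h0 0 h0]; simp [sgn]
  set l : Fin 4 → ℝ := g.mulVec n with hl
  -- Adding twice the square of the covector of n reverses the sign of g along n and makes the form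
  -- Euclidean, so that ordinary orthonormal extension applies.
  set e : Matrix (Fin 4) (Fin 4) ℝ := g + (2 : ℝ) • Matrix.vecMulVec l l with he
  have hln : ∀ x, dotProduct l x = bil g n x := by
    intro x
    rw [hg.bil_comm, bil, dotProduct_comm]
  have hbil : ∀ x y, dotProduct x (e.mulVec y) = bil g x y + 2 * (bil g n x * bil g n y) := by
    intro x y
    rw [he, Matrix.add_mulVec, dotProduct_add, Matrix.smul_mulVec, Matrix.vecMulVec_mulVec,
      dotProduct_smul, hln, ← hln x]
    simp only [MulOpposite.smul_eq_mul_unop, dotProduct_smul, MulOpposite.unop_op, dotProduct_comm x l,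
      smul_eq_mul]
    rfl
  have hpos : e.PosDef := by
    refine Matrix.PosDef.of_dotProduct_mulVec_pos ?_ ?_
    · ext i j
      simp [he, Matrix.vecMulVec_apply, hg.symm j i, mul_comm (l j)]
    · intro x hx
      rw [star_trivial, hbil]
      -- `w` is the part of x orthogonal to n, and e(x,x) = g(w,w) + g(n,x)².
      set w : Fin 4 → ℝ := x + bil g n x • n with hw
      have hnw : bil g n w = 0 := by
        rw [hw, bil_add_right, bil_smul_right, hnn]; ring
      have hww : bil g w w = bil g x x + bil g n x ^ 2 := by
        rw [hw, bil_add_right, hg.bil_add_left, hg.bil_add_left]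
        simp only [bil_smul_right, hg.bil_smul_left, hg.bil_comm x n, hnn]
        ring
      by_cases hw0 : w = 0
      · have h1 : bil g w w = 0 := by rw [hw0]; simp [bil]
        have h2 : bil g n x ≠ 0 := by
          intro h
          rw [hw, h, zero_smul, add_zero] at hw0
          exact hx hw0
        have := sq_pos_of_ne_zero h2
        nlinarith
      · have := hg.pos_of_orthogonal hnn hnw hw0
        nlinarith [sq_nonneg (bil g n x)]
  let core : InnerProductSpace.Core ℝ (Fin 4 → ℝ) :=
    { inner := fun x y => bil g x y + 2 * (bil g n x * bil g n y)
      conj_inner_symm := fun x y => by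
        simp only [conj_trivial]
        rw [hg.bil_comm]
        ring
      re_inner_nonneg := fun x => by
        by_cases hx : x = 0
        · simp [hx, bil]
        · have := (hpos.dotProduct_mulVec_pos hx).le
          rw [star_trivial, hbil] at this
          simpa using this
      add_left := fun x y z => by
        rw [hg.bil_add_left, bil_add_right]
        ring
      smul_left := fun x y r => by
        rw [hg.bil_smul_left, bil_smul_right, conj_trivial]
        ring
      definite := fun x hx => by
        by_contra h
        have := hpos.dotProduct_mulVec_pos h
        rw [star_trivial, hbil] at this
        exact this.ne' hx }
  -- The same rank-one change takes diag(-1,1,1,1) to the identity, so g-orthonormality of the given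
  -- vectors is e-orthonormality.
  have hdiag : ∀ i j : Fin 4, Matrix.diagonal sgn i j
      = (if i = j then 1 else 0) - 2 * ((if i = 0 then 1 else 0) * if j = 0 then 1 else 0) := by
    intro i j
    fin_cases i <;> fin_cases j <;> simp [sgn] <;> norm_num
  obtain ⟨b, hbb, hb⟩ := exists_orthonormal_extension core (by simp) v s (by
    intro i hi j hj
    have h1 : ∀ k ∈ s, bil g n (v k) = -(if k = 0 then 1 else 0) := by
      intro k hk
      rw [hn, hv 0 h0 k hk, hdiag]
      simp only [eq_comm (a := (0 : Fin 4))]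
      split_ifs <;> norm_num
    change bil g (v i) (v j) + 2 * (bil g n (v i) * bil g n (v j)) = _
    rw [hv i hi j hj, hdiag, h1 i hi, h1 j hj]
    ring)
  have hinner : ∀ i j, bil g (b i) (b j) + 2 * (bil g n (b i) * bil g n (b j))
      = if i = j then 1 else 0 := hbb
  refine ⟨Matrix.of fun k i => b i k, ?_, fun i hi k => by rw [Matrix.of_apply, hb i hi]⟩
  -- Since g(n,n) = -1, the Euclidean product with n is -g(n, ·). This recovers g(n, b i), and hence
  -- g from e on the basis.
  have hbn : ∀ i, bil g n (b i) = -(if i = 0 then 1 else 0) := by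
    intro i
    have h1 := hinner 0 i
    rw [hb 0 h0, ← hn, hnn] at h1
    simp only [eq_comm (a := (0 : Fin 4))] at h1
    linarith
  ext i j
  have h1 := hinner i j
  rw [hbn, hbn] at h1
  have h2 : ((Matrix.of fun k i => b i k).transpose * g * (Matrix.of fun k i => b i k)) i j
      = bil g (b i) (b j) := by
    rw [Matrix.mul_assoc, Matrix.mul_apply]
    rfl
  rw [h2, hdiag]
  linarith

end IsLorentzMatrix

end

section

/-! ### Restriction of the quadratic expressions to a hyperplane -/

section restriction

variable {g : Matrix (Fin 4) (Fin 4) ℝ} {n : Eu 4}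

theorem IsLorentzMatrix.det_ne (hg : IsLorentzMatrix g) : g.det ≠ 0 := by
  intro h0
  obtain ⟨v, hv, hgv⟩ := Matrix.exists_mulVec_eq_zero_iff.2 h0
  obtain ⟨t, -, ht⟩ := hg.signature
  have := ht v (by simp [bil, hgv]) hv
  simp [bil, hgv] at this

/-- The square of the unit normal. -/
def normalSq (n : Eu 4) : Matrix (Fin 4) (Fin 4) ℝ := Matrix.vecMulVec (fun i => n i) (fun i => n i)

theorem normalSq_transpose : (normalSq n).transpose = normalSq n := by
  simp [normalSq, Matrix.transpose_vecMulVec]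

theorem sum_proj_normal (hn : bil g (fun i => n i) (fun i => n i) = -1) (l : Fin 4) :
    ∑ σ, proj g n l σ * n σ = 0 := by
  have h1 : ∑ σ, lower g n σ * n σ = -1 := by
    rw [← hn]
    exact Finset.sum_congr rfl fun σ _ => mul_comm (lower g n σ) (n σ)
  have h2 : ∑ σ, proj g n l σ * n σ = n l + n l * ∑ σ, lower g n σ * n σ := by
    simp_rw [proj, add_mul, Finset.sum_add_distrib, Finset.mul_sum]
    congr 1
    · simp
    · exact Finset.sum_congr rfl fun σ _ => by ring
  rw [h2, h1]
  ring

/-- The projector annihilates n, hence so does an electric part in its second slot; the transposed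
version covers the first. Consequently n⊗n can be added to the inverse metric without changing any
contraction of E and B. -/
theorem electric_mul_normalSq (hn : bil g (fun i => n i) (fun i => n i) = -1)
    (T : (Fin 4 → Fin 4) → ℝ) : electric g n T * normalSq n = 0 := by
  have h : (electric g n T).mulVec (fun i => n i) = 0 := by
    ext τ
    have h1 : (electric g n T).mulVec (fun i => n i) τ = ev4 T (fun μ => proj g n μ τ) (fun i => n i)
        (fun l => ∑ σ, n σ * proj g n l σ) (fun i => n i) := by
      rw [ev4_sum_third]
      change ∑ σ, electric g n T τ σ * n σ = ∑ σ, n σ * electric g n T τ σ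
      exact Finset.sum_congr rfl fun σ _ => mul_comm (electric g n T τ σ) (n σ)
    rw [h1]
    simp_rw [mul_comm (n _), sum_proj_normal hn]
    exact ev4_zero_third _ _ _
  rw [normalSq, Matrix.mul_vecMulVec, h, Matrix.zero_vecMulVec]

theorem electric_transpose_mul_normalSq (hn : bil g (fun i => n i) (fun i => n i) = -1)
    (T : (Fin 4 → Fin 4) → ℝ) : (electric g n T).transpose * normalSq n = 0 := by
  have h : (electric g n T).transpose.mulVec (fun i => n i) = 0 := by
    ext τ
    have h1 : (electric g n T).transpose.mulVec (fun i => n i) τ =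
        ev4 T (fun l => ∑ σ, n σ * proj g n l σ) (fun i => n i)
          (fun μ => proj g n μ τ) (fun i => n i) := by
      rw [ev4_sum_first]
      change ∑ σ, electric g n T σ τ * n σ = ∑ σ, n σ * electric g n T σ τ
      exact Finset.sum_congr rfl fun σ _ => mul_comm (electric g n T σ τ) (n σ)
    rw [h1]
    simp_rw [mul_comm (n _), sum_proj_normal hn]
    exact ev4_zero_first _ _ _
  rw [normalSq, Matrix.mul_vecMulVec, h, Matrix.zero_vecMulVec]

theorem contract_add_normalSq {q X Y : Matrix (Fin 4) (Fin 4) ℝ}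
    (hX : X.transpose * normalSq n = 0) (hY : Y * normalSq n = 0) :
    contract (q + normalSq n) X Y = contract q X Y := by
  rw [contract_eq_trace, contract_eq_trace, Matrix.mul_add, hX, add_zero, Matrix.transpose_add,
    Matrix.mul_add, normalSq_transpose, Matrix.mul_assoc _ Y (normalSq n), hY, Matrix.mul_zero,
    add_zero]

theorem quadElectric_add_normalSq {q h E B : Matrix (Fin 4) (Fin 4) ℝ}
    (hE : E * normalSq n = 0) (hE' : E.transpose * normalSq n = 0)
    (hB : B * normalSq n = 0) (hB' : B.transpose * normalSq n = 0) :
    quadElectric (q + normalSq n) h E B = quadElectric q h E B := by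
  unfold quadElectric
  rw [contract_add_normalSq hE' hE, contract_add_normalSq hB' hB, Matrix.mul_add, hE,
    Matrix.mul_add, hB, add_zero, add_zero]

theorem quadMagnetic_add_normalSq {q h E B : Matrix (Fin 4) (Fin 4) ℝ}
    (hE' : E.transpose * normalSq n = 0) (hB : B * normalSq n = 0) :
    quadMagnetic (q + normalSq n) h E B = quadMagnetic q h E B := by
  unfold quadMagnetic
  rw [contract_add_normalSq hE' hB, Matrix.mul_add, hB, add_zero]

variable {J : Matrix (Fin 4) (Fin 3) ℝ}

/-- J k⁻¹ Jᵀ - n⊗n is a left inverse of g: applied after g, it fixes both the image of J and n,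
which together span. The induced metric k is invertible because g is positive on the complement of
n. -/
theorem IsLorentzMatrix.restrict_inv (hg : IsLorentzMatrix g)
    (hn : bil g (fun i => n i) (fun i => n i) = -1)
    (hJn : ∀ v, bil g (fun i => n i) (J.mulVec v) = 0) (hJ : ∀ v, J.mulVec v = 0 → v = 0) :
    J * (J.transpose * g * J)⁻¹ * J.transpose = g⁻¹ + normalSq n := by
  set k := J.transpose * g * J with hk
  have hkv : ∀ v w : Fin 3 → ℝ, dotProduct v (k.mulVec w) = bil g (J.mulVec v) (J.mulVec w) := by
    intro v w
    rw [hk, ← Matrix.mulVec_mulVec, ← Matrix.mulVec_mulVec, Matrix.dotProduct_mulVec,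
      Matrix.vecMul_transpose, bil]
  have hkdet : IsUnit k.det := by
    rw [isUnit_iff_ne_zero]
    intro h0
    obtain ⟨v, hv, hkv0⟩ := Matrix.exists_mulVec_eq_zero_iff.2 h0
    have h1 := hkv v v
    rw [hkv0, dotProduct_zero] at h1
    have h2 := hg.pos_of_orthogonal hn (hJn v) fun h => hv (hJ v h)
    linarith
  -- The map (v, a) ↦ J v + a n is injective by pairing with n, hence surjective since 3 + 1 = 4.
  have hsurj : ∀ x : Fin 4 → ℝ, ∃ (v : Fin 3 → ℝ) (a : ℝ), J.mulVec v + a • (fun i => n i) = x := by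
    let f : (Fin 3 → ℝ) × ℝ →ₗ[ℝ] (Fin 4 → ℝ) :=
      LinearMap.coprod J.mulVecLin (LinearMap.toSpanSingleton ℝ _ (fun i => n i))
    have hf : Function.Injective f := by
      rw [← LinearMap.ker_eq_bot, LinearMap.ker_eq_bot']
      rintro ⟨v, a⟩ h
      have h' : J.mulVec v + a • (fun i => n i) = 0 := h
      have h1 : bil g (fun i => n i) (J.mulVec v + a • (fun i => n i)) = 0 := by
        rw [h']; simp [bil]
      rw [bil_add_right, bil_smul_right, hJn, hn] at h1
      have ha : a = 0 := by linarith
      rw [ha, zero_smul, add_zero] at h'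
      rw [hJ v h', ha]
      rfl
    have hs := (LinearMap.injective_iff_surjective_of_finrank_eq_finrank (f := f)
      (by simp)).1 hf
    intro x
    obtain ⟨⟨v, a⟩, h⟩ := hs x
    exact ⟨v, a, h⟩
  have hPg : (J * k⁻¹ * J.transpose - normalSq n) * g = 1 := by
    refine Matrix.toLin'.injective (LinearMap.ext fun x => ?_)
    rw [Matrix.toLin'_apply, Matrix.toLin'_apply, Matrix.one_mulVec]
    have hN : ∀ y, (normalSq n * g).mulVec y = bil g (fun i => n i) y • (fun i => n i) := by
      intro y
      rw [normalSq, Matrix.vecMulVec_mul, Matrix.vecMulVec_mulVec, bil, Matrix.dotProduct_mulVec]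
      ext i
      simp [mul_comm]
    have hP1 : ∀ v, (J * k⁻¹ * J.transpose * g).mulVec (J.mulVec v) = J.mulVec v := by
      intro v
      rw [Matrix.mulVec_mulVec, show J * k⁻¹ * J.transpose * g * J = J * (k⁻¹ * k) by
        rw [hk]; simp only [Matrix.mul_assoc], Matrix.nonsing_inv_mul _ hkdet, Matrix.mul_one]
    have hP2 : (J * k⁻¹ * J.transpose * g).mulVec (fun i => n i) = 0 := by
      have : (J.transpose * g).mulVec (fun i => n i) = 0 := by
        ext j
        have h1 := hJn (Pi.single j 1)
        rw [hg.bil_comm, bil, Matrix.mulVec_single_one] at h1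
        rw [← Matrix.mulVec_mulVec]
        exact h1
      rw [Matrix.mul_assoc (J * k⁻¹), ← Matrix.mulVec_mulVec, this, Matrix.mulVec_zero]
    obtain ⟨v, a, rfl⟩ := hsurj x
    rw [Matrix.sub_mul, Matrix.sub_mulVec, hN, Matrix.mulVec_add, hP1, Matrix.mulVec_smul, hP2,
      bil_add_right, bil_smul_right, hJn, hn]
    simp
  rw [Matrix.inv_eq_left_inv hPg]
  abel

theorem restrict_spatialMetric (hJn : ∀ v, bil g (fun i => n i) (J.mulVec v) = 0)
    (hg : IsLorentzMatrix g) :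
    J.transpose * spatialMetric g n * J = J.transpose * g * J := by
  have h1 : spatialMetric g n = g + Matrix.vecMulVec (lower g n) (lower g n) := by
    ext i j; rfl
  have h2 : Matrix.vecMul (lower g n) J = 0 := by
    ext j
    have h3 := hJn (Pi.single j 1)
    rw [hg.bil_comm, bil, Matrix.mulVec_single_one, dotProduct_comm] at h3
    exact h3
  rw [h1, Matrix.mul_add, Matrix.add_mul, Matrix.mul_assoc _ (Matrix.vecMulVec _ _),
    Matrix.vecMulVec_mul, h2, show Matrix.vecMulVec (lower g n) (0 : Fin 3 → ℝ) = 0 by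
      ext i j; simp [Matrix.vecMulVec_apply], Matrix.mul_zero, add_zero]

/-- The formulas for the electric and magnetic parts restrict to a spacelike hyperplane. -/
theorem IsLorentzMatrix.restrict_quad (hg : IsLorentzMatrix g)
    (hn : bil g (fun i => n i) (fun i => n i) = -1)
    (hJn : ∀ v, bil g (fun i => n i) (J.mulVec v) = 0) (hJ : ∀ v, J.mulVec v = 0 → v = 0)
    (T T' : (Fin 4 → Fin 4) → ℝ) :
    J.transpose * quadElectric g⁻¹ (spatialMetric g n) (electric g n T) (electric g n T') * J
      = quadElectric (J.transpose * g * J)⁻¹ (J.transpose * g * J)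
        (J.transpose * electric g n T * J) (J.transpose * electric g n T' * J) ∧
    J.transpose * quadMagnetic g⁻¹ (spatialMetric g n) (electric g n T) (electric g n T') * J
      = quadMagnetic (J.transpose * g * J)⁻¹ (J.transpose * g * J)
        (J.transpose * electric g n T * J) (J.transpose * electric g n T' * J) := by
  have e := electric_mul_normalSq hn
  have e' := electric_transpose_mul_normalSq hn
  have hh := restrict_spatialMetric hJn hg
  constructor
  · rw [← quadElectric_add_normalSq (e T) (e' T) (e T') (e' T'), ← hg.restrict_inv hn hJn hJ,
      quadElectric_congr, hh]
  · rw [← quadMagnetic_add_normalSq (e' T) (e T'), ← hg.restrict_inv hn hJn hJ,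
      quadMagnetic_congr, hh]

end restriction

/-! ### Vacuum metrics in a coordinate patch -/

theorem MetricOn.isWeylTensor {G : Eu 4 → Matrix (Fin 4) (Fin 4) ℝ} {U : Set (Eu 4)} {x : Eu 4}
    (hG : MetricOn G U) (hv : ∀ y ∈ U, ∀ μ ν, ricci G μ ν y = 0) (hx : x ∈ U) :
    IsWeylTensor (G x) (weyl G x) := by
  have h : weyl G x = riemannT G x := funext fun α => weyl_eq_riemannT hv hx α
  rw [h]
  exact
    { antisymm_left := fun a b c d => hG.riemann_antisymm_left hx a b c d
      antisymm_right := fun a b c d => riemann_antisymm_right a b c d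
      pair_symm := fun a b c d => hG.riemann_pair_symm hx a b c d
      cyclic := fun a b c d => hG.riemann_cyclic hx a b c d
      trace := fun l ν => (hG.trace_riemann hx l ν).trans (hv x hx l ν) }

theorem MetricOn.electric_magnetic_box {G : Eu 4 → Matrix (Fin 4) (Fin 4) ℝ} {U : Set (Eu 4)}
    {x : Eu 4} (hG : MetricOn G U) (hv : ∀ y ∈ U, ∀ μ ν, ricci G μ ν y = 0) (hx : x ∈ U)
    (hL : IsLorentzMatrix (G x)) {n : Eu 4} (hn : bil (G x) (fun i => n i) (fun i => n i) = -1)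
    (o : ℤˣ) :
    electric (G x) n (dAlembertian G (weyl G) x)
      = quadElectric (G x)⁻¹ (spatialMetric (G x) n) (electric (G x) n (weyl G x))
          (magnetic (G x) o n (weyl G x)) ∧
    magnetic (G x) o n (dAlembertian G (weyl G) x)
      = quadMagnetic (G x)⁻¹ (spatialMetric (G x) n) (electric (G x) n (weyl G x))
          (magnetic (G x) o n (weyl G x)) := by
  -- Only the leg of index 0 is prescribed, so a constant family suffices.
  obtain ⟨A, hA, hAn⟩ := hL.exists_frame (fun _ i => n i) {0} rfl (by
    rintro i rfl j rfl
    rw [hn]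
    simp [sgn])
  rw [show dAlembertian G (weyl G) x = boxQuad (G x) (weyl G x) from
    funext fun α => hG.box_weyl hv hx α]
  exact (hG.isWeylTensor hv hx).electric_magnetic_boxQuad hA (fun i => (hAn 0 rfl i).symm) o

end

section

/-! ### The metric in a chart -/

section Manifold

variable {M : Type*} [TopologicalSpace M] [ChartedSpace (Eu 4) M]
  {g : BilinField 4 M}

/-- The coordinate field is the tangent map of the inverse chart applied to a constant section. With
a smooth metric this gives smooth components. -/
theorem smooth_coordinate_field [IsManifold (𝓡 4) ∞ M] (p : M) (μ : Fin 4) :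
    ContMDiffOn (𝓡 4) (𝓡 4).tangent ∞ (fun y : Eu 4 =>
      (⟨(extChartAt (𝓡 4) p).symm y, mfderiv (𝓡 4) (𝓡 4) (extChartAt (𝓡 4) p).symm y (ev μ)⟩ :
        TangentBundle (𝓡 4) M)) (extChartAt (𝓡 4) p).target := by
  have hopen : IsOpen (extChartAt (𝓡 4) p).target := isOpen_extChartAt_target p
  have h1 := (contMDiffOn_extChartAt_symm (I := 𝓡 4) (n := ∞) p).contMDiffOn_tangentMapWithin
    (m := ∞) (by simp) hopen.uniqueMDiffOn
  have h2 : ContMDiff (𝓡 4) (𝓡 4).tangent ∞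
      (fun y : Eu 4 => (⟨y, ev μ⟩ : TangentBundle (𝓡 4) (Eu 4))) :=
    contMDiff_vectorSpace_iff_contDiff.2 contDiff_const
  have h3 := h1.comp h2.contMDiffOn (s := (extChartAt (𝓡 4) p).target) (fun y hy => hy)
  refine h3.congr fun y hy => ?_
  simp only [Function.comp_apply, tangentMapWithin]
  rw [mfderivWithin_of_isOpen hopen hy]

theorem IsLorentzMetric.smooth_chartMetric [IsManifold (𝓡 4) ∞ M] (hg : IsLorentzMetric g)
    (p : M) (μ ν : Fin 4) :
    ContDiffOn ℝ ∞ (fun y => chartMetric g p y μ ν) (extChartAt (𝓡 4) p).target := by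
  rw [← contMDiffOn_iff_contDiffOn]
  have h1 := hg.smooth.comp_contMDiffOn (contMDiffOn_extChartAt_symm (I := 𝓡 4) (n := ∞) p)
  have h2 : ContMDiffOn (𝓡 4) ((𝓡 4).prod 𝓘(ℝ)) ∞ (fun y => Bundle.TotalSpace.mk' ℝ
      (E := Bundle.Trivial M ℝ) ((extChartAt (𝓡 4) p).symm y) (chartMetric g p y μ ν))
      (extChartAt (𝓡 4) p).target := by
    apply ContMDiffOn.clm_bundle_apply₂ (F₁ := Eu 4) (F₂ := Eu 4)
    · exact h1
    · exact smooth_coordinate_field p μ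
    · exact smooth_coordinate_field p ν
  intro y hy
  have h3 := h2 y hy
  simp only [Bundle.contMDiffWithinAt_totalSpace] at h3
  exact h3.2

theorem chartMetric_self [IsManifold (𝓡 4) ∞ M] (g : BilinField 4 M) (p : M) :
    chartMetric g p (extChartAt (𝓡 4) p p) = metricAt g p := by
  have h := mfderivWithin_range_extChartAt_symm (I := 𝓡 4) (x := p)
  rw [ModelWithCorners.Boundaryless.range_eq_univ, mfderivWithin_univ] at h
  ext μ ν
  have h4 := extChartAt_to_inv (I := 𝓡 4) p
  simp only [chartMetric, metricAt, Matrix.of_apply]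
  rw [h]
  -- The base point returned by the chart equals p only propositionally, while the type of the form
  -- depends on it; hence the substitution.
  generalize (extChartAt (𝓡 4) p).symm (extChartAt (𝓡 4) p p) = q at h4 ⊢
  subst h4
  rfl

/-- The linear map `L` is the derivative of the inverse chart for `chartMetric` and the identity for
`metricAt`, so one computation serves both. -/
theorem bil_form {E : Type*} [AddCommGroup E] [Module ℝ E] [TopologicalSpace E]
    (B : E →L[ℝ] E →L[ℝ] ℝ) (L : Eu 4 →L[ℝ] E) (v w : Fin 4 → ℝ) :
    bil (Matrix.of fun μ ν => B (L (ev μ)) (L (ev ν))) v w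
      = B (L (WithLp.toLp 2 v)) (L (WithLp.toLp 2 w)) := by
  have h : ∀ v : Fin 4 → ℝ, WithLp.toLp 2 v = ∑ i, v i • (ev i : Eu 4) := by
    intro v
    ext j
    simp [Pi.single_apply]
  rw [h v, h w]
  simp only [map_sum, map_smul, sum_apply, smul_apply,
    bil, dotProduct, Matrix.mulVec, Matrix.of_apply, smul_eq_mul, Finset.mul_sum]
  rw [Finset.sum_comm]
  refine Finset.sum_congr rfl fun i _ => Finset.sum_congr rfl fun j _ => by ring

theorem isLorentzMatrix_form {E : Type*} [AddCommGroup E] [Module ℝ E] [TopologicalSpace E]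
    (B : E →L[ℝ] E →L[ℝ] ℝ) (L : Eu 4 →L[ℝ] E) (hL : Function.Bijective L)
    (hB : ∀ v w, B v w = B w v) (hs : ∃ t, B t t < 0 ∧ ∀ v, B t v = 0 → v ≠ 0 → 0 < B v v) :
    IsLorentzMatrix (Matrix.of fun μ ν => B (L (ev μ)) (L (ev ν))) := by
  refine ⟨fun i j => hB _ _, ?_⟩
  obtain ⟨t, ht, hv⟩ := hs
  obtain ⟨t', rfl⟩ := hL.2 t
  refine ⟨fun i => t' i, ?_, fun v h0 hne => ?_⟩
  · rw [bil_form]; exact ht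
  · rw [bil_form] at h0 ⊢
    refine hv _ h0 fun h => hne ?_
    have h1 : WithLp.toLp 2 v = (0 : Eu 4) := hL.1 (by rw [h, map_zero])
    ext i
    exact congrArg (fun u : Eu 4 => u i) h1

theorem IsLorentzMetric.isLorentzMatrix_chartMetric [IsManifold (𝓡 4) ∞ M]
    (hg : IsLorentzMetric g) (p : M) {y : Eu 4} (hy : y ∈ (extChartAt (𝓡 4) p).target) :
    IsLorentzMatrix (chartMetric g p y) := by
  have hi := isInvertible_mfderivWithin_extChartAt_symm (I := 𝓡 4) hy
  rw [ModelWithCorners.Boundaryless.range_eq_univ, mfderivWithin_univ] at hi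
  exact isLorentzMatrix_form (g ((extChartAt (𝓡 4) p).symm y))
    (mfderiv (𝓡 4) (𝓡 4) (extChartAt (𝓡 4) p).symm y) hi.bijective (hg.symm _) (hg.signature _)

theorem IsLorentzMetric.metricOn [IsManifold (𝓡 4) ∞ M] (hg : IsLorentzMetric g) (p : M) :
    MetricOn (chartMetric g p) (extChartAt (𝓡 4) p).target where
  isOpen := isOpen_extChartAt_target p
  smooth := hg.smooth_chartMetric p
  symm := fun _ hy => (hg.isLorentzMatrix_chartMetric p hy).symm
  det_ne := fun _ hy => (hg.isLorentzMatrix_chartMetric p hy).det_ne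

theorem bil_metricAt (g : BilinField 4 M) (p : M) (v w : Eu 4) :
    bil (metricAt g p) (fun i => v i) (fun i => w i) = g p v w :=
  bil_form (g p) (ContinuousLinearMap.id ℝ (Eu 4)) _ _

/-- The formulas for `□C` hold at `p`. -/
theorem electric_magnetic_boxWeylAt [IsManifold (𝓡 4) ∞ M] {p : M}
    (hG : MetricOn (chartMetric g p) (extChartAt (𝓡 4) p).target)
    (hL : IsLorentzMatrix (metricAt g p))
    (hv : ∀ y ∈ (extChartAt (𝓡 4) p).target, ∀ μ ν, ricci (chartMetric g p) μ ν y = 0)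
    (o : M → ℤˣ) (n : TangentSpace (𝓡 4) p) (hn : g p n n = -1) :
    tensorD g p n = quadElectric (metricAt g p)⁻¹
      (spatialMetric (metricAt g p) n) (tensorE g p n) (tensorB g o p n) ∧
    tensorH g o p n = quadMagnetic (metricAt g p)⁻¹
      (spatialMetric (metricAt g p) n) (tensorE g p n) (tensorB g o p n) := by
  have h := hG.electric_magnetic_box hv (mem_extChartAt_target p) (n := n) (by
    rwa [chartMetric_self]) (by
      rw [chartMetric_self]; exact (bil_metricAt g p n n).trans hn) (o p)
  rw [chartMetric_self] at h
  exact h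

/-! ### Slices -/

variable {S : Type*} [TopologicalSpace S] [ChartedSpace (Eu 3) S]
  {φ : S → M}

/-- In immersion charts the map is u ↦ (u, 0) up to a linear isomorphism. The projection `P` to the
first factor therefore gives a differentiable local left inverse, and the chain rule gives a left
inverse of the derivative. -/
theorem mfderiv_injective_of_isImmersionAt [IsManifold (𝓡 4) ∞ M] {s : S}
    (h : Manifold.IsImmersionAt (𝓡 3) (𝓡 4) ∞ φ s) :
    Function.Injective (mfderiv (𝓡 3) (𝓡 4) φ s) := by
  set e := h.domChart.extend (𝓡 3) with he
  set e' := h.codChart.extend (𝓡 4) with he'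
  have hs : s ∈ e.source := by
    rw [he, OpenPartialHomeomorph.extend_source]; exact h.mem_domChart_source
  have hφs : φ s ∈ e'.source := by
    rw [he', OpenPartialHomeomorph.extend_source]; exact h.mem_codChart_source
  let P : Eu 4 →L[ℝ] Eu 3 := (ContinuousLinearMap.fst ℝ (Eu 3) h.complement).comp
    (h.equiv.symm : Eu 4 →L[ℝ] Eu 3 × h.complement)
  have hloc : ∀ x ∈ e.source, P (e' (φ x)) = e x := by
    intro x hx
    have h1 := h.writtenInCharts (e.map_source hx)
    simp only [Function.comp_apply] at h1
    rw [← he, e.left_inv hx] at h1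
    simp only [P, ContinuousLinearMap.comp_apply]
    rw [h1]
    simp
  have hinv : (e.symm ∘ P ∘ e') ∘ φ =ᶠ[nhds s] id := by
    have : e.source ∈ nhds s := by
      rw [he, OpenPartialHomeomorph.extend_source]
      exact h.domChart.open_source.mem_nhds h.mem_domChart_source
    filter_upwards [this] with x hx
    simp only [Function.comp_apply, id]
    rw [hloc x hx, e.left_inv hx]
  have hd1 : MDifferentiableAt (𝓡 4) (𝓡 4) e' (φ s) :=
    (h.codChart.contMDiffAt_extend h.codChart_mem_maximalAtlas h.mem_codChart_source).mdifferentiableAt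
      (by simp)
  have hd2 : MDifferentiableAt (𝓡 4) (𝓡 3) P (e' (φ s)) :=
    P.differentiableAt.mdifferentiableAt
  have hd3 : MDifferentiableAt (𝓡 3) (𝓡 3) e.symm (P (e' (φ s))) := by
    rw [hloc s hs]
    have h1 := contMDiffOn_extend_symm h.domChart_mem_maximalAtlas
    rw [← OpenPartialHomeomorph.extend_target'] at h1
    have h2 : e.target ∈ nhds (e s) := by
      refine IsOpen.mem_nhds ?_ (e.map_source hs)
      exact h.domChart.isOpen_extend_target
    exact (h1.contMDiffAt h2).mdifferentiableAt (by simp)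
  have hd := hd3.comp (φ s) (hd2.comp (φ s) hd1)
  have hc := mfderiv_comp s hd (h.contMDiffAt.mdifferentiableAt (by simp))
  have hid : mfderiv (𝓡 3) (𝓡 3) ((e.symm ∘ P ∘ e') ∘ φ) s = ContinuousLinearMap.id ℝ _ := by
    rw [hinv.mfderiv_eq, mfderiv_id]
  rw [hid] at hc
  intro u v huv
  have h1 := DFunLike.congr_fun hc u
  have h2 := DFunLike.congr_fun hc v
  simp only [ContinuousLinearMap.comp_apply] at h1 h2
  rw [huv, ← h2] at h1
  exact h1

theorem mulVec_jacobian (φ : S → M) (s : S) (v : Fin 3 → ℝ) :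
    (jacobian φ s).mulVec v = fun μ =>
      (show Eu 4 from mfderiv (𝓡 3) (𝓡 4) φ s (WithLp.toLp 2 v : Eu 3)) μ := by
  have h : WithLp.toLp 2 v = ∑ i, v i • (ev i : Eu 3) := by
    ext j
    simp [Pi.single_apply]
  ext μ
  have h1 : (EuclideanSpace.proj μ : Eu 4 →L[ℝ] ℝ).comp
      (show Eu 3 →L[ℝ] Eu 4 from mfderiv (𝓡 3) (𝓡 4) φ s) (WithLp.toLp 2 v)
      = ∑ i, v i * jacobian φ s μ i := by
    rw [h, map_sum]
    refine Finset.sum_congr rfl fun i _ => ?_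
    rw [map_smul]
    rfl
  rw [Matrix.mulVec, dotProduct_comm]
  exact h1.symm

/-- Linear algebra at one point: the Jacobian is injective and orthogonal to the normal. The
spacetime formulas enter as hypotheses, so the lemma serves both the general vacuum case and the
Kruskal case. -/
theorem IsSlice.restrict [IsManifold (𝓡 4) ∞ M] {n : ∀ s, TangentSpace (𝓡 4) (φ s)}
    {h K : BilinField 3 S} (hS : IsSlice g φ n h K) (s : S)
    (hL : IsLorentzMatrix (metricAt g (φ s))) (o : M → ℤˣ)
    (hD : tensorD g (φ s) (n s) = quadElectric (metricAt g (φ s))⁻¹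
        (spatialMetric (metricAt g (φ s)) (n s)) (tensorE g (φ s) (n s)) (tensorB g o (φ s) (n s)) ∧
      tensorH g o (φ s) (n s) = quadMagnetic (metricAt g (φ s))⁻¹
        (spatialMetric (metricAt g (φ s)) (n s)) (tensorE g (φ s) (n s))
        (tensorB g o (φ s) (n s))) :
    sliceD g φ n s = quadElectric (dataMetric h s)⁻¹ (dataMetric h s)
        (sliceE g φ n s) (sliceB g o φ n s) ∧
      sliceH g o φ n s = quadMagnetic (dataMetric h s)⁻¹ (dataMetric h s)
        (sliceE g φ n s) (sliceB g o φ n s) := by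
  have hdata : dataMetric h s = (jacobian φ s).transpose * metricAt g (φ s) * jacobian φ s := by
    ext i j
    rw [Matrix.mul_assoc]
    refine (hS.first s _ _).trans ?_
    refine (bil_metricAt g (φ s) _ _).symm.trans ?_
    rfl
  have hr := hL.restrict_quad (n := n s) (J := jacobian φ s)
    ((bil_metricAt g (φ s) _ _).trans (hS.normal_unit s))
    (fun v => by
      rw [mulVec_jacobian]
      exact (bil_metricAt g (φ s) _ _).trans (hS.normal_orthogonal s _))
    (fun v hv => by
      rw [mulVec_jacobian] at hv
      have h1 : (mfderiv (𝓡 3) (𝓡 4) φ s) (WithLp.toLp 2 v : Eu 3) = 0 := by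
        refine PiLp.ext fun μ => ?_
        exact congrFun hv μ
      have h2 := mfderiv_injective_of_isImmersionAt (hS.embedding.isImmersion.isImmersionAt s)
        (h1.trans (map_zero _).symm)
      ext i
      exact congrArg (fun u : Eu 3 => u i) h2)
    (weylAt g (φ s)) (dual (metricAt g (φ s)) (o (φ s)) (weylAt g (φ s)))
  rw [← hdata] at hr
  constructor
  · rw [sliceD, hD.1]
    exact hr.1
  · rw [sliceH, hD.2]
    exact hr.2

end Manifold

end

section

/-! ### The radial coordinate of the Kruskal spacetime -/

open Classical in
/-- The solution `x > 0` of `(1 - x) e^x = s`, for `s < 1`. -/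
def radiusSol (s : ℝ) : ℝ := if h : s < 1 then (existsUnique_radius h).choose else 0

theorem radiusSol_spec {s : ℝ} (hs : s < 1) :
    0 < radiusSol s ∧ (1 - radiusSol s) * Real.exp (radiusSol s) = s := by
  rw [radiusSol, dif_pos hs]
  exact (existsUnique_radius hs).choose_spec.1

theorem radiusSol_unique {s x : ℝ} (hs : s < 1) (hx : 0 < x) (h : (1 - x) * Real.exp x = s) :
    x = radiusSol s :=
  (existsUnique_radius hs).unique ⟨hx, h⟩ (radiusSol_spec hs)

theorem radius_eq (m : ℝ) {p : Eu 4} (hp : p 0 ^ 2 - kX p ^ 2 < 1) :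
    radius m p = 2 * m * radiusSol (p 0 ^ 2 - kX p ^ 2) := by
  rw [radius, radiusSol, dif_pos hp, dif_pos hp]

/-- Inverse function theorem: (1 - x) e^x has derivative -x e^x, nonzero for x > 0, and the analytic
local inverse is the chosen root by uniqueness. -/
theorem contDiffAt_radiusSol {s : ℝ} (hs : s < 1) : ContDiffAt ℝ ∞ radiusSol s := by
  obtain ⟨hx, hxs⟩ := radiusSol_spec hs
  set x := radiusSol s
  have ha : AnalyticAt ℝ (fun x : ℝ => (1 - x) * Real.exp x) x := by fun_prop
  have hd : HasDerivAt (fun x : ℝ => (1 - x) * Real.exp x) (-x * Real.exp x) x :=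
    (((hasDerivAt_id' x).const_sub 1).fun_mul (Real.hasDerivAt_exp x)).congr_deriv (by ring)
  have hne : deriv (fun x : ℝ => (1 - x) * Real.exp x) x ≠ 0 := by
    rw [hd.deriv]
    exact mul_ne_zero (neg_ne_zero.2 hx.ne') (Real.exp_pos x).ne'
  have hl := ha.analyticAt_localInverse hne
  have hr := ha.hasStrictDerivAt.eventually_right_inverse hne
  have h0 : (ha.hasStrictDerivAt.localInverse _ _ _ hne) ((1 - x) * Real.exp x) = x :=
    HasStrictFDerivAt.localInverse_apply_image ..
  have hc := hl.continuousAt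
  -- Uniqueness holds among positive roots only, so the local inverse must stay positive nearby.
  have hp := hc.eventually (lt_mem_nhds (by simpa only [h0] using hx))
  simp only [hxs] at hl hr hp
  refine hl.contDiffAt.congr_of_eventuallyEq ?_
  filter_upwards [hr, hp, gt_mem_nhds hs] with t h1 h2 h3
  exact (radiusSol_unique h3 h2 h1).symm

/-- Implicit differentiation of (1 - x) e^x = s. -/
theorem hasDerivAt_radiusSol {s : ℝ} (hs : s < 1) :
    HasDerivAt radiusSol (-(Real.exp (-radiusSol s) * (radiusSol s)⁻¹)) s := by
  have h1 := ((contDiffAt_radiusSol hs).differentiableAt (by simp)).hasDerivAt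
  obtain ⟨hx, -⟩ := radiusSol_spec hs
  have h2 := (h1.const_sub 1).fun_mul h1.exp
  have h3 : HasDerivAt (fun t => (1 - radiusSol t) * Real.exp (radiusSol t)) 1 s := by
    refine (hasDerivAt_id' s).congr_of_eventuallyEq ?_
    filter_upwards [gt_mem_nhds hs] with t ht
    exact (radiusSol_spec ht).2
  have h4 := h2.unique h3
  have h5 : deriv radiusSol s = -(Real.exp (-radiusSol s) * (radiusSol s)⁻¹) := by
    have he := Real.exp_pos (radiusSol s)
    rw [Real.exp_neg]
    field_simp
    linarith
  rwa [h5] at h1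

/-! ### Functions with given partial derivatives -/

/-- `f` is differentiable at `x`, with the partial derivatives `d`. -/
def HasPd (f : Eu 4 → ℝ) (d : Fin 4 → ℝ) (x : Eu 4) : Prop :=
  DifferentiableAt ℝ f x ∧ ∀ μ, pd μ f x = d μ

namespace HasPd

variable {f f' : Eu 4 → ℝ} {d d' : Fin 4 → ℝ} {x : Eu 4}

theorem const (c : ℝ) : HasPd (fun _ => c) (fun _ => 0) x :=
  ⟨differentiableAt_const c, fun μ => pd_const c μ⟩

theorem add (h : HasPd f d x) (h' : HasPd f' d' x) :
    HasPd (fun y => f y + f' y) (fun μ => d μ + d' μ) x :=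
  ⟨h.1.fun_add h'.1, fun μ => by rw [pd_add h.1 h'.1, h.2, h'.2]⟩

theorem sub (h : HasPd f d x) (h' : HasPd f' d' x) :
    HasPd (fun y => f y - f' y) (fun μ => d μ - d' μ) x :=
  ⟨h.1.fun_sub h'.1, fun μ => by rw [pd_sub h.1 h'.1, h.2, h'.2]⟩

theorem mul (h : HasPd f d x) (h' : HasPd f' d' x) :
    HasPd (fun y => f y * f' y) (fun μ => d μ * f' x + f x * d' μ) x :=
  ⟨h.1.fun_mul h'.1, fun μ => by rw [pd_mul h.1 h'.1, h.2, h'.2]⟩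

theorem comp {F : ℝ → ℝ} {c : ℝ} (hF : HasDerivAt F c (f x)) (h : HasPd f d x) :
    HasPd (fun y => F (f y)) (fun μ => c * d μ) x := by
  have h1 : HasFDerivAt (fun y => F (f y)) (c • fderiv ℝ f x) x :=
    hF.comp_hasFDerivAt x h.1.hasFDerivAt
  refine ⟨h1.differentiableAt, fun μ => ?_⟩
  rw [pd, h1.fderiv]
  exact congrArg (c * ·) (h.2 μ)

theorem congr (h : HasPd f d x) (hd : ∀ μ, d μ = d' μ) : HasPd f d' x :=
  ⟨h.1, fun μ => (h.2 μ).trans (hd μ)⟩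

end HasPd

/-! ### The forms `dT`, `dX`, `dΩ²` in coordinates -/

/-- Components of `dT`, and of `∂_T`. -/
def cT (a : Fin 4) : ℝ := if a = 0 then 1 else 0

/-- Components of `∂_X`. -/
def vX (y : Eu 4) (a : Fin 4) : ℝ := if a = 0 then 0 else y a

/-- Components of `dX`. -/
def cX (y : Eu 4) (a : Fin 4) : ℝ := (normSq y)⁻¹ * vX y a

/-- The projector to the last three coordinates. -/
def spaceProj (a b : Fin 4) : ℝ := if a = 0 then 0 else if a = b then 1 else 0

/-- Components of `dΩ²`. -/
def cΩ (y : Eu 4) (a b : Fin 4) : ℝ := (normSq y)⁻¹ * spaceProj a b - cX y a * cX y b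

/-- The projector to the tangent space of the sphere. -/
def projΩ (y : Eu 4) (a b : Fin 4) : ℝ := spaceProj a b - vX y a * cX y b

theorem normSq_eq (y : Eu 4) : normSq y = y 1 ^ 2 + y 2 ^ 2 + y 3 ^ 2 := by
  simp [normSq, Fin.sum_univ_three]

section derivatives

variable {y : Eu 4}

theorem hasPd_coord (a : Fin 4) : HasPd (fun y => y a) (fun μ => if a = μ then 1 else 0) y := by
  have h : HasFDerivAt (fun y : Eu 4 => y a) (EuclideanSpace.proj a : Eu 4 →L[ℝ] ℝ) y :=
    (EuclideanSpace.proj a : Eu 4 →L[ℝ] ℝ).hasFDerivAt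
  refine ⟨h.differentiableAt, fun μ => ?_⟩
  rw [pd, h.fderiv]
  simp

theorem hasPd_vX (a : Fin 4) : HasPd (fun y => vX y a) (fun μ => spaceProj a μ) y := by
  by_cases h : a = 0
  · subst h
    simpa [vX, spaceProj] using HasPd.const 0
  · simpa [vX, spaceProj, h] using hasPd_coord a

theorem hasPd_normSq : HasPd normSq (fun μ => 2 * vX y μ) y := by
  have h : normSq = fun y => y 1 * y 1 + y 2 * y 2 + y 3 * y 3 := by
    ext y; rw [normSq_eq]; ring
  rw [h]
  refine ((((hasPd_coord 1).mul (hasPd_coord 1)).add ((hasPd_coord 2).mul (hasPd_coord 2))).add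
    ((hasPd_coord 3).mul (hasPd_coord 3))).congr fun μ => ?_
  fin_cases μ <;> simp [vX] <;> ring

theorem hasPd_normSq_inv (hy : normSq y ≠ 0) :
    HasPd (fun y => (normSq y)⁻¹) (fun μ => -2 * (normSq y)⁻¹ * cX y μ) y := by
  refine (HasPd.comp (hasDerivAt_inv hy) hasPd_normSq).congr fun μ => ?_
  rw [cX]
  field_simp

/-- The derivatives of `cX`, `cΩ`, `projΩ` and `vX` are polynomials in these same symbols. The
calculus thus closes, and no explicit coordinates on the sphere are needed. -/
theorem hasPd_cX (hy : normSq y ≠ 0) (a : Fin 4) :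
    HasPd (fun y => cX y a) (fun μ => cΩ y μ a - cX y μ * cX y a) y := by
  refine ((hasPd_normSq_inv hy).mul (hasPd_vX a)).congr fun μ => ?_
  have : spaceProj a μ = spaceProj μ a := by
    fin_cases a <;> fin_cases μ <;> simp [spaceProj]
  rw [cΩ, this, cX, cX]
  ring

theorem hasPd_cΩ (hy : normSq y ≠ 0) (a b : Fin 4) : HasPd (fun y => cΩ y a b)
    (fun μ => -2 * cX y μ * cΩ y a b - cΩ y μ a * cX y b - cΩ y μ b * cX y a) y := by
  refine (((hasPd_normSq_inv hy).mul (HasPd.const (spaceProj a b))).sub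
    ((hasPd_cX hy a).mul (hasPd_cX hy b))).congr fun μ => ?_
  simp only [cΩ]
  ring

theorem hasPd_projΩ (hy : normSq y ≠ 0) (a b : Fin 4) : HasPd (fun y => projΩ y a b)
    (fun μ => -(projΩ y a μ * cX y b) - vX y a * cΩ y μ b) y := by
  refine ((HasPd.const (spaceProj a b)).sub ((hasPd_vX a).mul (hasPd_cX hy b))).congr fun μ => ?_
  simp only [projΩ]
  ring

theorem hasPd_vX' (a : Fin 4) :
    HasPd (fun y => vX y a) (fun μ => projΩ y a μ + vX y a * cX y μ) y :=
  (hasPd_vX a).congr fun μ => by rw [projΩ]; ring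

theorem hasPd_kX (hy : normSq y ≠ 0) : HasPd kX (fun μ => cX y μ) y := by
  have h : kX = fun y => 1 / 2 * Real.log (normSq y) := by
    ext y
    rw [kX, Real.log_sqrt (show 0 ≤ normSq y from Finset.sum_nonneg fun i _ => sq_nonneg _)]
    ring
  rw [h]
  refine ((HasPd.const (1 / 2)).mul (HasPd.comp (Real.hasDerivAt_log hy) hasPd_normSq)).congr
    fun μ => ?_
  rw [cX]
  ring

/-- This and the next contractions are the multiplication table of the adapted decomposition: dX is
dual to ∂_X, dΩ² annihilates ∂_X, and `projΩ` is a projector compatible with both. -/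
theorem sum_vX (hy : normSq y ≠ 0) : ∑ a, cX y a * vX y a = 1 := by
  simp only [cX, vX, Fin.sum_univ_four]
  simp
  field_simp
  rw [normSq_eq]

theorem sum_cΩ_vX (hy : normSq y ≠ 0) (a : Fin 4) : ∑ b, cΩ y a b * vX y b = 0 := by
  have h : ∑ b, cΩ y a b * vX y b
      = (normSq y)⁻¹ * ∑ b, spaceProj a b * vX y b - cX y a * ∑ b, cX y b * vX y b := by
    simp only [Fin.sum_univ_four, cΩ]; ring
  rw [h, sum_vX hy]
  fin_cases a <;> simp [spaceProj, vX, cX, Fin.sum_univ_four]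

theorem sum_projΩ_vX (hy : normSq y ≠ 0) (a : Fin 4) : ∑ b, projΩ y a b * vX y b = 0 := by
  have h : ∑ b, projΩ y a b * vX y b
      = ∑ b, spaceProj a b * vX y b - vX y a * ∑ b, cX y b * vX y b := by
    simp only [Fin.sum_univ_four, projΩ]; ring
  rw [h, sum_vX hy]
  fin_cases a <;> simp [spaceProj, vX, Fin.sum_univ_four]

theorem sum_cX_projΩ (hy : normSq y ≠ 0) (a : Fin 4) : ∑ b, cX y b * projΩ y b a = 0 := by
  have h : ∑ b, cX y b * projΩ y b a
      = ∑ b, cX y b * spaceProj b a - (∑ b, cX y b * vX y b) * cX y a := by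
    simp only [Fin.sum_univ_four, projΩ]; ring
  rw [h, sum_vX hy]
  fin_cases a <;> simp [spaceProj, vX, cX, Fin.sum_univ_four]

theorem sum_cΩ_projΩ (hy : normSq y ≠ 0) (a c : Fin 4) : ∑ b, cΩ y a b * projΩ y b c = cΩ y a c := by
  have h : ∑ b, cΩ y a b * projΩ y b c
      = ∑ b, cΩ y a b * spaceProj b c - (∑ b, cΩ y a b * vX y b) * cX y c := by
    simp only [Fin.sum_univ_four, projΩ]; ring
  rw [h, sum_cΩ_vX hy]
  fin_cases c <;> simp [spaceProj, vX, cX, cΩ, Fin.sum_univ_four]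
  fin_cases a <;> simp

theorem sum_projΩ_projΩ (hy : normSq y ≠ 0) (a c : Fin 4) : ∑ b, projΩ y a b * projΩ y b c = projΩ y a c := by
  have h : ∑ b, projΩ y a b * projΩ y b c
      = ∑ b, projΩ y a b * spaceProj b c - (∑ b, projΩ y a b * vX y b) * cX y c := by
    simp only [Fin.sum_univ_four]; simp only [projΩ]; ring
  rw [h, sum_projΩ_vX hy]
  fin_cases c <;> simp [spaceProj, vX, cX, projΩ, Fin.sum_univ_four]

end derivatives

end

section

/-! ### The Kruskal metric in coordinates -/

/-- `x = r / 2m`. -/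
def kx (y : Eu 4) : ℝ := radiusSol (y 0 ^ 2 - kX y ^ 2)

/-- `2m / r`. -/
def kxInv (y : Eu 4) : ℝ := (kx y)⁻¹

/-- `e^{-r/2m}`. -/
def kexp (y : Eu 4) : ℝ := Real.exp (-kx y)

/-- The components of `-T dT + X dX`. -/
def cS (y : Eu 4) (a : Fin 4) : ℝ := -(y 0 * cT a) + kX y * cX y a

/-- The components of the Kruskal metric. -/
def kruskalMatrix (m : ℝ) (y : Eu 4) : Matrix (Fin 4) (Fin 4) ℝ :=
  Matrix.of fun a b => 16 * m ^ 2 * (kexp y * kxInv y * (cX y a * cX y b - cT a * cT b))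
    + 4 * m ^ 2 * (kx y * kx y * cΩ y a b)

theorem cΩ_symm (y : Eu 4) (a b : Fin 4) : cΩ y a b = cΩ y b a := by
  have : spaceProj a b = spaceProj b a := by
    fin_cases a <;> fin_cases b <;> simp [spaceProj]
  rw [cΩ, cΩ, this, mul_comm (cX y a)]

section

variable {y : Eu 4}

theorem kx_pos (hy : y ∈ kruskalRegion) : 0 < kx y := (radiusSol_spec hy.2).1

theorem kx_mul_kxInv (hy : y ∈ kruskalRegion) : kx y * kxInv y = 1 :=
  mul_inv_cancel₀ (kx_pos hy).ne'

/-- The defining equation of r in polynomial form. With `kx_mul_kxInv` it is one of the two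
relations used in the curvature computation. -/
theorem kexp_mul (hy : y ∈ kruskalRegion) : kexp y * (y 0 ^ 2 - kX y ^ 2) = 1 - kx y := by
  have h := (radiusSol_spec hy.2).2
  rw [← h, kexp, Real.exp_neg, kx]
  field_simp

theorem hasPd_time : HasPd (fun y => y 0) cT y :=
  (hasPd_coord 0).congr fun μ => by simp [cT, eq_comm]

theorem hasPd_kx (hy : y ∈ kruskalRegion) :
    HasPd kx (fun μ => 2 * kexp y * kxInv y * cS y μ) y := by
  have h1 := (hasPd_time.mul hasPd_time).sub ((hasPd_kX hy.1).mul (hasPd_kX hy.1))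
  have h2 : HasPd (fun y => radiusSol (y 0 * y 0 - kX y * kX y)) _ y :=
    HasPd.comp (hasDerivAt_radiusSol (by simpa only [pow_two] using hy.2)) h1
  have h3 : kx = fun y => radiusSol (y 0 * y 0 - kX y * kX y) := by
    ext y; rw [kx, pow_two, pow_two]
  rw [← h3] at h2
  refine h2.congr fun μ => ?_
  rw [← congrFun h3 y]
  simp only [kexp, kxInv, cS]
  ring

theorem hasPd_kexp (hy : y ∈ kruskalRegion) :
    HasPd kexp (fun μ => -2 * kexp y ^ 2 * kxInv y * cS y μ) y := by
  have h := HasPd.comp (Real.hasDerivAt_exp (0 - kx y)) ((HasPd.const 0).sub (hasPd_kx hy))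
  have h3 : kexp = fun y => Real.exp (0 - kx y) := by
    ext y; rw [kexp, zero_sub]
  rw [← h3] at h
  refine h.congr fun μ => ?_
  rw [← congrFun h3 y]
  ring

theorem hasPd_kxInv (hy : y ∈ kruskalRegion) :
    HasPd kxInv (fun μ => -2 * kexp y * kxInv y ^ 3 * cS y μ) y := by
  refine (HasPd.comp (hasDerivAt_inv (kx_pos hy).ne') (hasPd_kx hy)).congr fun μ => ?_
  simp only [kxInv]
  ring

theorem hasPd_kruskalMatrix (m : ℝ) (hy : y ∈ kruskalRegion) (a b : Fin 4) :
    HasPd (fun y => kruskalMatrix m y a b)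
      (fun μ => 16 * m ^ 2 * (-2 * kexp y ^ 2 * (kxInv y ^ 2 + kxInv y ^ 3) * cS y μ
          * (cX y a * cX y b - cT a * cT b)
        + kexp y * kxInv y * ((cΩ y μ a - cX y μ * cX y a) * cX y b
          + cX y a * (cΩ y μ b - cX y μ * cX y b)))
      + 4 * m ^ 2 * (4 * kexp y * (kx y * kxInv y) * cS y μ * cΩ y a b
        + kx y ^ 2 * (-2 * cX y μ * cΩ y a b - cΩ y μ a * cX y b - cΩ y μ b * cX y a))) y := by
  have hX := hasPd_cX hy.1
  refine (((HasPd.const (16 * m ^ 2)).mul (((hasPd_kexp hy).mul (hasPd_kxInv hy)).mul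
    (((hX a).mul (hX b)).sub (HasPd.const (cT a * cT b))))).add
    ((HasPd.const (4 * m ^ 2)).mul (((hasPd_kx hy).mul (hasPd_kx hy)).mul
      (hasPd_cΩ hy.1 a b)))).congr fun μ => ?_
  ring

/-! ### The connection -/

/-- The coefficient `e^{-x} (1 + x) / x²`. -/
def kL (y : Eu 4) : ℝ := kexp y * (kxInv y + kxInv y * kxInv y)

/-- `Γ^T_{bc}`. -/
def kΓT (y : Eu 4) (b c : Fin 4) : ℝ :=
  kL y * (y 0 * (cT b * cT c + cX y b * cX y c) - kX y * (cT b * cX y c + cX y b * cT c))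
    - 1 / 2 * (y 0 * kx y * cΩ y b c)

/-- `Γ^X_{bc}`. -/
def kΓX (y : Eu 4) (b c : Fin 4) : ℝ :=
  kL y * (y 0 * (cT b * cX y c + cX y b * cT c) - kX y * (cT b * cT c + cX y b * cX y c))
    - 1 / 2 * (kX y * kx y * cΩ y b c) + cΩ y b c - cX y b * cX y c

/-- The form `k` in the angular part `P^a_b k_c + P^a_c k_b` of the connection. -/
def kΓΩ (y : Eu 4) (b : Fin 4) : ℝ := 2 * (kexp y * (kxInv y * kxInv y)) * cS y b - cX y b

/-- The Christoffel symbols of the Kruskal metric. -/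
def kΓ (y : Eu 4) (a b c : Fin 4) : ℝ :=
  cT a * kΓT y b c + vX y a * kΓX y b c + projΩ y a b * kΓΩ y c + projΩ y a c * kΓΩ y b

theorem sum_cT_kΓ (b c : Fin 4) : ∑ a, cT a * kΓ y a b c = kΓT y b c := by
  simp [cT, kΓ, vX, projΩ, spaceProj]

theorem sum_cX_kΓ (hy : normSq y ≠ 0) (b c : Fin 4) : ∑ a, cX y a * kΓ y a b c = kΓX y b c := by
  have h : ∑ a, cX y a * kΓ y a b c = (∑ a, cX y a * cT a) * kΓT y b c
      + (∑ a, cX y a * vX y a) * kΓX y b c + (∑ a, cX y a * projΩ y a b) * kΓΩ y c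
      + (∑ a, cX y a * projΩ y a c) * kΓΩ y b := by
    simp only [Fin.sum_univ_four, kΓ]; ring
  rw [h, sum_vX hy, sum_cX_projΩ hy, sum_cX_projΩ hy]
  simp [cT, cX, vX]

theorem sum_cΩ_kΓ (hy : normSq y ≠ 0) (d b c : Fin 4) :
    ∑ a, cΩ y d a * kΓ y a b c = cΩ y d b * kΓΩ y c + cΩ y d c * kΓΩ y b := by
  have h : ∑ a, cΩ y d a * kΓ y a b c = (∑ a, cΩ y d a * cT a) * kΓT y b c
      + (∑ a, cΩ y d a * vX y a) * kΓX y b c + (∑ a, cΩ y d a * projΩ y a b) * kΓΩ y c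
      + (∑ a, cΩ y d a * projΩ y a c) * kΓΩ y b := by
    simp only [Fin.sum_univ_four, kΓ]; ring
  rw [h, sum_cΩ_vX hy, sum_cΩ_projΩ hy, sum_cΩ_projΩ hy]
  have : cΩ y d 0 = 0 := by fin_cases d <;> simp [cΩ, spaceProj, cX, vX]
  simp [cT, this]

theorem sum_projΩ_kΓ (hy : normSq y ≠ 0) (d b c : Fin 4) :
    ∑ a, projΩ y d a * kΓ y a b c = projΩ y d b * kΓΩ y c + projΩ y d c * kΓΩ y b := by
  have h : ∑ a, projΩ y d a * kΓ y a b c = (∑ a, projΩ y d a * cT a) * kΓT y b c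
      + (∑ a, projΩ y d a * vX y a) * kΓX y b c + (∑ a, projΩ y d a * projΩ y a b) * kΓΩ y c
      + (∑ a, projΩ y d a * projΩ y a c) * kΓΩ y b := by
    simp only [Fin.sum_univ_four, kΓ]; ring
  rw [h, sum_projΩ_vX hy, sum_projΩ_projΩ hy, sum_projΩ_projΩ hy]
  have : projΩ y d 0 = 0 := by fin_cases d <;> simp [projΩ, spaceProj, cX, vX]
  simp [cT, this]

/-- The guessed connection is checked with its first index lowered, so that the metric need not be
inverted; nondegeneracy then identifies it in `christoffel_kruskalMatrix`. -/
theorem sum_kruskalMatrix_kΓ (m : ℝ) (hy : y ∈ kruskalRegion) (k μ ν : Fin 4) :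
    ∑ l, kruskalMatrix m y k l * kΓ y l μ ν = 1 / 2 *
      (pd μ (fun y => kruskalMatrix m y k ν) y + pd ν (fun y => kruskalMatrix m y k μ) y
        - pd k (fun y => kruskalMatrix m y μ ν) y) := by
  have h : ∑ l, kruskalMatrix m y k l * kΓ y l μ ν
      = 16 * m ^ 2 * (kexp y * kxInv y * (cX y k * ∑ l, cX y l * kΓ y l μ ν
          - cT k * ∑ l, cT l * kΓ y l μ ν))
        + 4 * m ^ 2 * (kx y * kx y * ∑ l, cΩ y k l * kΓ y l μ ν) := by
    simp only [Fin.sum_univ_four, kruskalMatrix, Matrix.of_apply]; ring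
  rw [h, sum_cT_kΓ, sum_cX_kΓ hy.1, sum_cΩ_kΓ hy.1, (hasPd_kruskalMatrix m hy _ _).2,
    (hasPd_kruskalMatrix m hy _ _).2, (hasPd_kruskalMatrix m hy _ _).2]
  beta_reduce
  rw [cΩ_symm y μ k, cΩ_symm y ν k, cΩ_symm y ν μ]
  simp only [kΓT, kΓX, kΓΩ, kL, cS]
  linear_combination 8 * m ^ 2 * kexp y * kx y * kxInv y
    * (cΩ y k μ * (-(y 0 * cT ν) + kX y * cX y ν) + cΩ y k ν * (-(y 0 * cT μ) + kX y * cX y μ))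
    * kx_mul_kxInv hy

theorem hasPd_kL (hy : y ∈ kruskalRegion) : HasPd kL
    (fun μ => -2 * kexp y ^ 2 * (kxInv y ^ 2 + 2 * kxInv y ^ 3 + 2 * kxInv y ^ 4) * cS y μ) y := by
  refine ((hasPd_kexp hy).mul ((hasPd_kxInv hy).add ((hasPd_kxInv hy).mul
    (hasPd_kxInv hy)))).congr fun μ => ?_
  ring

theorem hasPd_kΓT (hy : y ∈ kruskalRegion) (b c : Fin 4) : HasPd (fun y => kΓT y b c)
    (fun μ => -2 * kexp y ^ 2 * (kxInv y ^ 2 + 2 * kxInv y ^ 3 + 2 * kxInv y ^ 4) * cS y μ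
        * (y 0 * (cT b * cT c + cX y b * cX y c) - kX y * (cT b * cX y c + cX y b * cT c))
      + kL y * (cT μ * (cT b * cT c + cX y b * cX y c)
        + y 0 * ((cΩ y μ b - cX y μ * cX y b) * cX y c + cX y b * (cΩ y μ c - cX y μ * cX y c))
        - cX y μ * (cT b * cX y c + cX y b * cT c)
        - kX y * (cT b * (cΩ y μ c - cX y μ * cX y c) + (cΩ y μ b - cX y μ * cX y b) * cT c))
      - 1 / 2 * ((cT μ * kx y + y 0 * (2 * kexp y * kxInv y * cS y μ)) * cΩ y b c
        + y 0 * kx y * (-2 * cX y μ * cΩ y b c - cΩ y μ b * cX y c - cΩ y μ c * cX y b))) y := by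
  have hX := hasPd_cX hy.1
  refine (((hasPd_kL hy).mul ((hasPd_time.mul ((HasPd.const (cT b * cT c)).add
    ((hX b).mul (hX c)))).sub ((hasPd_kX hy.1).mul (((HasPd.const (cT b)).mul (hX c)).add
      ((hX b).mul (HasPd.const (cT c))))))).sub ((HasPd.const (1 / 2)).mul
      ((hasPd_time.mul (hasPd_kx hy)).mul (hasPd_cΩ hy.1 b c)))).congr fun μ => ?_
  ring

theorem hasPd_kΓX (hy : y ∈ kruskalRegion) (b c : Fin 4) : HasPd (fun y => kΓX y b c)
    (fun μ => -2 * kexp y ^ 2 * (kxInv y ^ 2 + 2 * kxInv y ^ 3 + 2 * kxInv y ^ 4) * cS y μ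
        * (y 0 * (cT b * cX y c + cX y b * cT c) - kX y * (cT b * cT c + cX y b * cX y c))
      + kL y * (cT μ * (cT b * cX y c + cX y b * cT c)
        + y 0 * (cT b * (cΩ y μ c - cX y μ * cX y c) + (cΩ y μ b - cX y μ * cX y b) * cT c)
        - cX y μ * (cT b * cT c + cX y b * cX y c)
        - kX y * ((cΩ y μ b - cX y μ * cX y b) * cX y c + cX y b * (cΩ y μ c - cX y μ * cX y c)))
      - 1 / 2 * ((cX y μ * kx y + kX y * (2 * kexp y * kxInv y * cS y μ)) * cΩ y b c
        + kX y * kx y * (-2 * cX y μ * cΩ y b c - cΩ y μ b * cX y c - cΩ y μ c * cX y b))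
      + (-2 * cX y μ * cΩ y b c - cΩ y μ b * cX y c - cΩ y μ c * cX y b)
      - ((cΩ y μ b - cX y μ * cX y b) * cX y c + cX y b * (cΩ y μ c - cX y μ * cX y c))) y := by
  have hX := hasPd_cX hy.1
  refine (((((hasPd_kL hy).mul ((hasPd_time.mul (((HasPd.const (cT b)).mul (hX c)).add
      ((hX b).mul (HasPd.const (cT c))))).sub ((hasPd_kX hy.1).mul
      ((HasPd.const (cT b * cT c)).add ((hX b).mul (hX c)))))).sub ((HasPd.const (1 / 2)).mul
      (((hasPd_kX hy.1).mul (hasPd_kx hy)).mul (hasPd_cΩ hy.1 b c)))).add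
      (hasPd_cΩ hy.1 b c)).sub ((hX b).mul (hX c))).congr fun μ => ?_
  ring

theorem hasPd_kΓΩ (hy : y ∈ kruskalRegion) (b : Fin 4) : HasPd (fun y => kΓΩ y b)
    (fun μ => -4 * kexp y ^ 2 * (kxInv y ^ 3 + 2 * kxInv y ^ 4) * cS y μ * cS y b
      + 2 * kexp y * kxInv y ^ 2
        * (-(cT μ * cT b) + cX y μ * cX y b + kX y * (cΩ y μ b - cX y μ * cX y b))
      - (cΩ y μ b - cX y μ * cX y b)) y := by
  have hX := hasPd_cX hy.1
  have hS : HasPd (fun y => 0 - y 0 * cT b + kX y * cX y b) _ y :=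
    ((HasPd.const 0).sub (hasPd_time.mul (HasPd.const (cT b)))).add ((hasPd_kX hy.1).mul (hX b))
  have hS' : (fun y => cS y b) = fun y => 0 - y 0 * cT b + kX y * cX y b := by
    ext y; rw [cS, zero_sub]
  rw [← hS'] at hS
  refine (((HasPd.const 2).mul ((hasPd_kexp hy).mul ((hasPd_kxInv hy).mul
    (hasPd_kxInv hy)))).mul hS |>.sub (hX b)).congr fun μ => ?_
  ring

theorem hasPd_kΓ (hy : y ∈ kruskalRegion) (a b c μ : Fin 4) : pd μ (fun y => kΓ y a b c) y
    = cT a * pd μ (fun y => kΓT y b c) y + (projΩ y a μ + vX y a * cX y μ) * kΓX y b c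
      + vX y a * pd μ (fun y => kΓX y b c) y
      + (-(projΩ y a μ * cX y b) - vX y a * cΩ y μ b) * kΓΩ y c
      + projΩ y a b * pd μ (fun y => kΓΩ y c) y
      + (-(projΩ y a μ * cX y c) - vX y a * cΩ y μ c) * kΓΩ y b
      + projΩ y a c * pd μ (fun y => kΓΩ y b) y := by
  have h := (((((HasPd.const (cT a)).mul (hasPd_kΓT hy b c)).add ((hasPd_vX' a).mul
    (hasPd_kΓX hy b c))).add ((hasPd_projΩ hy.1 a b).mul (hasPd_kΓΩ hy c))).add
    ((hasPd_projΩ hy.1 a c).mul (hasPd_kΓΩ hy b))).2 μ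
  refine h.trans ?_
  rw [(hasPd_kΓT hy b c).2, (hasPd_kΓX hy b c).2, (hasPd_kΓΩ hy b).2, (hasPd_kΓΩ hy c).2]
  ring

/-- In the contracted index the first factor is a combination of dT, dX, dΩ² and the angular
projector, and each of these has a known contraction with the connection. -/
theorem sum_kΓ_kΓ (hy : y ∈ kruskalRegion) (k l μ ν : Fin 4) :
    ∑ σ, kΓ y k μ σ * kΓ y σ ν l
      = cT k * (kL y * (y 0 * (cT μ * kΓT y ν l + cX y μ * kΓX y ν l)
          - kX y * (cT μ * kΓX y ν l + cX y μ * kΓT y ν l))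
          - 1 / 2 * (y 0 * kx y * (cΩ y μ ν * kΓΩ y l + cΩ y μ l * kΓΩ y ν)))
        + vX y k * (kL y * (y 0 * (cT μ * kΓX y ν l + cX y μ * kΓT y ν l)
          - kX y * (cT μ * kΓT y ν l + cX y μ * kΓX y ν l))
          + (1 - 1 / 2 * (kX y * kx y)) * (cΩ y μ ν * kΓΩ y l + cΩ y μ l * kΓΩ y ν)
          - cX y μ * kΓX y ν l)
        + projΩ y k μ * (2 * (kexp y * (kxInv y * kxInv y))
          * (-(y 0 * kΓT y ν l) + kX y * kΓX y ν l) - kΓX y ν l)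
        + (projΩ y k ν * kΓΩ y l + projΩ y k l * kΓΩ y ν) * kΓΩ y μ := by
  rw [← sum_cΩ_kΓ hy.1, ← sum_projΩ_kΓ hy.1, ← sum_cT_kΓ, ← sum_cX_kΓ hy.1]
  simp only [Fin.sum_univ_four]
  -- The second factor enters linearly, so its components may be opaque in the final polynomial
  -- identity.
  generalize kΓ y 0 ν l = z0
  generalize kΓ y 1 ν l = z1
  generalize kΓ y 2 ν l = z2
  generalize kΓ y 3 ν l = z3
  simp only [kΓ, kΓT, kΓX]
  generalize kΓΩ y μ = k'
  simp only [kΓΩ, cS]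
  ring

/-! ### The curvature -/

/-- The projector to the `(T, X)` plane. -/
def projTX (y : Eu 4) (a b : Fin 4) : ℝ := cT a * cT b + vX y a * cX y b

/-- `(m / r³) Φ (-dT² + dX²)`, where `Φ (-dT² + dX²)` is the `(T, X)` part of the metric. -/
def curvTX (y : Eu 4) (a b : Fin 4) : ℝ :=
  2 * kexp y * kxInv y ^ 4 * (cX y a * cX y b - cT a * cT b)

/-- `(m / r³) r² dΩ²`. -/
def curvΩ (y : Eu 4) (a b : Fin 4) : ℝ := 1 / 2 * kxInv y * cΩ y a b

/-- Half of the curvature tensor `R^k_{lμν}`, before antisymmetrization in `μ`, `ν`. -/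
def kruskalCurv (y : Eu 4) (k l μ ν : Fin 4) : ℝ :=
  projTX y k μ * (2 * curvTX y l ν - curvΩ y l ν) + projΩ y k μ * (2 * curvΩ y l ν - curvTX y l ν)

/-- All derivatives are polynomials in e^{-x}, x, x⁻¹, T, X and the components of the adapted forms.
The claim therefore holds as a polynomial identity modulo the two relations `h1` and `h2`. -/
theorem curvature_kΓ (hy : y ∈ kruskalRegion) (k l μ ν : Fin 4) :
    pd μ (fun y => kΓ y k ν l) y - pd ν (fun y => kΓ y k μ l) y
      + ∑ σ, (kΓ y k μ σ * kΓ y σ ν l - kΓ y k ν σ * kΓ y σ μ l)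
    = kruskalCurv y k l μ ν - kruskalCurv y k l ν μ := by
  rw [Finset.sum_sub_distrib, sum_kΓ_kΓ hy, sum_kΓ_kΓ hy, hasPd_kΓ hy, hasPd_kΓ hy]
  simp only [(hasPd_kΓT hy _ _).2, (hasPd_kΓX hy _ _).2, (hasPd_kΓΩ hy _).2]
  simp only [kruskalCurv, kΓT, kΓX, kΓΩ, kL, cS, projTX, curvTX, curvΩ]
  rw [cΩ_symm y ν μ, cΩ_symm y μ l, cΩ_symm y ν l]
  have h1 := kx_mul_kxInv hy
  have h2 := kexp_mul hy
  generalize kexp y = E at *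
  generalize kxInv y = i at *
  generalize kx y = x at *
  generalize kX y = X at *
  generalize y 0 = T at *
  generalize cΩ y μ ν = wmn
  generalize cΩ y l μ = wlm
  generalize cΩ y l ν = wln
  generalize cX y l = vl
  generalize cX y μ = vm
  generalize cX y ν = vn
  generalize cT l = ul
  generalize cT μ = um
  generalize cT ν = un
  generalize cT k = U
  generalize vX y k = V
  generalize projΩ y k μ = Pm
  generalize projΩ y k ν = Pn
  generalize projΩ y k l = Pl
  -- The cofactors of the two relations, each antisymmetrised in μ, ν: first that of e^{-x}(T² - X²)
  -- = 1 - x, then that of x · x⁻¹ = 1.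
  linear_combination
    ((Pm * (i * wln + 2 * E * (i ^ 4 + i ^ 3) * (ul * un - vl * vn))
        - 1 / 2 * (i + 1) * (V * vm + U * um) * wln
        + 2 * E * (2 * i ^ 4 + 2 * i ^ 3 + i ^ 2) * (U * um * vl * vn - V * vm * ul * un))
      - (Pn * (i * wlm + 2 * E * (i ^ 4 + i ^ 3) * (ul * um - vl * vm))
        - 1 / 2 * (i + 1) * (V * vn + U * un) * wlm
        + 2 * E * (2 * i ^ 4 + 2 * i ^ 3 + i ^ 2) * (U * un * vl * vm - V * vn * ul * um))) * h2
    + ((Pm * (E * (T ^ 2 - X ^ 2) * i * wln - wln + 2 * E * (i ^ 3 + i ^ 2) * (vl * vn - ul * un))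
        + V * (-(E * T * X * i * um * wln) + 3 / 2 * E * X ^ 2 * i * vm * wln
          - 1 / 2 * E * T ^ 2 * i * vm * wln + 1 / 2 * vm * wln
          + 1 / 2 * E * (X ^ 2 - T ^ 2) * vm * wln + (4 * i ^ 3 + 4 * i ^ 2 + 2 * i) * E * ul * un * vm)
        + U * (E * T * X * i * vm * wln + 1 / 2 * E * X ^ 2 * i * um * wln
          - 3 / 2 * E * T ^ 2 * i * um * wln + 1 / 2 * E * (X ^ 2 - T ^ 2) * um * wln
          + 1 / 2 * um * wln - (4 * i ^ 3 + 4 * i ^ 2 + 2 * i) * E * um * vl * vn))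
      - (Pn * (E * (T ^ 2 - X ^ 2) * i * wlm - wlm + 2 * E * (i ^ 3 + i ^ 2) * (vl * vm - ul * um))
        + V * (-(E * T * X * i * un * wlm) + 3 / 2 * E * X ^ 2 * i * vn * wlm
          - 1 / 2 * E * T ^ 2 * i * vn * wlm + 1 / 2 * vn * wlm
          + 1 / 2 * E * (X ^ 2 - T ^ 2) * vn * wlm + (4 * i ^ 3 + 4 * i ^ 2 + 2 * i) * E * ul * um * vn)
        + U * (E * T * X * i * vn * wlm + 1 / 2 * E * X ^ 2 * i * un * wlm
          - 3 / 2 * E * T ^ 2 * i * un * wlm + 1 / 2 * E * (X ^ 2 - T ^ 2) * un * wlm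
          + 1 / 2 * un * wlm - (4 * i ^ 3 + 4 * i ^ 2 + 2 * i) * E * un * vl * vm))) * h1

end

end

section

/-! ### The Kruskal metric is a vacuum metric -/

section smoothness

theorem contDiff_vX (a : Fin 4) : ContDiff ℝ ∞ fun y => vX y a := by
  by_cases h : a = 0
  · simp only [vX, h, if_true]
    exact contDiff_const
  · simp only [vX, h, if_false]
    exact (EuclideanSpace.proj a : Eu 4 →L[ℝ] ℝ).contDiff

theorem contDiff_normSq : ContDiff ℝ ∞ normSq := by
  unfold normSq
  exact ContDiff.sum fun i _ => (EuclideanSpace.proj i.succ : Eu 4 →L[ℝ] ℝ).contDiff.pow 2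

theorem contDiffOn_normSq_inv : ContDiffOn ℝ ∞ (fun y => (normSq y)⁻¹) kruskalRegion :=
  contDiff_normSq.contDiffOn.inv fun _ hy => hy.1

theorem contDiffOn_cX (a : Fin 4) : ContDiffOn ℝ ∞ (fun y => cX y a) kruskalRegion :=
  contDiffOn_normSq_inv.mul (contDiff_vX a).contDiffOn

theorem contDiffOn_cΩ (a b : Fin 4) : ContDiffOn ℝ ∞ (fun y => cΩ y a b) kruskalRegion :=
  (contDiffOn_normSq_inv.mul contDiffOn_const).sub ((contDiffOn_cX a).mul (contDiffOn_cX b))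

theorem contDiffOn_kx : ContDiffOn ℝ ∞ kx kruskalRegion := by
  have hn : ∀ y ∈ kruskalRegion, √(normSq y) ≠ 0 := fun y hy =>
    (Real.sqrt_pos.2 (lt_of_le_of_ne (Finset.sum_nonneg fun i _ => sq_nonneg _)
      (Ne.symm hy.1))).ne'
  have hX : ContDiffOn ℝ ∞ kX kruskalRegion :=
    (contDiff_normSq.contDiffOn.sqrt fun y hy => hy.1).log hn
  have hT : ContDiff ℝ ∞ fun y : Eu 4 => y 0 := (EuclideanSpace.proj 0 : Eu 4 →L[ℝ] ℝ).contDiff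
  intro y hy
  exact (contDiffAt_radiusSol hy.2).comp_contDiffWithinAt y
    ((hT.contDiffOn.pow 2).sub (hX.pow 2) y hy)

theorem contDiffOn_kruskalMatrix (m : ℝ) (a b : Fin 4) :
    ContDiffOn ℝ ∞ (fun y => kruskalMatrix m y a b) kruskalRegion := by
  have hi : ContDiffOn ℝ ∞ kxInv kruskalRegion := contDiffOn_kx.inv fun y hy => (kx_pos hy).ne'
  have he : ContDiffOn ℝ ∞ kexp kruskalRegion := contDiffOn_kx.neg.exp
  exact (contDiffOn_const.mul ((he.mul hi).mul
    (((contDiffOn_cX a).mul (contDiffOn_cX b)).sub contDiffOn_const))).add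
    (contDiffOn_const.mul ((contDiffOn_kx.mul contDiffOn_kx).mul (contDiffOn_cΩ a b)))

end smoothness

section

variable {y : Eu 4} {m : ℝ}

/-- The conformal factor `Φ = (32 m³ / r) e^{-r/2m}`. -/
def kΦ (m : ℝ) (y : Eu 4) : ℝ := 16 * m ^ 2 * (kexp y * kxInv y)

theorem kΦ_pos (hm : 0 < m) (hy : y ∈ kruskalRegion) : 0 < kΦ m y := by
  have h1 : 0 < kexp y := Real.exp_pos _
  have h2 : 0 < kxInv y := inv_pos.2 (kx_pos hy)
  unfold kΦ
  positivity

theorem kruskalMatrix_apply (a b : Fin 4) : kruskalMatrix m y a b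
    = kΦ m y * (cX y a * cX y b - cT a * cT b) + 4 * m ^ 2 * kx y ^ 2 * cΩ y a b := by
  simp only [kruskalMatrix, kΦ, Matrix.of_apply]; ring

theorem kruskalMatrix_symm (a b : Fin 4) : kruskalMatrix m y a b = kruskalMatrix m y b a := by
  rw [kruskalMatrix_apply, kruskalMatrix_apply, cΩ_symm y a b]
  ring

theorem sum_cT (f : Fin 4 → ℝ) : ∑ b, cT b * f b = f 0 := by simp [cT]

theorem mulVec_cT : (kruskalMatrix m y).mulVec cT = fun a => -kΦ m y * cT a := by
  ext a
  have h1 : cΩ y a 0 = 0 := by fin_cases a <;> simp [cΩ, spaceProj, cX, vX]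
  have h2 : cX y 0 = 0 := by simp [cX, vX]
  rw [Matrix.mulVec, dotProduct_comm]
  refine (sum_cT _).trans ?_
  rw [kruskalMatrix_apply, h1, h2, show cT 0 = 1 by simp [cT]]
  ring

theorem mulVec_vX (hy : normSq y ≠ 0) :
    (kruskalMatrix m y).mulVec (vX y) = fun a => kΦ m y * cX y a := by
  ext a
  have h : (kruskalMatrix m y).mulVec (vX y) a = kΦ m y * (cX y a * ∑ b, cX y b * vX y b
      - cT a * ∑ b, cT b * vX y b) + 4 * m ^ 2 * kx y ^ 2 * ∑ b, cΩ y a b * vX y b := by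
    simp only [Matrix.mulVec, dotProduct, Fin.sum_univ_four, kruskalMatrix_apply]; ring
  rw [h, sum_vX hy, sum_cΩ_vX hy, sum_cT]
  simp [vX]

theorem sum_kruskalMatrix_projΩ (hy : normSq y ≠ 0) (a b : Fin 4) :
    ∑ c, kruskalMatrix m y a c * projΩ y c b = 4 * m ^ 2 * kx y ^ 2 * cΩ y a b := by
  have h : ∑ c, kruskalMatrix m y a c * projΩ y c b
      = kΦ m y * (cX y a * ∑ c, cX y c * projΩ y c b - cT a * ∑ c, cT c * projΩ y c b)
        + 4 * m ^ 2 * kx y ^ 2 * ∑ c, cΩ y a c * projΩ y c b := by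
    simp only [Fin.sum_univ_four, kruskalMatrix_apply]; ring
  rw [h, sum_cX_projΩ hy, sum_cΩ_projΩ hy]
  simp [cT, projΩ, spaceProj, vX]

/-- The timelike vector is ∂_T, whose complement is v 0 = 0. There the form is Φ a² + r² (|v|²/|y|²
- a²) with a = dX(v); the second term is nonnegative by Cauchy–Schwarz, and is positive when a = 0.
-/
theorem isLorentzMatrix_kruskalMatrix (hm : 0 < m) (hy : y ∈ kruskalRegion) :
    IsLorentzMatrix (kruskalMatrix m y) := by
  have hΦ := kΦ_pos hm hy
  have hx := kx_pos hy
  have hs : 0 < normSq y :=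
    lt_of_le_of_ne (Finset.sum_nonneg fun i _ => sq_nonneg _) (Ne.symm hy.1)
  have hsymm : ∀ i j, kruskalMatrix m y i j = kruskalMatrix m y j i := kruskalMatrix_symm
  refine ⟨hsymm, cT, ?_, fun v h0 hv => ?_⟩
  · rw [bil, mulVec_cT]
    simp [dotProduct, cT, hΦ]
  · have hv0 : v 0 = 0 := by
      rw [bil, Matrix.dotProduct_mulVec, ← Matrix.mulVec_transpose,
        show (kruskalMatrix m y).transpose = kruskalMatrix m y from
          Matrix.ext fun i j => hsymm j i, mulVec_cT] at h0
      simpa [dotProduct, cT, hΦ.ne'] using h0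
    set a := ∑ i, cX y i * v i with ha
    set N := v 1 ^ 2 + v 2 ^ 2 + v 3 ^ 2 with hN
    have hNpos : 0 < N := by
      by_contra hle
      have h1 := sq_nonneg (v 1)
      have h2 := sq_nonneg (v 2)
      have h3 := sq_nonneg (v 3)
      have e1 : v 1 = 0 := pow_eq_zero_iff two_ne_zero |>.1 (by linarith)
      have e2 : v 2 = 0 := pow_eq_zero_iff two_ne_zero |>.1 (by linarith)
      have e3 : v 3 = 0 := pow_eq_zero_iff two_ne_zero |>.1 (by linarith)
      exact hv (by ext i; fin_cases i <;> simp [hv0, e1, e2, e3])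
    have ha' : normSq y * a = y 1 * v 1 + y 2 * v 2 + y 3 * v 3 := by
      simp only [ha, Fin.sum_univ_four, cX, vX]
      simp
      field_simp
    have hb : bil (kruskalMatrix m y) v v
        = kΦ m y * a ^ 2 + 4 * m ^ 2 * kx y ^ 2 * ((normSq y)⁻¹ * N - a ^ 2) := by
      simp only [bil, dotProduct, Matrix.mulVec, Fin.sum_univ_four, kruskalMatrix_apply, cΩ, ha, hN,
        hv0]
      simp [cT, spaceProj]
      ring
    -- Lagrange's identity writes |y|²|v|² - (y·v)² as a sum of three squares.
    have hcs : 0 ≤ (normSq y)⁻¹ * N - a ^ 2 := by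
      have h1 : (normSq y)⁻¹ * N - a ^ 2
          = ((normSq y)⁻¹) ^ 2 * (normSq y * N - (normSq y * a) ^ 2) := by
        field_simp
      rw [h1, ha', normSq_eq]
      refine mul_nonneg (sq_nonneg _) ?_
      nlinarith [sq_nonneg (y 1 * v 2 - y 2 * v 1), sq_nonneg (y 1 * v 3 - y 3 * v 1),
        sq_nonneg (y 2 * v 3 - y 3 * v 2)]
    rw [hb]
    by_cases h : a = 0
    · rw [h]
      have : 0 < 4 * m ^ 2 * kx y ^ 2 * ((normSq y)⁻¹ * N) := by positivity
      simpa using this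
    · have h1 : 0 < kΦ m y * a ^ 2 := by positivity
      have h2 : 0 ≤ 4 * m ^ 2 * kx y ^ 2 * ((normSq y)⁻¹ * N - a ^ 2) := by positivity
      linarith

theorem metricOn_kruskalMatrix (hm : 0 < m) : MetricOn (kruskalMatrix m) kruskalRegion where
  isOpen := kruskalRegion.isOpen
  smooth := contDiffOn_kruskalMatrix m
  symm := fun _ _ => kruskalMatrix_symm
  det_ne := fun _ hy => (isLorentzMatrix_kruskalMatrix hm hy).det_ne

theorem christoffel_kruskalMatrix (hm : 0 < m) (hy : y ∈ kruskalRegion) (a b c : Fin 4) :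
    christoffel (kruskalMatrix m) a b c y = kΓ y a b c := by
  have hG := metricOn_kruskalMatrix hm
  rw [← hG.sum_raise_lower hy (fun l => kΓ y l b c) a]
  simp_rw [sum_kruskalMatrix_kΓ m hy]
  rw [christoffel, Finset.mul_sum]
  refine Finset.sum_congr rfl fun k _ => by ring

theorem riemannUp_kruskalMatrix (hm : 0 < m) (hy : y ∈ kruskalRegion) (k l μ ν : Fin 4) :
    riemannUp (kruskalMatrix m) k l μ ν y = kruskalCurv y k l μ ν - kruskalCurv y k l ν μ := by
  rw [← curvature_kΓ hy, riemannUp]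
  have h := fun a b c d => pd_congr (f := christoffel (kruskalMatrix m) a b c)
    kruskalRegion.isOpen (fun y hy => christoffel_kruskalMatrix hm hy a b c) hy d
  rw [h, h]
  simp_rw [christoffel_kruskalMatrix hm hy]

/-- The projectors to the (T, X) plane and to the sphere both have trace two. With the coefficients
of `kruskalCurv`, the traces over `k` and the second or the first form index coincide, so their
difference vanishes. -/
theorem ricci_kruskalMatrix (hm : 0 < m) (hy : y ∈ kruskalRegion) (l ν : Fin 4) :
    ricci (kruskalMatrix m) l ν y = 0 := by
  have h1 : ∑ k, kruskalCurv y k l k ν = 2 * (curvTX y l ν + curvΩ y l ν) := by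
    have h : ∑ k, kruskalCurv y k l k ν
        = (∑ k, cT k * cT k + ∑ k, cX y k * vX y k) * (2 * curvTX y l ν - curvΩ y l ν)
          + (∑ k, spaceProj k k - ∑ k, cX y k * vX y k) * (2 * curvΩ y l ν - curvTX y l ν) := by
      simp only [Fin.sum_univ_four, kruskalCurv, projTX, projΩ]; ring
    rw [h, sum_vX hy.1]
    simp [cT, spaceProj, Fin.sum_univ_four]
    ring
  have h2 : ∑ k, kruskalCurv y k l ν k = 2 * (curvTX y l ν + curvΩ y l ν) := by
    have h : ∑ k, kruskalCurv y k l ν k = 2 * kexp y * kxInv y ^ 4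
        * (cX y l * (2 * (cT ν * ∑ k, cT k * cX y k + cX y ν * ∑ k, cX y k * vX y k)
              - ∑ k, cX y k * projΩ y k ν)
          - cT l * (2 * (cT ν * ∑ k, cT k * cT k + cX y ν * ∑ k, cT k * vX y k)
              - ∑ k, cT k * projΩ y k ν))
        + 1 / 2 * kxInv y * (2 * ∑ k, cΩ y l k * projΩ y k ν
          - (cT ν * ∑ k, cT k * cΩ y l k + cX y ν * ∑ k, cΩ y l k * vX y k)) := by
      simp only [Fin.sum_univ_four, kruskalCurv, projTX, curvTX, curvΩ]; ring
    have h0 : cΩ y l 0 = 0 := by fin_cases l <;> simp [cΩ, spaceProj, cX, vX]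
    rw [h, sum_vX hy.1, sum_cX_projΩ hy.1, sum_cΩ_projΩ hy.1, sum_cΩ_vX hy.1,
      sum_cT, sum_cT, sum_cT, sum_cT, sum_cT, h0, show vX y 0 = 0 by simp [vX],
      show cX y 0 = 0 by simp [cX, vX], show cT 0 = 1 by simp [cT],
      show projΩ y 0 ν = 0 by simp [projΩ, spaceProj, vX], curvTX, curvΩ]
    ring
  rw [ricci]
  simp_rw [riemannUp_kruskalMatrix hm hy]
  rw [Finset.sum_sub_distrib, h1, h2, sub_self]

end

end

section

/-! ### The curvature of the Kruskal metric in an adapted frame -/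

theorem ev4_smul (c : ℝ) (T : (Fin 4 → Fin 4) → ℝ) (x y z w : Fin 4 → ℝ) :
    ev4 (fun α => c * T α) x y z w = c * ev4 T x y z w := by
  simp_rw [ev4, Finset.mul_sum]
  exact sum4_congr fun i j k l => by ring

/-- A tensor is determined by its components in a frame. -/
theorem IsFrame.eq_of_frameComp {g A : Matrix (Fin 4) (Fin 4) ℝ} (h : IsFrame g A)
    {T T' : (Fin 4 → Fin 4) → ℝ} (hT : frameComp A T = frameComp A T') : T = T' := by
  have hA : ∀ f : Fin 4 → ℝ, (∀ a, ∑ i, f i * A i a = 0) → ∀ i, f i = 0 := by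
    intro f hf i
    have h1 : Matrix.vecMul f A = 0 := funext hf
    have h2 : Matrix.vecMul (Matrix.vecMul f A) A⁻¹ = f := by
      rw [Matrix.vecMul_vecMul, Matrix.mul_nonsing_inv _ h.isUnit_det, Matrix.vecMul_one]
    rw [h1, Matrix.zero_vecMul] at h2
    rw [← h2]
    rfl
  have h0 : ∀ a b c d, ev4 (fun α => T α - T' α) (fun k => A k a) (fun k => A k b)
      (fun k => A k c) (fun k => A k d) = 0 := by
    intro a b c d
    have h1 : frameComp A T a b c d = frameComp A T' a b c d := by rw [hT]
    rw [ev4_sub]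
    exact sub_eq_zero.2 h1
  -- The invertible frame is stripped from one slot at a time.
  have h1 : ∀ i b c d, ∑ j, ∑ k, ∑ l, (T ![i, j, k, l] - T' ![i, j, k, l]) * A j b * A k c * A l d
      = 0 := by
    intro i b c d
    refine hA (fun i => ∑ j, ∑ k, ∑ l,
      (T ![i, j, k, l] - T' ![i, j, k, l]) * A j b * A k c * A l d) (fun a => ?_) i
    rw [← h0 a b c d]
    simp_rw [ev4, Finset.sum_mul]
    exact sum4_congr fun i j k l => by ring
  have h2 : ∀ i j c d, ∑ k, ∑ l, (T ![i, j, k, l] - T' ![i, j, k, l]) * A k c * A l d = 0 := by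
    intro i j c d
    refine hA (fun j => ∑ k, ∑ l,
      (T ![i, j, k, l] - T' ![i, j, k, l]) * A k c * A l d) (fun b => ?_) j
    rw [← h1 i b c d]
    simp_rw [Finset.sum_mul]
    refine Finset.sum_congr rfl fun j _ => Finset.sum_congr rfl fun k _ =>
      Finset.sum_congr rfl fun l _ => by ring
  have h3 : ∀ i j k d, ∑ l, (T ![i, j, k, l] - T' ![i, j, k, l]) * A l d = 0 := by
    intro i j k d
    refine hA (fun k => ∑ l, (T ![i, j, k, l] - T' ![i, j, k, l]) * A l d) (fun c => ?_) k
    rw [← h2 i j c d]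
    simp_rw [Finset.sum_mul]
    refine Finset.sum_congr rfl fun k _ => Finset.sum_congr rfl fun l _ => by ring
  funext α
  have h4 := hA (fun l => T ![α 0, α 1, α 2, l] - T' ![α 0, α 1, α 2, l])
    (fun d => h3 _ _ _ d) (α 3)
  rw [vec4_eta] at h4
  linarith

/-- The `(T, X)` part of the metric in an adapted frame. -/
def frameTX (a b : Fin 4) : ℤ := if a = b then ![-1, 1, 0, 0] a else 0

/-- The spherical part of the metric in an adapted frame. -/
def frameΩ (a b : Fin 4) : ℤ := if a = b then ![0, 0, 1, 1] a else 0

/-- The curvature of the Kruskal metric in an adapted frame, in units of `m / r³`. -/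
def frameCurv (a b c d : Fin 4) : ℤ :=
  (frameTX a c * (2 * frameTX b d - frameΩ b d) + frameΩ a c * (2 * frameΩ b d - frameTX b d))
  - (frameTX a d * (2 * frameTX b c - frameΩ b c) + frameΩ a d * (2 * frameΩ b c - frameTX b c))

/-- `frameQuad` for `frameCurv`. -/
def frameCurvQuad (a b c d : Fin 4) : ℤ :=
  -∑ i, ∑ j, ![-1, 1, 1, 1] i * ![-1, 1, 1, 1] j * (frameCurv j a i c * frameCurv j b i d
    + frameCurv j b i c * frameCurv a j i d + frameCurv j d i c * frameCurv a b i j)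

/-- All entries are integers, so this is a finite check over the index values. It is the origin of
the factor -6. -/
theorem frameCurvQuad_eq : ∀ a b c d : Fin 4,
    frameCurvQuad a b c d - frameCurvQuad a b d c = -6 * frameCurv a b c d := by
  decide +kernel

/-- The quadratic source is homogeneous of degree two. One power of the scale k = m/r³ stays with
the tensor, and the other joins the eigenvalue. -/
theorem frameQuad_frameCurv (k : ℝ) (a b c d : Fin 4) :
    frameQuad (fun a b c d => k * frameCurv a b c d) a b c d
      - frameQuad (fun a b c d => k * frameCurv a b c d) a b d c
      = -6 * k * (k * frameCurv a b c d) := by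
  have h : ∀ a b c d, frameQuad (fun a b c d => k * frameCurv a b c d) a b c d
      = k ^ 2 * (frameCurvQuad a b c d : ℝ) := by
    intro a b c d
    have hs : ∀ i : Fin 4, sgn i = ((![-1, 1, 1, 1] i : ℤ) : ℝ) := by
      intro i; fin_cases i <;> simp [sgn]
    simp only [frameQuad, frameCurvQuad, Int.cast_neg, Int.cast_sum, Int.cast_mul, Int.cast_add,
      mul_neg, Finset.mul_sum, hs]
    rw [neg_inj]
    refine Finset.sum_congr rfl fun i _ => Finset.sum_congr rfl fun j _ => by ring
  have h' : (frameCurvQuad a b c d : ℝ) - frameCurvQuad a b d c = -6 * frameCurv a b c d := by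
    exact_mod_cast frameCurvQuad_eq a b c d
  rw [h, h]
  linear_combination k ^ 2 * h'

/-- The value of the bilinear form with components `p`. -/
def pair (p : Fin 4 → Fin 4 → ℝ) (x z : Fin 4 → ℝ) : ℝ := ∑ i, ∑ k, p i k * x i * z k

theorem ev4_add (T T' : (Fin 4 → Fin 4) → ℝ) (x y z w : Fin 4 → ℝ) :
    ev4 (fun α => T α + T' α) x y z w = ev4 T x y z w + ev4 T' x y z w := by
  simp only [ev4, add_mul, Finset.sum_add_distrib]

theorem pair_sub (c : ℝ) (p q : Fin 4 → Fin 4 → ℝ) (x z : Fin 4 → ℝ) :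
    pair (fun a b => c * p a b - q a b) x z = c * pair p x z - pair q x z := by
  simp_rw [pair, Finset.mul_sum, ← Finset.sum_sub_distrib]
  refine Finset.sum_congr rfl fun i _ => Finset.sum_congr rfl fun j _ => by ring

theorem ev4_mul (p q : Fin 4 → Fin 4 → ℝ) (x y z w : Fin 4 → ℝ) :
    ev4 (fun α => p (α 0) (α 2) * q (α 1) (α 3)) x y z w = pair p x z * pair q y w := by
  have h : pair p x z * pair q y w
      = ∑ i, ∑ k, ∑ j, ∑ l, p i k * q j l * x i * y j * z k * w l := by
    simp_rw [pair, Finset.sum_mul, Finset.mul_sum]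
    exact sum4_congr fun i j k l => by ring
  rw [h, sum4_swap23]
  rfl

theorem ev4_mul' (p q : Fin 4 → Fin 4 → ℝ) (x y z w : Fin 4 → ℝ) :
    ev4 (fun α => p (α 0) (α 3) * q (α 1) (α 2)) x y z w = pair p x w * pair q y z := by
  rw [← ev4_mul p q x y w z]
  unfold ev4
  rw [sum4_swap34]
  refine sum4_congr fun i j k l => ?_
  change p i k * q j l * _ * _ * _ * _ = p i k * q j l * _ * _ * _ * _
  ring

section

variable {y : Eu 4} {m : ℝ}

/-- The `(T, X)` part of the Kruskal metric. -/
def metricTX (m : ℝ) (y : Eu 4) (a b : Fin 4) : ℝ := kΦ m y * (cX y a * cX y b - cT a * cT b)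

/-- The spherical part of the Kruskal metric. -/
def metricΩ (m : ℝ) (y : Eu 4) (a b : Fin 4) : ℝ := 4 * m ^ 2 * kx y ^ 2 * cΩ y a b

/-- `m / r³`. -/
def kMass (m : ℝ) (y : Eu 4) : ℝ := kxInv y ^ 3 / (8 * m ^ 2)

theorem curvTX_eq (hm : 0 < m) (a b : Fin 4) : curvTX y a b = kMass m y * metricTX m y a b := by
  simp only [curvTX, kMass, metricTX, kΦ]
  field_simp
  ring

theorem curvΩ_eq (hm : 0 < m) (hy : y ∈ kruskalRegion) (a b : Fin 4) :
    curvΩ y a b = kMass m y * metricΩ m y a b := by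
  have hx := kx_pos hy
  simp only [curvΩ, kMass, metricΩ, kxInv]
  field_simp
  ring

/-- Lowering an index turns the two projectors into the two blocks of the metric. The curvature is
then m/r³ times products of these blocks alone, which makes its frame components constants times
m/r³. -/
theorem riemann_kruskalMatrix (hm : 0 < m) (hy : y ∈ kruskalRegion) (k l μ ν : Fin 4) :
    riemann (kruskalMatrix m) k l μ ν y = kMass m y *
      ((metricTX m y k μ * (2 * metricTX m y l ν - metricΩ m y l ν)
        + metricΩ m y k μ * (2 * metricΩ m y l ν - metricTX m y l ν))
      - (metricTX m y k ν * (2 * metricTX m y l μ - metricΩ m y l μ)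
        + metricΩ m y k ν * (2 * metricΩ m y l μ - metricTX m y l μ))) := by
  have hT : ∀ b, ∑ σ, kruskalMatrix m y k σ * projTX y σ b = metricTX m y k b := by
    intro b
    have h : ∑ σ, kruskalMatrix m y k σ * projTX y σ b = (kruskalMatrix m y).mulVec cT k * cT b
        + (kruskalMatrix m y).mulVec (vX y) k * cX y b := by
      simp only [Matrix.mulVec, dotProduct, projTX, Fin.sum_univ_four]; ring
    rw [h, mulVec_cT, mulVec_vX hy.1, metricTX]
    ring
  have hΩ : ∀ b, ∑ σ, kruskalMatrix m y k σ * projΩ y σ b = metricΩ m y k b :=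
    fun b => sum_kruskalMatrix_projΩ hy.1 k b
  have h : ∀ a b, ∑ σ, kruskalMatrix m y k σ * kruskalCurv y σ l a b
      = metricTX m y k a * (2 * curvTX y l b - curvΩ y l b)
        + metricΩ m y k a * (2 * curvΩ y l b - curvTX y l b) := by
    intro a b
    rw [← hT, ← hΩ]
    simp only [kruskalCurv, Fin.sum_univ_four]
    ring
  rw [riemann]
  simp_rw [riemannUp_kruskalMatrix hm hy, mul_sub]
  rw [Finset.sum_sub_distrib, h, h]
  simp only [curvTX_eq hm, curvΩ_eq hm hy]
  ring

/-- The first two legs are the normalised ∂_T and ∂_X. The other two come from orthonormal extension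
and need not be known: orthogonality to the first two already determines both metric blocks. -/
theorem exists_kruskalFrame (hm : 0 < m) (hy : y ∈ kruskalRegion) :
    ∃ A, IsFrame (kruskalMatrix m y) A ∧
      (∀ a b, pair (metricTX m y) (fun k => A k a) (fun k => A k b) = frameTX a b) ∧
      ∀ a b, pair (metricΩ m y) (fun k => A k a) (fun k => A k b) = frameΩ a b := by
  have hΦ := kΦ_pos hm hy
  have hL := isLorentzMatrix_kruskalMatrix hm hy
  set G := kruskalMatrix m y with hGdef
  -- k = Φ^{-1/2} normalises both ∂_T and ∂_X, whose squares are -Φ and Φ.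
  obtain ⟨k, hk, hk2⟩ : ∃ k : ℝ, k ≠ 0 ∧ k ^ 2 * kΦ m y = 1 := by
    refine ⟨(√(kΦ m y))⁻¹, inv_ne_zero (Real.sqrt_pos.2 hΦ).ne', ?_⟩
    rw [inv_pow, Real.sq_sqrt hΦ.le, inv_mul_cancel₀ hΦ.ne']
  have hbT : ∀ x : Fin 4 → ℝ, bil G x cT = -kΦ m y * ∑ i, cT i * x i := by
    intro x
    rw [bil, mulVec_cT]
    simp only [dotProduct, Fin.sum_univ_four]; ring
  have hbX : ∀ x : Fin 4 → ℝ, bil G x (vX y) = kΦ m y * ∑ i, cX y i * x i := by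
    intro x
    rw [bil, mulVec_vX hy.1]
    simp only [dotProduct, Fin.sum_univ_four]; ring
  have h00 : bil G cT cT = -kΦ m y := by rw [hbT, sum_cT]; simp [cT]
  have h10 : bil G (vX y) cT = 0 := by rw [hbT, sum_cT]; simp [vX]
  have h01 : bil G cT (vX y) = 0 := by rw [hL.bil_comm, h10]
  have h11 : bil G (vX y) (vX y) = kΦ m y := by rw [hbX, sum_vX hy.1, mul_one]
  obtain ⟨A, hA, hAv⟩ := hL.exists_frame (fun i => if i = 0 then k • cT else k • vX y) {0, 1}
    (by simp) (by
      rintro i (rfl | rfl) j (rfl | rfl) <;>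
        simp only [bil_smul_right, hL.bil_smul_left, if_true, one_ne_zero, if_false,
          Matrix.diagonal_apply, h00, h01, h10, h11, sgn] <;> simp <;> linarith)
  have hA0 : (fun i => A i 0) = k • cT := funext fun i => by rw [hAv 0 (by simp)]; rfl
  have hA1 : (fun i => A i 1) = k • vX y := funext fun i => by rw [hAv 1 (by simp)]; rfl
  have hAb : ∀ a b, bil G (fun i => A i a) (fun i => A i b) = Matrix.diagonal sgn a b := by
    intro a b
    rw [← hA, Matrix.mul_assoc]
    rfl
  -- Up to scale, dT and dX are the metric duals of the first two legs, so their values on every leg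
  -- follow from orthonormality.
  have hT : ∀ a, ∑ i, cT i * A i a = -k * Matrix.diagonal sgn a 0 := by
    intro a
    have h := hAb a 0
    rw [hA0, bil_smul_right, hbT] at h
    rw [← h]
    linear_combination -(∑ i, cT i * A i a) * hk2
  have hX : ∀ a, ∑ i, cX y i * A i a = k * Matrix.diagonal sgn a 1 := by
    intro a
    have h := hAb a 1
    rw [hA1, bil_smul_right, hbX] at h
    rw [← h]
    linear_combination -(∑ i, cX y i * A i a) * hk2
  have hTX : ∀ a b, pair (metricTX m y) (fun k => A k a) (fun k => A k b) = frameTX a b := by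
    intro a b
    have h : pair (metricTX m y) (fun k => A k a) (fun k => A k b) = kΦ m y *
        ((∑ i, cX y i * A i a) * (∑ i, cX y i * A i b)
          - (∑ i, cT i * A i a) * (∑ i, cT i * A i b)) := by
      simp only [pair, metricTX, Fin.sum_univ_four]; ring
    have h' : (frameTX a b : ℝ) = Matrix.diagonal sgn a 1 * Matrix.diagonal sgn b 1
        - Matrix.diagonal sgn a 0 * Matrix.diagonal sgn b 0 := by
      fin_cases a <;> fin_cases b <;> simp [frameTX, sgn]
    rw [h, hT, hT, hX, hX, h']
    linear_combination (Matrix.diagonal sgn a 1 * Matrix.diagonal sgn b 1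
        - Matrix.diagonal sgn a 0 * Matrix.diagonal sgn b 0) * hk2
  refine ⟨A, hA, hTX, fun a b => ?_⟩
  have h : pair (metricΩ m y) (fun k => A k a) (fun k => A k b)
      = bil G (fun k => A k a) (fun k => A k b)
        - pair (metricTX m y) (fun k => A k a) (fun k => A k b) := by
    simp only [pair, metricTX, metricΩ, bil, Matrix.mulVec, dotProduct, hGdef, kruskalMatrix_apply,
      Fin.sum_univ_four]
    ring
  rw [h, hAb, hTX]
  fin_cases a <;> fin_cases b <;> simp [frameTX, frameΩ, sgn]

/-- `□C = -(6m/r³) C` for the Kruskal metric. -/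
theorem boxQuad_kruskalMatrix (hm : 0 < m) (hy : y ∈ kruskalRegion) :
    boxQuad (kruskalMatrix m y) (weyl (kruskalMatrix m) y)
      = fun α => -6 * kMass m y * weyl (kruskalMatrix m) y α := by
  obtain ⟨A, hA, hT, hΩ⟩ := exists_kruskalFrame hm hy
  have hw : weyl (kruskalMatrix m) y = riemannT (kruskalMatrix m) y :=
    funext fun α => MetricOn.weyl_eq_riemannT (fun y hy => ricci_kruskalMatrix hm hy) hy α
  have hR : frameComp A (weyl (kruskalMatrix m) y)
      = fun a b c d => kMass m y * frameCurv a b c d := by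
    funext a b c d
    let p : Fin 4 → Fin 4 → ℝ := fun a b => 2 * metricTX m y a b - metricΩ m y a b
    let q : Fin 4 → Fin 4 → ℝ := fun a b => 2 * metricΩ m y a b - metricTX m y a b
    have h1 : weyl (kruskalMatrix m) y = fun α => kMass m y *
        ((metricTX m y (α 0) (α 2) * p (α 1) (α 3) + metricΩ m y (α 0) (α 2) * q (α 1) (α 3))
        - (metricTX m y (α 0) (α 3) * p (α 1) (α 2) + metricΩ m y (α 0) (α 3) * q (α 1) (α 2))) := by
      rw [hw]
      exact funext fun α => riemann_kruskalMatrix hm hy _ _ _ _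
    rw [h1, frameComp, ev4_smul, ev4_sub, ev4_add, ev4_add, ev4_mul, ev4_mul, ev4_mul', ev4_mul']
    simp only [p, q, pair_sub, hT, hΩ]
    simp only [frameCurv]
    push_cast
    ring
  refine hA.eq_of_frameComp ?_
  funext a b c d
  rw [hA.frameComp_boxQuad, hR, frameQuad_frameCurv]
  refine Eq.symm ((ev4_smul _ _ _ _ _ _).trans ?_)
  exact congrArg _ (congrFun (congrFun (congrFun (congrFun hR a) b) c) d)

end

end

section

/-! ### The Kruskal spacetime as a manifold -/

theorem tens_apply (a b : Eu 4 →L[ℝ] ℝ) (v w : Eu 4) : tens a b v w = a v * b w := by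
  simp [tens]

theorem dX_apply (y : Eu 4) (a : Fin 4) : dX y (ev a) = cX y a := by
  fin_cases a <;> simp [dX, cX, vX, Fin.sum_univ_three, dx]

theorem dOmega_apply (y : Eu 4) (a b : Fin 4) : dOmega y (ev a) (ev b) = cΩ y a b := by
  have h : dOmega y (ev a) (ev b) = (normSq y)⁻¹ * (∑ i : Fin 3, dx i.succ (ev a) * dx i.succ (ev b))
      - dX y (ev a) * dX y (ev b) := by
    simp only [dOmega, sub_apply, smul_apply, sum_apply, tens_apply, smul_eq_mul]
  rw [h, dX_apply, dX_apply, cΩ]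
  congr 2
  fin_cases a <;> fin_cases b <;> simp [spaceProj, Fin.sum_univ_three, dx]

theorem kruskalForm_apply {m : ℝ} (hm : 0 < m) {y : Eu 4} (hy : y ∈ kruskalRegion) (a b : Fin 4) :
    kruskalForm m y (ev a) (ev b) = kruskalMatrix m y a b := by
  have hr : radius m y = 2 * m * kx y := radius_eq m hy.2
  have hx := kx_pos hy
  have h0 : ∀ a, dx 0 (ev a) = cT a := by
    intro a; fin_cases a <;> simp [cT, dx]
  have h : kruskalForm m y (ev a) (ev b)
      = (32 * m ^ 3 / radius m y * Real.exp (-(radius m y) / (2 * m)))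
        * (-(dx 0 (ev a) * dx 0 (ev b)) + dX y (ev a) * dX y (ev b))
      + radius m y ^ 2 * dOmega y (ev a) (ev b) := by
    simp only [kruskalForm, add_apply, neg_apply, smul_apply, tens_apply, smul_eq_mul]
  rw [h, h0, h0, dX_apply, dX_apply, dOmega_apply, hr, kruskalMatrix_apply, kΦ, kexp, kxInv,
    show -(2 * m * kx y) / (2 * m) = -kx y by field_simp]
  field_simp
  ring

theorem extChartAt_kruskalRegion (p q : kruskalRegion) : extChartAt (𝓡 4) p q = q := by
  simp [extChartAt, TopologicalSpace.Opens.chartAt_eq]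
  rfl

theorem extChartAt_target_kruskalRegion (p : kruskalRegion) :
    (extChartAt (𝓡 4) p).target = kruskalRegion := by
  ext y
  constructor
  · intro hy
    rw [← (extChartAt (𝓡 4) p).right_inv hy, extChartAt_kruskalRegion]
    exact Subtype.property _
  · intro hy
    have h := (extChartAt (𝓡 4) p).map_source (x := ⟨y, hy⟩) (by
      simp [extChartAt, TopologicalSpace.Opens.chartAt_eq]
      exact Set.mem_univ y)
    rwa [extChartAt_kruskalRegion] at h

theorem extChartAt_symm_kruskalRegion (p : kruskalRegion) {y : Eu 4} (hy : y ∈ kruskalRegion) :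
    (((extChartAt (𝓡 4) p).symm y : kruskalRegion) : Eu 4) = y := by
  rw [← extChartAt_kruskalRegion p]
  exact (extChartAt (𝓡 4) p).right_inv (by rwa [extChartAt_target_kruskalRegion])

theorem mfderiv_extChartAt_symm_kruskalRegion (p : kruskalRegion) {y : Eu 4}
    (hy : y ∈ kruskalRegion) (v : Eu 4) :
    mfderiv (𝓡 4) (𝓡 4) (extChartAt (𝓡 4) p).symm y v = v := by
  have hd : MDifferentiableAt (𝓡 4) (𝓡 4) (extChartAt (𝓡 4) p).symm y := by
    refine ((contMDiffOn_extChartAt_symm (I := 𝓡 4) (n := ∞) p).contMDiffAt ?_).mdifferentiableAt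
      (by simp)
    rw [extChartAt_target_kruskalRegion]
    exact kruskalRegion.isOpen.mem_nhds hy
  have h1 : writtenInExtChartAt (𝓡 4) (𝓡 4) y (extChartAt (𝓡 4) p).symm =ᶠ[nhds y] id := by
    filter_upwards [kruskalRegion.isOpen.mem_nhds hy] with z hz
    simp only [writtenInExtChartAt, Function.comp_apply, extChartAt_kruskalRegion]
    exact extChartAt_symm_kruskalRegion p hz
  rw [hd.mfderiv]
  have h2 : fderivWithin ℝ (writtenInExtChartAt (𝓡 4) (𝓡 4) y (extChartAt (𝓡 4) p).symm)
      (Set.range (𝓡 4)) ((extChartAt (𝓡 4) y) y) = ContinuousLinearMap.id ℝ (Eu 4) := by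
    rw [ModelWithCorners.Boundaryless.range_eq_univ, fderivWithin_univ]
    exact (h1.fderiv_eq).trans fderiv_id
  exact DFunLike.congr_fun h2 v

theorem chartMetric_kruskalMetric {m : ℝ} (hm : 0 < m) (p : kruskalRegion) {y : Eu 4}
    (hy : y ∈ kruskalRegion) : chartMetric (kruskalMetric m) p y = kruskalMatrix m y := by
  ext a b
  rw [← kruskalForm_apply hm hy, chartMetric, Matrix.of_apply, kruskalMetric,
    mfderiv_extChartAt_symm_kruskalRegion p hy, mfderiv_extChartAt_symm_kruskalRegion p hy,
    extChartAt_symm_kruskalRegion p hy]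
  rfl

theorem metricAt_kruskalMetric {m : ℝ} (hm : 0 < m) (p : kruskalRegion) :
    metricAt (kruskalMetric m) p = kruskalMatrix m p := by
  rw [← chartMetric_self, extChartAt_kruskalRegion, chartMetric_kruskalMetric hm p p.2]

/-- `chartMetric` and `kruskalMatrix` agree only on the Kruskal region. Locality of derivatives
suffices, since the region is open. -/
theorem christoffel_congr {G G' : Eu 4 → Matrix (Fin 4) (Fin 4) ℝ} {U : Set (Eu 4)} (hU : IsOpen U)
    (h : ∀ y ∈ U, G y = G' y) {y : Eu 4} (hy : y ∈ U) (a b c : Fin 4) :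
    christoffel G a b c y = christoffel G' a b c y := by
  have hp := fun μ i j => pd_congr (f := fun y => G y i j) (f' := fun y => G' y i j) hU
    (fun z hz => by rw [h z hz]) hy μ
  simp only [christoffel, hp, h y hy]

theorem riemannUp_congr {G G' : Eu 4 → Matrix (Fin 4) (Fin 4) ℝ} {U : Set (Eu 4)} (hU : IsOpen U)
    (h : ∀ y ∈ U, G y = G' y) {y : Eu 4} (hy : y ∈ U) (a b c d : Fin 4) :
    riemannUp G a b c d y = riemannUp G' a b c d y := by
  have hp := fun μ i j k => pd_congr (f := christoffel G i j k) (f' := christoffel G' i j k) hU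
    (fun z hz => christoffel_congr hU h hz i j k) hy μ
  simp only [riemannUp, hp, christoffel_congr hU h hy]

theorem ricci_congr {G G' : Eu 4 → Matrix (Fin 4) (Fin 4) ℝ} {U : Set (Eu 4)} (hU : IsOpen U)
    (h : ∀ y ∈ U, G y = G' y) {y : Eu 4} (hy : y ∈ U) (a b : Fin 4) :
    ricci G a b y = ricci G' a b y := by
  simp only [ricci, riemannUp_congr hU h hy]

theorem weyl_congr {G G' : Eu 4 → Matrix (Fin 4) (Fin 4) ℝ} {U : Set (Eu 4)} (hU : IsOpen U)
    (h : ∀ y ∈ U, G y = G' y) {y : Eu 4} (hy : y ∈ U) : weyl G y = weyl G' y := by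
  funext α
  simp only [weyl, riemann, scalarCurv, ricci_congr hU h hy, riemannUp_congr hU h hy, h y hy]

/-- Smoothness and nondegeneracy are taken from the explicit components, so the local theory applies
to the Kruskal metric directly. -/
theorem metricOn_chartMetric_kruskalMetric {m : ℝ} (hm : 0 < m) (p : kruskalRegion) :
    MetricOn (chartMetric (kruskalMetric m) p) kruskalRegion where
  isOpen := kruskalRegion.isOpen
  smooth := fun μ ν => (contDiffOn_kruskalMatrix m μ ν).congr fun y hy => by
    rw [chartMetric_kruskalMetric hm p hy]
  symm := fun y hy μ ν => by
    rw [chartMetric_kruskalMetric hm p hy, kruskalMatrix_symm]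
  det_ne := fun y hy => by
    rw [chartMetric_kruskalMetric hm p hy]
    exact (isLorentzMatrix_kruskalMatrix hm hy).det_ne

theorem ricci_chartMetric_kruskalMetric {m : ℝ} (hm : 0 < m) (p : kruskalRegion) {y : Eu 4}
    (hy : y ∈ kruskalRegion) (μ ν : Fin 4) :
    ricci (chartMetric (kruskalMetric m) p) μ ν y = 0 := by
  rw [ricci_congr kruskalRegion.isOpen (fun z hz => chartMetric_kruskalMetric hm p hz) hy,
    ricci_kruskalMatrix hm hy]

/-- The scalar factor multiplies the whole tensor, so electric and magnetic parts and their
pull-backs inherit it by linearity, whatever the slice. -/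
theorem boxWeylAt_kruskalMetric {m : ℝ} (hm : 0 < m) (p : kruskalRegion) :
    boxWeylAt (kruskalMetric m) p
      = fun α => (-6 * m / radius m p ^ 3) * weylAt (kruskalMetric m) p α := by
  have hp : extChartAt (𝓡 4) p p ∈ kruskalRegion := by
    rw [extChartAt_kruskalRegion]; exact p.2
  have hα : -6 * m / radius m p ^ 3 = -6 * kMass m p := by
    have hx := kx_pos p.2
    rw [radius_eq m p.2.2, kMass, kxInv, ← kx]
    field_simp
    ring
  funext α
  rw [boxWeylAt, (metricOn_chartMetric_kruskalMetric hm p).box_weyl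
    (fun y hy => ricci_chartMetric_kruskalMetric hm p hy) hp, weylAt, chartMetric_kruskalMetric hm p hp,
    weyl_congr kruskalRegion.isOpen (fun z hz => chartMetric_kruskalMetric hm p hz) hp,
    boxQuad_kruskalMatrix hm hp, hα, extChartAt_kruskalRegion]

theorem electric_smul (g : Matrix (Fin 4) (Fin 4) ℝ) (n : Eu 4) (c : ℝ) (T : (Fin 4 → Fin 4) → ℝ) :
    electric g n (fun α => c * T α) = c • electric g n T := by
  ext a b
  simp only [electric, Matrix.of_apply, Matrix.smul_apply, smul_eq_mul, Finset.mul_sum, mul_assoc]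

theorem magnetic_smul (g : Matrix (Fin 4) (Fin 4) ℝ) (o : ℤˣ) (n : Eu 4) (c : ℝ)
    (T : (Fin 4 → Fin 4) → ℝ) :
    magnetic g o n (fun α => c * T α) = c • magnetic g o n T := by
  rw [magnetic, magnetic, ← electric_smul]
  congr 1
  funext α
  simp only [dual, Finset.mul_sum]
  exact sum4_congr fun i j k l => by ring

theorem pull_smul {M S : Type*} [TopologicalSpace M] [ChartedSpace (Eu 4) M] [TopologicalSpace S]
    [ChartedSpace (Eu 3) S] (φ : S → M) (s : S) (c : ℝ) (X : Matrix (Fin 4) (Fin 4) ℝ) :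
    pull φ s (c • X) = c • pull φ s X := by
  simp only [pull, Matrix.mul_smul, Matrix.smul_mul]

end

end GR

end

/-! ### Assembly of the vacuum and Schwarzschild statements. -/

theorem proposition2 :
    -- vacuum spacetimes
    (∀ (M : Type*) [TopologicalSpace M] [ChartedSpace (GR.Eu 4) M] [IsManifold (𝓡 4) ∞ M]
      (g : GR.BilinField 4 M), GR.IsLorentzMetric g → GR.IsVacuum g → ∀ o : M → ℤˣ,
      -- on spacetime
      (∀ (p : M) (n : TangentSpace (𝓡 4) p), g p n n = -1 →
        GR.tensorD g p n = GR.quadElectric (GR.metricAt g p)⁻¹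
          (GR.spatialMetric (GR.metricAt g p) n) (GR.tensorE g p n) (GR.tensorB g o p n) ∧
        GR.tensorH g o p n = GR.quadMagnetic (GR.metricAt g p)⁻¹
          (GR.spatialMetric (GR.metricAt g p) n) (GR.tensorE g p n) (GR.tensorB g o p n)) ∧
      -- on slices
      (∀ (S : Type*) [TopologicalSpace S] [ChartedSpace (GR.Eu 3) S] [IsManifold (𝓡 3) ∞ S]
        (φ : S → M) (n : ∀ s, TangentSpace (𝓡 4) (φ s)) (h K : GR.BilinField 3 S),
        GR.IsSlice g φ n h K → ∀ s : S,
        GR.sliceD g φ n s = GR.quadElectric (GR.dataMetric h s)⁻¹ (GR.dataMetric h s)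
          (GR.sliceE g φ n s) (GR.sliceB g o φ n s) ∧
        GR.sliceH g o φ n s = GR.quadMagnetic (GR.dataMetric h s)⁻¹ (GR.dataMetric h s)
          (GR.sliceE g φ n s) (GR.sliceB g o φ n s))) ∧
    -- Schwarzschildean data
    (∀ (m : ℝ), 0 < m → ∀ o : GR.kruskalRegion → ℤˣ,
      ∀ (S : Type*) [TopologicalSpace S] [ChartedSpace (GR.Eu 3) S] [IsManifold (𝓡 3) ∞ S]
        (φ : S → GR.kruskalRegion) (n : ∀ s, TangentSpace (𝓡 4) (φ s)) (h K : GR.BilinField 3 S),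
        GR.IsSlice (GR.kruskalMetric m) φ n h K → ∀ s : S,
        (GR.sliceD (GR.kruskalMetric m) φ n s
            = GR.quadElectric (GR.dataMetric h s)⁻¹ (GR.dataMetric h s)
                (GR.sliceE (GR.kruskalMetric m) φ n s) (GR.sliceB (GR.kruskalMetric m) o φ n s) ∧
          GR.sliceH (GR.kruskalMetric m) o φ n s
            = GR.quadMagnetic (GR.dataMetric h s)⁻¹ (GR.dataMetric h s)
                (GR.sliceE (GR.kruskalMetric m) φ n s) (GR.sliceB (GR.kruskalMetric m) o φ n s)) ∧
        (GR.sliceD (GR.kruskalMetric m) φ n s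
            = (-6 * m / GR.radius m (φ s) ^ 3) • GR.sliceE (GR.kruskalMetric m) φ n s ∧
          GR.sliceH (GR.kruskalMetric m) o φ n s
            = (-6 * m / GR.radius m (φ s) ^ 3) • GR.sliceB (GR.kruskalMetric m) o φ n s)) := by
  refine ⟨fun M _ _ _ g hg hv o => ?_, fun m hm o S _ _ _ φ n h K hS s => ?_⟩
  · have hL : ∀ p, GR.IsLorentzMatrix (GR.metricAt g p) := fun p => by
      rw [← GR.chartMetric_self]
      exact hg.isLorentzMatrix_chartMetric p (mem_extChartAt_target p)
    have hM := fun (p : M) n hn =>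
      GR.electric_magnetic_boxWeylAt (hg.metricOn p) (hL p) (hv p) o n hn
    exact ⟨hM, fun S _ _ _ φ n h K hS s =>
      hS.restrict s (hL _) o (hM _ _ (hS.normal_unit s))⟩
  -- The quadratic formulas come from the same pointwise lemmas as in the vacuum case, supplied with
  -- the coordinate facts about Kruskal; the proportionality is separate and uses only linearity.
  · have hL : GR.IsLorentzMatrix (GR.metricAt (GR.kruskalMetric m) (φ s)) := by
      rw [GR.metricAt_kruskalMetric hm]
      exact GR.isLorentzMatrix_kruskalMatrix hm (φ s).2
    refine ⟨hS.restrict s hL o (GR.electric_magnetic_boxWeylAt ?_ hL ?_ o _ (hS.normal_unit s)),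
      ?_, ?_⟩
    · rw [GR.extChartAt_target_kruskalRegion]
      exact GR.metricOn_chartMetric_kruskalMetric hm (φ s)
    · rw [GR.extChartAt_target_kruskalRegion]
      exact fun y hy => GR.ricci_chartMetric_kruskalMetric hm (φ s) hy
    · rw [GR.sliceD, GR.sliceE, GR.tensorD, GR.tensorE, GR.boxWeylAt_kruskalMetric hm]
      exact (congrArg _ (GR.electric_smul _ _ _ _)).trans (GR.pull_smul _ _ _ _)
    · rw [GR.sliceH, GR.sliceB, GR.tensorH, GR.tensorB, GR.boxWeylAt_kruskalMetric hm]
      exact (congrArg _ (GR.magnetic_smul _ _ _ _ _)).trans (GR.pull_smul _ _ _ _)
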